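/- For $h>0$ and a bounded measurable function $v$ on $\mathbb{R}^n$, let $$T_hv(x,\xi)=2^{-\frac n2}(\pi h)^{-\frac{3n}{4}}\int_{\mathbb{R}^n} e^{\frac ih (x-y)\cdot\xi-\frac1{2h}|x-y|^2}v(y)\,dy,\qquad x,\xi\in\mathbb{R}^n,$$ be the FBI transform of $v$. For a multi-index $\alpha\in\mathbb{N}^n$ write $(hD)^\alpha=(h/i)^{|\alpha|}\partial^\alpha$, and write $A\subset\subset B$ if the closure of $A$ is compact and contained in $B$. Let $X\subset\mathbb{R}^n$ be a (measurable) neighbourhood of $x_0\in\mathbb{R}^n$, let $h_0>0$, and let $u=u(h)\in L^\infty(X)$, $0<h\le h_0$, be a family of complex-valued functions such that $\|u(h)\|_{L^\infty(X)}=O(h^{-N})$ as $h\to0$ for some $N\in\mathbb{R}$. In (i), $u(h)$ is extended by $0$ outside $X$; in (ii) and (iii), $u(h)$ is identified with functions equal to it almost everywhere. Then the following are equivalent: (i) There exist an open neighbourhood $V\subset\subset X$ of $x_0$ and constants $C_0,C_1,\delta>0$ such that for all $0<\tilde h\le h\le h_0$, all $x\in V$ and all $\xi\in\mathbb{R}^n$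 with $|\xi|\ge C_0$, $$|T_{\tilde h}u(h)(x,\xi)|\le C_1e^{-\delta/\tilde h}\|u(h)\|_{L^\infty(X)}.$$ (ii) There exist an open neighbourhood $W\subset\subset X+i\mathbb{R}^n$ of $x_0$ in $\mathbb{C}^n$ and constants $C,C_2>0$ such that for every $0<h\le h_0$, $u(h)$ extends holomorphically to $W$ and $$\sup_W|u(h)|\le C_2e^{C/h}\|u(h)\|_{L^\infty(X)}.$$ (iii) There exist an open neighbourhood $U\subset\subset X$ of $x_0$ and a constant $C_3>0$ such that for every $0<h\le h_0$, $u(h)$ is smooth on $U$ and, for all $x\in U$ and all multi-indices $\alpha\in\mathbb{N}^n$, $$|(hD)^\alpha u(h)(x)|\le C_3^{|\alpha|}(1+h|\alpha|)^{|\alpha|}\|u(h)\|_{L^\infty(X)}.$$ -/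

import Mathlib

open MeasureTheory Set Filter Topology Asymptotics
open scoped ContDiff ENNReal

noncomputable section

namespace SemiclassicalCauchy

variable {n : ℕ}

/-- The standard FBI transform at scale `h`,
`T_h v (x, ξ) = 2^(-n/2) (π h)^(-3n/4) ∫ exp ((i/h) (x - y)·ξ - |x - y|²/(2h)) v(y) dy`.
It is only applied to bounded measurable `v`, for which the integral converges absolutely. -/
def fbi (h : ℝ) (v : EuclideanSpace ℝ (Fin n) → ℂ) (x ξ : EuclideanSpace ℝ (Fin n)) : ℂ :=
  (((2 : ℝ) ^ (-(n : ℝ) / 2) * (Real.pi * h) ^ (-(3 * (n : ℝ)) / 4) : ℝ) : ℂ) *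
    ∫ y, Complex.exp (Complex.I / (h : ℂ) * ((inner ℝ (x - y) ξ : ℝ) : ℂ)
      - ((‖x - y‖ ^ 2 / (2 * h) : ℝ) : ℂ)) * v y

/-- The norm of `v` in `L^∞(X)` (the essential supremum of `|v|` over `X`). -/
def supNorm (X : Set (EuclideanSpace ℝ (Fin n))) (v : EuclideanSpace ℝ (Fin n) → ℂ) : ℝ :=
  (eLpNorm v ∞ (volume.restrict X)).toReal

/-- `A ⊂⊂ B`: the closure of `A` is compact and contained in `B`. -/
def CompactlyContained {E : Type*} [TopologicalSpace E] (A B : Set E) : Prop :=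
  IsCompact (closure A) ∧ closure A ⊆ B

/-- The inclusion of `ℝⁿ` into `ℂⁿ`. -/
def toComplex (x : EuclideanSpace ℝ (Fin n)) : EuclideanSpace ℂ (Fin n) :=
  WithLp.toLp 2 (fun j => (x j : ℂ))

/-- The componentwise real part `ℂⁿ → ℝⁿ`. -/
def rePart (z : EuclideanSpace ℂ (Fin n)) : EuclideanSpace ℝ (Fin n) :=
  WithLp.toLp 2 (fun j => (z j).re)

/-- The set `X + i ℝⁿ` in `ℂⁿ`. -/
def tube (X : Set (EuclideanSpace ℝ (Fin n))) : Set (EuclideanSpace ℂ (Fin n)) :=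
  {z | rePart z ∈ X}

/-- `h D_j = (h / i) ∂_j`. -/
def hD (h : ℝ) (j : Fin n) (v : EuclideanSpace ℝ (Fin n) → ℂ) :
    EuclideanSpace ℝ (Fin n) → ℂ :=
  fun x => ((h : ℂ) / Complex.I) * fderiv ℝ v x (EuclideanSpace.single j 1)

/-- `(h D)^α = (h D_1)^(α_1) ∘ ⋯ ∘ (h D_n)^(α_n)` for a multi-index `α`. -/
def hDPow (h : ℝ) (α : Fin n → ℕ) (v : EuclideanSpace ℝ (Fin n) → ℂ) :
    EuclideanSpace ℝ (Fin n) → ℂ :=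
  (List.finRange n).foldr (fun j w => (hD h j)^[α j] w) v

/-- Uniform exponential decay of the FBI transforms `T_{h'} u(h)`, `0 < h' ≤ h ≤ h₀`,
for `x` near `x₀` and large `|ξ|`; `u(h)` is extended by zero outside `X`. -/
def FBIDecay (X : Set (EuclideanSpace ℝ (Fin n))) (x₀ : EuclideanSpace ℝ (Fin n)) (h₀ : ℝ)
    (u : ℝ → EuclideanSpace ℝ (Fin n) → ℂ) : Prop :=
  ∃ V : Set (EuclideanSpace ℝ (Fin n)), IsOpen V ∧ x₀ ∈ V ∧ CompactlyContained V X ∧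
    ∃ C₀ C₁ δ : ℝ, 0 < C₀ ∧ 0 < C₁ ∧ 0 < δ ∧
      ∀ h' h : ℝ, 0 < h' → h' ≤ h → h ≤ h₀ → ∀ x ∈ V, ∀ ξ : EuclideanSpace ℝ (Fin n),
        C₀ ≤ ‖ξ‖ →
          ‖fbi h' (X.indicator (u h)) x ξ‖ ≤ C₁ * Real.exp (-δ / h') * supNorm X (u h)

/-- Holomorphic extension of every `u(h)` to a fixed complex neighbourhood `W` of `x₀`, with
exponential bounds. As `u(h)` is an element of `L^∞(X)`, it is compared with the restriction of
the extension to the real points of `W` almost everywhere. -/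
def HolomorphicExtension (X : Set (EuclideanSpace ℝ (Fin n))) (x₀ : EuclideanSpace ℝ (Fin n))
    (h₀ : ℝ) (u : ℝ → EuclideanSpace ℝ (Fin n) → ℂ) : Prop :=
  ∃ W : Set (EuclideanSpace ℂ (Fin n)), IsOpen W ∧ toComplex x₀ ∈ W ∧
    CompactlyContained W (tube X) ∧
    ∃ C C₂ : ℝ, 0 < C ∧ 0 < C₂ ∧
      ∀ h : ℝ, 0 < h → h ≤ h₀ →
        ∃ F : EuclideanSpace ℂ (Fin n) → ℂ, DifferentiableOn ℂ F W ∧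
          (∀ᵐ x : EuclideanSpace ℝ (Fin n), toComplex x ∈ W → F (toComplex x) = u h x) ∧
          ∀ z ∈ W, ‖F z‖ ≤ C₂ * Real.exp (C / h) * supNorm X (u h)

/-- The semiclassical Cauchy estimates near `x₀`: every `u(h)` is smooth on a fixed neighbourhood
`U` of `x₀` (agrees almost everywhere on `U` with a smooth `v`), with the stated bounds on its
derivatives at every point of `U`. -/
def CauchyEstimates (X : Set (EuclideanSpace ℝ (Fin n))) (x₀ : EuclideanSpace ℝ (Fin n))
    (h₀ : ℝ) (u : ℝ → EuclideanSpace ℝ (Fin n) → ℂ) : Prop :=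
  ∃ U : Set (EuclideanSpace ℝ (Fin n)), IsOpen U ∧ x₀ ∈ U ∧ CompactlyContained U X ∧
    ∃ C₃ : ℝ, 0 < C₃ ∧
      ∀ h : ℝ, 0 < h → h ≤ h₀ →
        ∃ v : EuclideanSpace ℝ (Fin n) → ℂ, ContDiffOn ℝ ∞ v U ∧
          (∀ᵐ x : EuclideanSpace ℝ (Fin n), x ∈ U → v x = u h x) ∧
          ∀ (α : Fin n → ℕ), ∀ x ∈ U,
            ‖hDPow h α v x‖ ≤
              C₃ ^ (∑ j, α j) * (1 + h * ((∑ j, α j : ℕ) : ℝ)) ^ (∑ j, α j) * supNorm X (u h)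

end SemiclassicalCauchy

end

/-! Everything passes through the holomorphic extension (ii). On real points the extension F is
bounded by A = ‖u(h)‖ with no exponential loss, and on complex points by a constant times A e^{C/h}.
The two-constants principle interpolates between the two and gives |F(z)| ≤ A e^{κ|Im z|/h} near x₀
(`HolomorphicExtension.exists_bound`). Both implications out of (ii) rest on this bound.

(ii) ⇒ (iii): with k = |α|, spend k successive Cauchy estimates over a total distance s = min(hk,
r). The growth costs e^{κs/h} ≤ e^{κk}, and the radii give (hk/s)^k, which is at most a constant to
the power k times (1 + hk)^k. (iii) ⇒ (ii): (1/h + k)^k ≤ e^{1/h} e^k k!, so u(h)/e^{1/h} satisfies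
ordinary analytic estimates with constants independent of h, and its Taylor series at x₀ converges
on a fixed complex ball.

(ii) ⇒ (i): in the FBI integral, move y to y − iθ(y) ξ/|ξ| near x₀ (`integral_contour_shift`). The
kernel gains e^{−θ|ξ|/h'} while F loses only e^{κθ/h} ≤ e^{κθ/h'}, so |ξ| ≥ κ + 1 leaves decay. Away
from x₀ the Gaussian decays by itself.

(i) ⇒ (ii): let χ be a frequency cutoff equal to 1 on |ξ| < C₀, and consider F_t(z) = t^{-n} ∫∫ χ(ξ)
e^{(i(z−y)·ξ − (z−y)²/2)/t} u(y) dy dξ. As t → 0, F_t tends weakly to (2π)^n u on the reals, by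
Fourier inversion. The kernel k satisfies ∂_t(t^{-n}k) = −(1/t) div_ξ(ξ t^{-n}k) − ½Δ_ξ(t^{-n}k).
Hence after integration by parts ∂_t F_t involves only derivatives of χ (`integral_evolution`), that
is, frequencies C₀ ≤ |ξ| ≤ C₀ + 1, where (i) applies at every scale t ≤ h. The decay persists at
nearby complex z by two constants again. So ∂_t F_t is bounded on 0 < t ≤ h uniformly in z, and F_t
converges uniformly to a holomorphic limit, which differs by O(h)A from F_h. The latter is trivially
O(e^{C/h})A. -/

namespace SemiclassicalCauchy

/-! ### Holomorphic functions on open subsets of a complex normed space: Cauchy estimates, limits,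
parameter integrals. -/

section SeveralComplexVariables

variable {E : Type*} [NormedAddCommGroup E] [NormedSpace ℂ E]

/-- Restricting a function to a complex line. -/
theorem hasDerivAt_comp_line {f : E → ℂ} {W : Set E} (hW : IsOpen W) (hf : DifferentiableOn ℂ f W)
    (z y : E) {ζ : ℂ} (hζ : z + ζ • y ∈ W) :
    HasDerivAt (fun ζ : ℂ => f (z + ζ • y)) (fderiv ℂ f (z + ζ • y) y) ζ := by
  have h1 : HasFDerivAt f (fderiv ℂ f (z + ζ • y)) (z + ζ • y) :=
    (hf.differentiableAt (hW.mem_nhds hζ)).hasFDerivAt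
  have h2 : HasDerivAt (fun ζ : ℂ => z + ζ • y) y ζ := by
    simpa using ((hasDerivAt_id ζ).smul_const y).const_add z
  exact h1.comp_hasDerivAt ζ h2

/-- The Cauchy estimate for the first derivative. -/
theorem norm_fderiv_apply_le {f : E → ℂ} {W : Set E} (hW : IsOpen W)
    (hf : DifferentiableOn ℂ f W) {z : E} {r M : ℝ} (hr : 0 < r)
    (hsub : Metric.closedBall z r ⊆ W) (hM : ∀ w ∈ Metric.closedBall z r, ‖f w‖ ≤ M) (y : E) :
    ‖fderiv ℂ f z y‖ ≤ M / r * ‖y‖ := by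
  rcases eq_or_ne y 0 with rfl | hy
  · simp
  have hy' : 0 < ‖y‖ := norm_pos_iff.mpr hy
  have hmem : ∀ ζ ∈ Metric.closedBall (0 : ℂ) (r / ‖y‖), z + ζ • y ∈ Metric.closedBall z r := by
    intro ζ hζ
    rw [mem_closedBall_zero_iff] at hζ
    rw [mem_closedBall_iff_norm, add_sub_cancel_left, norm_smul]
    rwa [le_div_iff₀ hy'] at hζ
  have hd : ∀ ζ ∈ Metric.closedBall (0 : ℂ) (r / ‖y‖),
      HasDerivAt (fun ζ : ℂ => f (z + ζ • y)) (fderiv ℂ f (z + ζ • y) y) ζ := fun ζ hζ =>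
    hasDerivAt_comp_line hW hf z y (hsub (hmem ζ hζ))
  have hdc : DiffContOnCl ℂ (fun ζ : ℂ => f (z + ζ • y)) (Metric.ball 0 (r / ‖y‖)) := by
    apply DifferentiableOn.diffContOnCl_ball (U := Metric.closedBall 0 (r / ‖y‖)) _ subset_rfl
    exact fun ζ hζ => (hd ζ hζ).differentiableAt.differentiableWithinAt
  have h := Complex.norm_deriv_le_of_forall_mem_sphere_norm_le (by positivity) hdc
    (C := M) (fun ζ hζ => hM _ (hmem ζ (Metric.sphere_subset_closedBall hζ)))
  have h0 := (hd 0 (Metric.mem_closedBall_self (by positivity))).deriv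
  rw [h0, zero_smul, add_zero] at h
  calc _ ≤ _ := h
    _ = _ := by field_simp

theorem norm_fderiv_le {f : E → ℂ} {W : Set E} (hW : IsOpen W)
    (hf : DifferentiableOn ℂ f W) {z : E} {r M : ℝ} (hr : 0 < r)
    (hsub : Metric.closedBall z r ⊆ W) (hM : ∀ w ∈ Metric.closedBall z r, ‖f w‖ ≤ M) :
    ‖fderiv ℂ f z‖ ≤ M / r := by
  have : 0 ≤ M := (norm_nonneg _).trans (hM z (Metric.mem_closedBall_self hr.le))
  exact ContinuousLinearMap.opNorm_le_bound _ (by positivity)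
    (norm_fderiv_apply_le hW hf hr hsub hM)

/-- A uniform limit of holomorphic functions on an open set is holomorphic. -/
theorem differentiableOn_of_tendstoUniformlyOn {f : ℕ → E → ℂ} {g : E → ℂ} {W : Set E} (hW : IsOpen W)
    (hf : ∀ k, DifferentiableOn ℂ (f k) W)
    (hg : TendstoUniformlyOn f g atTop W) : DifferentiableOn ℂ g W := by
  intro z hz
  obtain ⟨r, hr, hrW⟩ := Metric.isOpen_iff.1 hW z hz
  have hcb : ∀ w ∈ Metric.ball z (r / 2), Metric.closedBall w (r / 4) ⊆ W := by
    intro w hw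
    refine (Metric.closedBall_subset_ball' ?_).trans hrW
    rw [Metric.mem_ball] at hw
    linarith
  have hu : UniformCauchySeqOn (fun k => fderiv ℂ (f k)) atTop (Metric.ball z (r / 2)) := by
    rw [Metric.uniformCauchySeqOn_iff]
    intro ε hε
    obtain ⟨K, hK⟩ := Metric.uniformCauchySeqOn_iff.1 hg.uniformCauchySeqOn (ε / 2 * (r / 4))
      (by positivity)
    refine ⟨K, fun k hk l hl w hw => ?_⟩
    have hwW : w ∈ W := hcb w hw (Metric.mem_closedBall_self (by positivity))
    have hdk := (hf k).differentiableAt (hW.mem_nhds hwW)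
    have hdl := (hf l).differentiableAt (hW.mem_nhds hwW)
    rw [dist_eq_norm, ← fderiv_sub hdk hdl]
    have := norm_fderiv_le hW ((hf k).sub (hf l)) (z := w) (r := r / 4) (M := ε / 2 * (r / 4))
      (by positivity) (hcb w hw) (fun v hv => by
        simpa [dist_eq_norm] using (hK k hk l hl v (hcb w hw hv)).le)
    rw [mul_div_cancel_right₀ _ (by positivity)] at this
    exact this.trans_lt (by linarith)
  have hlim : ∀ w ∈ Metric.ball z (r / 2), ∃ L, Tendsto (fun k => fderiv ℂ (f k) w) atTop (𝓝 L) := by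
    intro w hw
    exact cauchySeq_tendsto_of_complete (hu.cauchySeq hw)
  choose! L hL using hlim
  have hul := hu.tendstoUniformlyOn_of_tendsto hL
  have := hasFDerivAt_of_tendstoUniformlyOn Metric.isOpen_ball hul
    (f := f) (g := g) (fun k w hw => ((hf k).differentiableAt (hW.mem_nhds
      (hcb w hw (Metric.mem_closedBall_self (by positivity))))).hasFDerivAt)
    (fun w hw => hg.tendsto_at (hcb w hw (Metric.mem_closedBall_self (by positivity))))
    (x := z) (Metric.mem_ball_self (by positivity))
  exact this.differentiableAt.differentiableWithinAt

variable {n : ℕ}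

/-- Reduces measurability of a family of functionals to that of its finitely many coordinates. -/
theorem clm_eq_sum_smulRight (T : EuclideanSpace ℂ (Fin n) →L[ℂ] ℂ) :
    T = ∑ j, (EuclideanSpace.proj j : EuclideanSpace ℂ (Fin n) →L[ℂ] ℂ).smulRight
      (T (EuclideanSpace.single j 1)) := by
  ext z
  simp only [sum_apply, ContinuousLinearMap.smulRight_apply, PiLp.proj_apply, smul_eq_mul]
  have hz : z = ∑ j, z j • (EuclideanSpace.single j (1 : ℂ) : EuclideanSpace ℂ (Fin n)) := by
    ext i
    simp [Finset.sum_apply, Pi.single_apply]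
  conv_lhs => rw [hz]
  simp

/-- The integral of a dominated family of holomorphic functions is holomorphic. -/
theorem differentiableOn_integral {α : Type*} [MeasurableSpace α] {μ : Measure α}
    {f : EuclideanSpace ℂ (Fin n) → α → ℂ} {W : Set (EuclideanSpace ℂ (Fin n))} (hW : IsOpen W)
    {b : α → ℝ} (hb : Integrable b μ) (hm : ∀ z ∈ W, AEStronglyMeasurable (f z) μ)
    (hf : ∀ a, DifferentiableOn ℂ (fun z => f z a) W)
    (hfb : ∀ z ∈ W, ∀ a, ‖f z a‖ ≤ b a) :
    DifferentiableOn ℂ (fun z => ∫ a, f z a ∂μ) W := by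
  intro z hz
  obtain ⟨r, hr, hrW⟩ := Metric.isOpen_iff.1 hW z hz
  have hcb : ∀ w ∈ Metric.ball z (r / 2), Metric.closedBall w (r / 4) ⊆ W := by
    intro w hw
    refine (Metric.closedBall_subset_ball' ?_).trans hrW
    rw [Metric.mem_ball] at hw
    linarith
  have hbW : ∀ w ∈ Metric.ball z (r / 2), w ∈ W := fun w hw =>
    hcb w hw (Metric.mem_closedBall_self (by positivity))
  have hd : ∀ a, ∀ w ∈ W, HasFDerivAt (fun z => f z a) (fderiv ℂ (fun z => f z a) w) w :=
    fun a w hw => ((hf a).differentiableAt (hW.mem_nhds hw)).hasFDerivAt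
  -- Each partial derivative is the pointwise limit of the difference quotients with step 1/k.
  -- Shifting the index by N keeps all base points in W, where measurability is assumed.
  have hcomp : ∀ j : Fin n, AEStronglyMeasurable
      (fun a => fderiv ℂ (fun z => f z a) z (EuclideanSpace.single j 1)) μ := by
    intro j
    have hc : Tendsto (fun k : ℕ => ‖(k : ℂ)‖) atTop atTop := by
      simpa using tendsto_natCast_atTop_atTop (R := ℝ)
    have hin : Tendsto (fun k : ℕ => z + ((k : ℂ))⁻¹ •
        (EuclideanSpace.single j (1 : ℂ) : EuclideanSpace ℂ (Fin n))) atTop (𝓝 z) := by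
      simpa using (tendsto_inv_atTop_nhds_zero_nat (𝕜 := ℂ)).smul_const
        (EuclideanSpace.single j (1 : ℂ) : EuclideanSpace ℂ (Fin n)) |>.const_add z
    obtain ⟨N, hN⟩ := eventually_atTop.1 (hin.eventually (hW.mem_nhds hz))
    refine aestronglyMeasurable_of_tendsto_ae (u := atTop) (f := fun (k : ℕ) a =>
      ((k + N : ℕ) : ℂ) • (f (z + (((k + N : ℕ) : ℂ))⁻¹ •
        (EuclideanSpace.single j (1 : ℂ) : EuclideanSpace ℂ (Fin n))) a - f z a)) ?_ ?_
    · intro k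
      exact ((hm _ (hN (k + N) (Nat.le_add_left N k))).sub (hm z hz)).const_smul ((k + N : ℕ) : ℂ)
    · refine ae_of_all _ fun a => ?_
      exact ((hd a z hz).lim (EuclideanSpace.single j (1 : ℂ)) hc).comp (tendsto_add_atTop_nat N)
  have hF' : AEStronglyMeasurable (fun a => fderiv ℂ (fun z => f z a) z) μ := by
    have : (fun a => fderiv ℂ (fun z => f z a) z) = fun a => ∑ j,
      (EuclideanSpace.proj j : EuclideanSpace ℂ (Fin n) →L[ℂ] ℂ).smulRight
        (fderiv ℂ (fun z => f z a) z (EuclideanSpace.single j 1)) := by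
      ext1 a
      exact clm_eq_sum_smulRight _
    rw [this]
    refine Finset.aestronglyMeasurable_fun_sum _ fun j _ => ?_
    exact (ContinuousLinearMap.smulRightL ℂ (EuclideanSpace ℂ (Fin n)) ℂ
      (EuclideanSpace.proj j)).continuous.comp_aestronglyMeasurable (hcomp j)
  have hbound : ∀ a, ∀ w ∈ Metric.ball z (r / 2),
      ‖fderiv ℂ (fun z => f z a) w‖ ≤ b a / (r / 4) := fun a w hw =>
    norm_fderiv_le hW (hf a) (by positivity) (hcb w hw) (fun v hv => hfb v (hcb w hw hv) a)
  have := hasFDerivAt_integral_of_dominated_of_fderiv_le (𝕜 := ℂ) (μ := μ)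
    (F := f) (F' := fun w a => fderiv ℂ (fun z => f z a) w) (x₀ := z)
    (bound := fun a => b a / (r / 4)) (Metric.ball_mem_nhds z (half_pos hr))
    (eventually_of_mem (hW.mem_nhds hz) hm)
    (hb.mono' (hm z hz) (ae_of_all _ fun a => hfb z hz a)) hF'
    (ae_of_all _ fun a w hw => hbound a w hw) (hb.div_const _)
    (ae_of_all _ fun a w hw => hd a w (hbW w hw))
  exact this.differentiableAt.differentiableWithinAt

end SeveralComplexVariables

/-! ### Smoothness of holomorphic functions of several variables. -/

section SeveralComplexVariables

variable {n : ℕ}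

/-- Directional derivatives of holomorphic functions of several variables are holomorphic. -/
theorem differentiableOn_fderiv_apply {f : EuclideanSpace ℂ (Fin n) → ℂ}
    {W : Set (EuclideanSpace ℂ (Fin n))} (hW : IsOpen W) (hf : DifferentiableOn ℂ f W)
    (y : EuclideanSpace ℂ (Fin n)) : DifferentiableOn ℂ (fun z => fderiv ℂ f z y) W := by
  intro z hz
  obtain ⟨r, hr, hrW⟩ := Metric.nhds_basis_closedBall.mem_iff.1 (hW.mem_nhds hz)
  obtain ⟨M, hM⟩ := (isCompact_closedBall z r).exists_bound_of_continuousOn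
    (hf.continuousOn.mono hrW)
  -- The +1 keeps ρ meaningful when y = 0. The complex disc of radius ρ in direction y stays in the
  -- closed r-ball for every centre in the ball of radius r/2, so a single circle serves all these
  -- centres and the Cauchy integral is holomorphic in the centre.
  set ρ : ℝ := r / 2 / (‖y‖ + 1) with hρdef
  have hρ : 0 < ρ := by positivity
  have hρy : ρ * ‖y‖ ≤ r / 2 := by
    rw [hρdef, div_mul_eq_mul_div, div_le_iff₀ (by positivity)]
    gcongr
    linarith
  have hmem : ∀ w ∈ Metric.ball z (r / 2), ∀ ζ : ℂ, ‖ζ‖ ≤ ρ →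
      w + ζ • y ∈ Metric.closedBall z r := by
    intro w hw ζ hζ
    rw [mem_ball_iff_norm] at hw
    rw [mem_closedBall_iff_norm]
    calc ‖w + ζ • y - z‖ = ‖(w - z) + ζ • y‖ := by congr 1; abel
      _ ≤ ‖w - z‖ + ‖ζ‖ * ‖y‖ := (norm_add_le _ _).trans (by rw [norm_smul])
      _ ≤ r / 2 + ρ * ‖y‖ := by gcongr
      _ ≤ r := by linarith
  have hcirc : ∀ θ : ℝ, ‖circleMap 0 ρ θ‖ = ρ := fun θ => by simp [hρ.le]
  have key : DifferentiableOn ℂ (fun w => ∫ θ in Ioc 0 (2 * Real.pi), deriv (circleMap 0 ρ) θ •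
      ((1 / (circleMap 0 ρ θ - 0) ^ 2) • f (w + circleMap 0 ρ θ • y))) (Metric.ball z (r / 2)) := by
    refine differentiableOn_integral Metric.isOpen_ball (b := fun _ => ρ * (1 / ρ ^ 2 * M))
      ?_ ?_ ?_ ?_
    · exact integrable_const _
    · intro w hw
      apply Continuous.aestronglyMeasurable
      have h1 : Continuous fun θ : ℝ => f (w + circleMap 0 ρ θ • y) := by
        refine hf.continuousOn.comp_continuous ?_ fun θ => hrW (hmem w hw _ (hcirc θ).le)
        fun_prop
      have h2 : Continuous fun θ : ℝ => deriv (circleMap 0 ρ) θ := by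
        simp only [deriv_circleMap]
        fun_prop
      have h3 : Continuous fun θ : ℝ => 1 / (circleMap 0 ρ θ - 0) ^ 2 := by
        refine continuous_const.div (by fun_prop) fun θ h => ?_
        have := hcirc θ
        rw [sub_zero] at h
        rw [pow_eq_zero_iff two_ne_zero] at h
        rw [h, norm_zero] at this
        exact hρ.ne this
      exact h2.smul (h3.smul h1)
    · intro θ
      refine ((hf.comp (f := fun w => w + circleMap 0 ρ θ • y) (s := Metric.ball z (r / 2))
        (by fun_prop) fun w hw => hrW (hmem w hw _ (hcirc θ).le)).const_smul
          (1 / (circleMap 0 ρ θ - 0) ^ 2)).const_smul (deriv (circleMap 0 ρ) θ)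
    · intro w hw θ
      rw [norm_smul, norm_smul, norm_div, norm_pow, sub_zero, hcirc, norm_one, deriv_circleMap,
        norm_mul, hcirc, Complex.norm_I, mul_one]
      gcongr
      exact hM _ (hmem w hw _ (hcirc θ).le)
  have heq : ∀ w ∈ Metric.ball z (r / 2), fderiv ℂ f w y = (2 * Real.pi * Complex.I : ℂ)⁻¹ •
      ∫ θ in Ioc 0 (2 * Real.pi), deriv (circleMap 0 ρ) θ •
      ((1 / (circleMap 0 ρ θ - 0) ^ 2) • f (w + circleMap 0 ρ θ • y)) := by
    intro w hw
    have hd : ∀ ζ ∈ Metric.closedBall (0 : ℂ) ρ,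
        HasDerivAt (fun ζ : ℂ => f (w + ζ • y)) (fderiv ℂ f (w + ζ • y) y) ζ := fun ζ hζ =>
      hasDerivAt_comp_line hW hf w y (hrW (hmem w hw ζ (mem_closedBall_zero_iff.1 hζ)))
    have h1 := DifferentiableOn.deriv_eq_smul_circleIntegral hρ (c := 0)
      (f := fun ζ : ℂ => f (w + ζ • y))
      fun ζ hζ => (hd ζ hζ).differentiableAt.differentiableWithinAt
    have h0 := (hd 0 (Metric.mem_closedBall_self hρ.le)).deriv
    rw [h0, zero_smul, add_zero, circleIntegral,
      intervalIntegral.integral_of_le (by positivity)] at h1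
    rw [h1, smul_smul, inv_mul_cancel₀ Complex.two_pi_I_ne_zero, one_smul]
  have := (key.const_smul (2 * Real.pi * Complex.I : ℂ)⁻¹).congr heq
  exact (this.differentiableAt (Metric.ball_mem_nhds z (half_pos hr))).differentiableWithinAt

/-- Holomorphic functions of several variables are smooth. -/
theorem contDiffOn_of_differentiableOn {f : EuclideanSpace ℂ (Fin n) → ℂ}
    {W : Set (EuclideanSpace ℂ (Fin n))} (hW : IsOpen W) (hf : DifferentiableOn ℂ f W) (m : ℕ) :
    ContDiffOn ℂ m f W := by
  induction m generalizing f with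
  | zero => exact contDiffOn_zero.2 hf.continuousOn
  | succ m ih =>
    push_cast
    rw [contDiffOn_succ_iff_fderiv_of_isOpen hW]
    refine ⟨hf, by simp, ?_⟩
    exact contDiffOn_clm_apply.2 fun y => ih (differentiableOn_fderiv_apply hW hf y)

end SeveralComplexVariables

/-! ### The two-constants principle, and real and imaginary parts in ℂⁿ. -/

section TwoConstants

/-- A two-constants theorem for a half-disc. -/
theorem two_constants {f : ℂ → ℂ} {r A L t : ℝ} (hr : 0 < r)
    (hf : DifferentiableOn ℂ f (Metric.closedBall 0 (2 * r))) (hL : 0 ≤ L)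
    (hM : ∀ ζ ∈ Metric.closedBall (0 : ℂ) (2 * r), ‖f ζ‖ ≤ A * Real.exp L)
    (hA : ∀ s : ℝ, |s| ≤ r → ‖f s‖ ≤ A) (ht : 0 ≤ t) (htr : t ≤ r) :
    ‖f (t * Complex.I)‖ ≤ A * Real.exp (2 * t * L / r) := by
  have hA0 : 0 ≤ A := (norm_nonneg _).trans (hA 0 (by simpa using hr.le))
  -- For ζ = x + iy one has Re q = −L((x² − y²)/r² + 2y/r). This is at most 0 on the real segment,
  -- and at most −L on the other three sides of the rectangle |x| ≤ r, 0 ≤ y ≤ r. Thus f e^q is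
  -- bounded by A on the whole boundary, and at ζ = it the weight costs at most e^{2tL/r}.
  set q : ℂ → ℂ := fun ζ => -(L : ℂ) * (ζ ^ 2 / (r : ℂ) ^ 2 - 2 * Complex.I * ζ / r) with hq
  have hqre : ∀ ζ, (q ζ).re = -L * ((ζ.re ^ 2 - ζ.im ^ 2) / r ^ 2 + 2 * ζ.im / r) := by
    intro ζ
    have h1 : q ζ = ((-L : ℝ) : ℂ) * (ζ ^ 2 / ((r ^ 2 : ℝ) : ℂ) - 2 * Complex.I * ζ / (r : ℝ)) := by
      simp [hq]
    rw [h1, Complex.re_ofReal_mul, Complex.sub_re, Complex.div_ofReal_re, Complex.div_ofReal_re,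
      pow_two, Complex.mul_re]
    simp
    ring_nf
    tauto
  set U : Set ℂ := Ioo (-r) r ×ℂ Ioo 0 r with hU
  have hcl : closure U = Icc (-r) r ×ℂ Icc 0 r := by
    rw [hU, Complex.closure_reProdIm, closure_Ioo (by linarith), closure_Ioo hr.ne]
  have hsub : closure U ⊆ Metric.closedBall (0 : ℂ) (2 * r) := by
    intro ζ hζ
    rw [hcl, Complex.mem_reProdIm] at hζ
    rw [mem_closedBall_zero_iff]
    calc ‖ζ‖ ≤ |ζ.re| + |ζ.im| := Complex.norm_le_abs_re_add_abs_im ζ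
      _ ≤ r + r := add_le_add (abs_le.2 hζ.1) (abs_le.2 ⟨by linarith [hζ.2.1], hζ.2.2⟩)
      _ = 2 * r := by ring
  have hg : DiffContOnCl ℂ (fun ζ => f ζ * Complex.exp (q ζ)) U := by
    apply DifferentiableOn.diffContOnCl
    refine (hf.mono hsub).mul ?_
    apply Differentiable.differentiableOn
    simp only [hq]
    fun_prop
  have hbd : Bornology.IsBounded U :=
    Metric.isBounded_closedBall.subset (subset_closure.trans hsub)
  have hfr : ∀ ζ ∈ frontier U, ‖f ζ * Complex.exp (q ζ)‖ ≤ A := by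
    intro ζ hζ
    have hζc := frontier_subset_closure hζ
    have hζc' := hζc
    rw [hcl, Complex.mem_reProdIm] at hζc
    obtain ⟨⟨h1, h2⟩, h3, h4⟩ := hζc
    rw [norm_mul, Complex.norm_exp, hqre]
    have hx2 : ζ.re ^ 2 ≤ r ^ 2 := sq_le_sq' h1 h2
    have hside : ζ.im = 0 ∨
        1 ≤ (ζ.re ^ 2 - ζ.im ^ 2) / r ^ 2 + 2 * ζ.im / r := by
      have hnot : ζ ∉ U := by
        have : IsOpen U := isOpen_Ioo.reProdIm isOpen_Ioo
        rw [this.frontier_eq] at hζ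
        exact hζ.2
      have hrw : (ζ.re ^ 2 - ζ.im ^ 2) / r ^ 2 + 2 * ζ.im / r =
          (ζ.re ^ 2 - ζ.im ^ 2 + 2 * ζ.im * r) / r ^ 2 := by field_simp
      by_cases h0 : ζ.im = 0
      · exact Or.inl h0
      right
      rw [hrw, le_div_iff₀ (by positivity), one_mul]
      have h3' : 0 < ζ.im := lt_of_le_of_ne h3 (Ne.symm h0)
      by_cases h5 : ζ.im = r
      · rw [h5]; nlinarith [sq_nonneg ζ.re]
      have h4' : ζ.im < r := lt_of_le_of_ne h4 h5
      have h6 : ζ.re ^ 2 = r ^ 2 := by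
        by_contra hne
        have : ζ.re ^ 2 < r ^ 2 := lt_of_le_of_ne hx2 hne
        have := abs_lt_of_sq_lt_sq' this hr.le
        exact hnot (Complex.mem_reProdIm.2 ⟨this, h3', h4'⟩)
      nlinarith
    rcases hside with h | h
    · have hreal : ζ = (ζ.re : ℂ) := by
        apply Complex.ext <;> simp [h]
      have h5 := hA ζ.re (abs_le.2 ⟨h1, h2⟩)
      rw [← hreal] at h5
      rw [h]
      have : Real.exp (-L * ((ζ.re ^ 2 - 0 ^ 2) / r ^ 2 + 2 * 0 / r)) ≤ 1 := by
        rw [Real.exp_le_one_iff]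
        have : 0 ≤ (ζ.re ^ 2 - 0 ^ 2) / r ^ 2 + 2 * 0 / r := by
          simp only [ne_eq, OfNat.ofNat_ne_zero, not_false_eq_true, zero_pow, sub_zero, mul_zero,
            zero_div, add_zero]
          positivity
        nlinarith
      calc _ ≤ A * 1 := by gcongr
        _ = A := mul_one A
    · calc _ ≤ (A * Real.exp L) * Real.exp (-L) := by
            gcongr
            · exact hM ζ (hsub hζc')
            · nlinarith
        _ = A := by rw [mul_assoc, ← Real.exp_add]; simp
  have hmem : (t * Complex.I : ℂ) ∈ closure U := by
    rw [hcl, Complex.mem_reProdIm]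
    simp [hr.le, ht, htr]
  have hmax := Complex.norm_le_of_forall_mem_frontier_norm_le hbd hg hfr hmem
  rw [norm_mul, Complex.norm_exp, hqre] at hmax
  simp only [Complex.mul_re, Complex.ofReal_re, Complex.I_re, Complex.ofReal_im, Complex.I_im,
    Complex.mul_im, mul_zero, sub_zero, mul_one, add_zero] at hmax
  rw [← le_div_iff₀ (Real.exp_pos _), div_eq_mul_inv, ← Real.exp_neg] at hmax
  refine hmax.trans ?_
  gcongr
  have : 0 ≤ L * (t ^ 2 / r ^ 2) := by positivity
  calc _ = 2 * t * L / r - L * (t ^ 2 / r ^ 2) := by ring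
    _ ≤ _ := by linarith

variable {n : ℕ}

@[simp] theorem toComplex_apply (x : EuclideanSpace ℝ (Fin n)) (j : Fin n) :
    toComplex x j = (x j : ℂ) := rfl

@[simp] theorem rePart_apply (z : EuclideanSpace ℂ (Fin n)) (j : Fin n) :
    rePart z j = (z j).re := rfl

/-- The componentwise imaginary part `ℂⁿ → ℝⁿ`. -/
def imPart (z : EuclideanSpace ℂ (Fin n)) : EuclideanSpace ℝ (Fin n) :=
  WithLp.toLp 2 (fun j => (z j).im)

@[simp] theorem imPart_apply (z : EuclideanSpace ℂ (Fin n)) (j : Fin n) :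
    imPart z j = (z j).im := rfl

theorem norm_sq_eq_rePart_add_imPart (z : EuclideanSpace ℂ (Fin n)) :
    ‖z‖ ^ 2 = ‖rePart z‖ ^ 2 + ‖imPart z‖ ^ 2 := by
  simp only [EuclideanSpace.norm_sq_eq, ← Finset.sum_add_distrib]
  refine Finset.sum_congr rfl fun j _ => ?_
  rw [Complex.sq_norm, Complex.normSq_apply]
  simp [pow_two]

theorem norm_rePart_le (z : EuclideanSpace ℂ (Fin n)) : ‖rePart z‖ ≤ ‖z‖ := by
  refine le_of_sq_le_sq ?_ (norm_nonneg _)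
  rw [norm_sq_eq_rePart_add_imPart]
  nlinarith [sq_nonneg ‖imPart z‖]

theorem norm_imPart_le (z : EuclideanSpace ℂ (Fin n)) : ‖imPart z‖ ≤ ‖z‖ := by
  refine le_of_sq_le_sq ?_ (norm_nonneg _)
  rw [norm_sq_eq_rePart_add_imPart]
  nlinarith [sq_nonneg ‖rePart z‖]

theorem rePart_sub_toComplex (z : EuclideanSpace ℂ (Fin n)) (x : EuclideanSpace ℝ (Fin n)) :
    rePart (z - toComplex x) = rePart z - x := by
  ext j; simp

theorem imPart_sub_toComplex (z : EuclideanSpace ℂ (Fin n)) (x : EuclideanSpace ℝ (Fin n)) :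
    imPart (z - toComplex x) = imPart z := by
  ext j; simp

theorem eq_toComplex_add (z : EuclideanSpace ℂ (Fin n)) :
    z = toComplex (rePart z) + Complex.I • toComplex (imPart z) := by
  ext j
  simp [mul_comm Complex.I]

/-- The inclusion of `ℝⁿ` into `ℂⁿ` as a real-linear isometry. -/
def toComplexLI (n : ℕ) : EuclideanSpace ℝ (Fin n) →ₗᵢ[ℝ] EuclideanSpace ℂ (Fin n) where
  toFun := toComplex
  map_add' x y := by ext j; simp
  map_smul' c x := by ext j; simp
  norm_map' x := by
    simp [EuclideanSpace.norm_eq]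

theorem norm_toComplex (x : EuclideanSpace ℝ (Fin n)) : ‖toComplex x‖ = ‖x‖ :=
  (toComplexLI n).norm_map x

theorem toComplex_sub (x y : EuclideanSpace ℝ (Fin n)) :
    toComplex (x - y) = toComplex x - toComplex y := (toComplexLI n).map_sub x y

theorem toComplex_add (x y : EuclideanSpace ℝ (Fin n)) :
    toComplex (x + y) = toComplex x + toComplex y := (toComplexLI n).map_add x y

theorem continuous_toComplex : Continuous (toComplex (n := n)) := (toComplexLI n).continuous

theorem toComplex_smul (c : ℝ) (x : EuclideanSpace ℝ (Fin n)) :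
    toComplex (c • x) = (c : ℂ) • toComplex x := by ext j; simp

theorem toComplex_mem_ball {x y : EuclideanSpace ℝ (Fin n)} {r : ℝ} :
    toComplex y ∈ Metric.ball (toComplex x) r ↔ y ∈ Metric.ball x r := by
  rw [mem_ball_iff_norm, mem_ball_iff_norm, ← toComplex_sub, norm_toComplex]

theorem toComplex_mem_closedBall {x y : EuclideanSpace ℝ (Fin n)} {r : ℝ} :
    toComplex y ∈ Metric.closedBall (toComplex x) r ↔ y ∈ Metric.closedBall x r := by
  rw [mem_closedBall_iff_norm, mem_closedBall_iff_norm, ← toComplex_sub, norm_toComplex]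

/-- A two-constants theorem near a real point of `ℂⁿ`. -/
theorem two_constants_tube {F : EuclideanSpace ℂ (Fin n) → ℂ}
    {W : Set (EuclideanSpace ℂ (Fin n))} (hW : IsOpen W) (hF : DifferentiableOn ℂ F W)
    {x w : EuclideanSpace ℝ (Fin n)} {r A L : ℝ} (hr : 0 < r) (hL : 0 ≤ L)
    (hsub : Metric.closedBall (toComplex x) (2 * r) ⊆ W)
    (hM : ∀ z ∈ Metric.closedBall (toComplex x) (2 * r), ‖F z‖ ≤ A * Real.exp L)
    (hA : ∀ y ∈ Metric.closedBall x r, ‖F (toComplex y)‖ ≤ A) (hw : ‖w‖ ≤ r) :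
    ‖F (toComplex x + Complex.I • toComplex w)‖ ≤ A * Real.exp (2 * ‖w‖ * L / r) := by
  rcases eq_or_ne w 0 with rfl | hw0
  · have h0 : toComplex (0 : EuclideanSpace ℝ (Fin n)) = 0 := (toComplexLI n).map_zero
    simpa [h0] using hA x (Metric.mem_closedBall_self hr.le)
  have hw' : 0 < ‖w‖ := norm_pos_iff.2 hw0
  set e : EuclideanSpace ℝ (Fin n) := ‖w‖⁻¹ • w with he
  have he1 : ‖e‖ = 1 := by
    rw [he, norm_smul, norm_inv, norm_norm, inv_mul_cancel₀ hw'.ne']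
  have hwe : toComplex w = (‖w‖ : ℂ) • toComplex e := by
    rw [he, ← toComplex_smul, smul_smul, mul_inv_cancel₀ hw'.ne', one_smul]
  have hmem : ∀ ζ ∈ Metric.closedBall (0 : ℂ) (2 * r),
      toComplex x + ζ • toComplex e ∈ Metric.closedBall (toComplex x) (2 * r) := by
    intro ζ hζ
    rw [mem_closedBall_zero_iff] at hζ
    rw [mem_closedBall_iff_norm, add_sub_cancel_left, norm_smul, norm_toComplex, he1, mul_one]
    exact hζ
  have := two_constants (f := fun ζ => F (toComplex x + ζ • toComplex e)) (r := r) (A := A)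
    (L := L) (t := ‖w‖) hr
    (fun ζ hζ => (hasDerivAt_comp_line hW hF _ _
      (hsub (hmem ζ hζ))).differentiableAt.differentiableWithinAt) hL
    (fun ζ hζ => hM _ (hmem ζ hζ))
    (fun s hs => by
      rw [← toComplex_smul, ← toComplex_add]
      apply hA
      rw [mem_closedBall_iff_norm, add_sub_cancel_left, norm_smul, he1, mul_one]
      exact hs) hw'.le hw
  rw [hwe, smul_smul, mul_comm Complex.I]
  exact this

end TwoConstants

/-! ### From the holomorphic extension to the Cauchy estimates. -/

section HolomorphicToCauchy

variable {n : ℕ}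

theorem supNorm_nonneg (X : Set (EuclideanSpace ℝ (Fin n))) (v : EuclideanSpace ℝ (Fin n) → ℂ) :
    0 ≤ supNorm X v := ENNReal.toReal_nonneg

theorem ae_norm_le_supNorm {X : Set (EuclideanSpace ℝ (Fin n))} {v : EuclideanSpace ℝ (Fin n) → ℂ}
    (hv : MemLp v ⊤ (volume.restrict X)) : ∀ᵐ x ∂(volume.restrict X), ‖v x‖ ≤ supNorm X v := by
  have h1 : eLpNorm v ⊤ (volume.restrict X) ≠ ⊤ := hv.2.ne
  have h2 := ae_le_eLpNormEssSup (f := v) (μ := volume.restrict X)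
  filter_upwards [h2] with x hx
  rw [← eLpNorm_exponent_top] at hx
  rw [supNorm, ← toReal_enorm]
  exact ENNReal.toReal_mono h1 hx

theorem compactlyContained_ball {E : Type*} [PseudoMetricSpace E] [ProperSpace E] {x : E} {r : ℝ}
    {X : Set E} (h : Metric.closedBall x r ⊆ X) : CompactlyContained (Metric.ball x r) X :=
  ⟨(isCompact_closedBall x r).of_isClosed_subset isClosed_closure
    Metric.closure_ball_subset_closedBall, Metric.closure_ball_subset_closedBall.trans h⟩

/-- An almost everywhere bound on an open set holds everywhere for continuous functions. -/
theorem le_of_ae_le_of_continuousOn {g : EuclideanSpace ℝ (Fin n) → ℝ} {A : ℝ}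
    {U : Set (EuclideanSpace ℝ (Fin n))} (hU : IsOpen U) (hg : ContinuousOn g U)
    (hae : ∀ᵐ x, x ∈ U → g x ≤ A) : ∀ x ∈ U, g x ≤ A := by
  by_contra! h
  obtain ⟨x, hx, hxA⟩ := h
  have hV : IsOpen (U ∩ g ⁻¹' Ioi A) := hg.isOpen_inter_preimage hU isOpen_Ioi
  have hpos := hV.measure_pos volume ⟨x, hx, hxA⟩
  refine hpos.ne' (measure_mono_null ?_ hae)
  rintro y ⟨hy, hyA⟩ h
  exact absurd (h hy) (not_le.2 hyA)

/-- Two constants on complex lines through real points: the exponential loss is proportional to |Im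
z|, and the constant in front becomes exactly the sup norm. Without both gains neither the powers
C₃^{|α|} (with constant 1 at α = 0) nor the contour shift would follow. -/
theorem HolomorphicExtension.exists_bound {X : Set (EuclideanSpace ℝ (Fin n))}
    {x₀ : EuclideanSpace ℝ (Fin n)} {h₀ : ℝ} {u : ℝ → EuclideanSpace ℝ (Fin n) → ℂ}
    (hh₀ : 0 < h₀) (hXm : MeasurableSet X)
    (hu : ∀ h : ℝ, 0 < h → h ≤ h₀ → MemLp (u h) ⊤ (volume.restrict X))
    (H : HolomorphicExtension X x₀ h₀ u) :
    ∃ r κ : ℝ, 0 < r ∧ 0 < κ ∧ Metric.closedBall x₀ r ⊆ X ∧ ∀ h : ℝ, 0 < h → h ≤ h₀ →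
      ∃ F : EuclideanSpace ℂ (Fin n) → ℂ, DifferentiableOn ℂ F (Metric.ball (toComplex x₀) r) ∧
        (∀ᵐ x, x ∈ Metric.ball x₀ r → F (toComplex x) = u h x) ∧
        ∀ z ∈ Metric.ball (toComplex x₀) r,
          ‖F z‖ ≤ supNorm X (u h) * Real.exp (κ * ‖imPart z‖ / h) := by
  obtain ⟨W, hW, hx₀, ⟨-, hWX⟩, C, C₂, hC, hC₂, hF⟩ := H
  obtain ⟨R, hR, hRW⟩ := Metric.nhds_basis_closedBall.mem_iff.1 (hW.mem_nhds hx₀)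
  have hRX : Metric.closedBall x₀ R ⊆ X := by
    intro y hy
    have := hWX (subset_closure (hRW (toComplex_mem_closedBall.2 hy)))
    rwa [tube, mem_ofPred_eq, show rePart (toComplex y) = y by ext j; simp] at this
  set K : ℝ := C + h₀ * |Real.log C₂| with hK
  have hKpos : 0 < K := by positivity
  -- If z is within R/4 of x₀, the complex ball of radius 2(R/4) about Re z lies in the R-ball. The
  -- two-constants bound with radius R/4 and L = K/h then has rate 2K/(R/4).
  refine ⟨R / 4, 2 * K / (R / 4), by positivity, by positivity,
    (Metric.closedBall_subset_closedBall (by linarith)).trans hRX, fun h hh hhh₀ => ?_⟩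
  obtain ⟨F, hFd, hFu, hFb⟩ := hF h hh hhh₀
  have hsub : Metric.ball (toComplex x₀) (R / 4) ⊆ W :=
    (Metric.ball_subset_closedBall.trans (Metric.closedBall_subset_closedBall (by linarith))).trans
      hRW
  refine ⟨F, hFd.mono hsub, ?_, fun z hz => ?_⟩
  · filter_upwards [hFu] with x hx hxb
    exact hx (hsub (toComplex_mem_ball.2 hxb))
  set A := supNorm X (u h) with hA
  have hA0 : 0 ≤ A := supNorm_nonneg _ _
  have hreal : ∀ y ∈ Metric.ball x₀ R, ‖F (toComplex y)‖ ≤ A := by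
    refine le_of_ae_le_of_continuousOn Metric.isOpen_ball ?_ ?_
    · exact (hFd.continuousOn.comp continuous_toComplex.continuousOn fun y hy =>
        hRW (toComplex_mem_closedBall.2 (Metric.ball_subset_closedBall hy))).norm
    · filter_upwards [hFu, (ae_restrict_iff' hXm).1 (ae_norm_le_supNorm (hu h hh hhh₀))]
        with y hy1 hy2 hy
      have hy' := Metric.ball_subset_closedBall hy
      rw [hy1 (hRW (toComplex_mem_closedBall.2 hy'))]
      exact hy2 (hRX hy')
  have hbound : ∀ z ∈ W, ‖F z‖ ≤ A * Real.exp (K / h) := by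
    intro z hz
    refine (hFb z hz).trans ?_
    rw [mul_comm]
    gcongr
    have h1 : C₂ ≤ Real.exp (h₀ * |Real.log C₂| / h) := by
      conv_lhs => rw [← Real.exp_log hC₂]
      apply Real.exp_le_exp.2
      refine (le_abs_self _).trans ?_
      rw [mul_comm, mul_div_assoc]
      exact le_mul_of_one_le_right (abs_nonneg _) ((one_le_div hh).2 hhh₀)
    calc C₂ * Real.exp (C / h) ≤ Real.exp (h₀ * |Real.log C₂| / h) * Real.exp (C / h) := by gcongr
      _ = Real.exp (K / h) := by rw [← Real.exp_add, hK]; ring_nf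
  have hre : ‖rePart z - x₀‖ < R / 4 := by
    rw [← rePart_sub_toComplex]
    exact (norm_rePart_le _).trans_lt (mem_ball_iff_norm.1 hz)
  have him : ‖imPart z‖ < R / 4 := by
    rw [← imPart_sub_toComplex z x₀]
    exact (norm_imPart_le _).trans_lt (mem_ball_iff_norm.1 hz)
  have hcb : Metric.closedBall (toComplex (rePart z)) (2 * (R / 4)) ⊆ W := by
    refine (Metric.closedBall_subset_closedBall' ?_).trans hRW
    rw [dist_eq_norm, ← toComplex_sub, norm_toComplex]
    linarith
  have := two_constants_tube hW hFd (x := rePart z) (w := imPart z) (r := R / 4) (A := A)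
    (L := K / h) (by positivity) (by positivity) hcb (fun z hz => hbound z (hcb hz))
    (fun y hy => hreal y (by
      rw [mem_closedBall_iff_norm] at hy
      rw [mem_ball_iff_norm]
      have := norm_add_le (y - rePart z) (rePart z - x₀)
      rw [sub_add_sub_cancel] at this
      linarith)) him.le
  rw [← eq_toComplex_add] at this
  refine this.trans (le_of_eq ?_)
  congr 2
  field_simp

theorem toComplex_single (j : Fin n) :
    toComplex (EuclideanSpace.single j 1) = EuclideanSpace.single j 1 := by
  ext i
  simp only [toComplex_apply, PiLp.single_apply]
  split_ifs <;> simp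

theorem hasFDerivAt_comp_toComplex {G : EuclideanSpace ℂ (Fin n) → ℂ}
    {W : Set (EuclideanSpace ℂ (Fin n))} (hW : IsOpen W) (hG : DifferentiableOn ℂ G W)
    {y : EuclideanSpace ℝ (Fin n)} (hy : toComplex y ∈ W) :
    HasFDerivAt (fun y => G (toComplex y)) (((fderiv ℂ G (toComplex y)).restrictScalars ℝ).comp
      (toComplexLI n).toContinuousLinearMap) y := by
  have h1 := (hG.differentiableAt (hW.mem_nhds hy)).hasFDerivAt.restrictScalars ℝ
  exact h1.comp y (toComplexLI n).toContinuousLinearMap.hasFDerivAt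

/-- Iterated Cauchy estimates for `(hD)^α` of the restriction of a holomorphic function to real
points. -/
theorem norm_hDPow_comp_toComplex_le {F : EuclideanSpace ℂ (Fin n) → ℂ}
    {W : Set (EuclideanSpace ℂ (Fin n))} (hW : IsOpen W) (hF : DifferentiableOn ℂ F W)
    {x : EuclideanSpace ℝ (Fin n)} {r ρ M h : ℝ} (hr : 0 ≤ r) (hρ : 0 < ρ) (hh : 0 < h)
    (hsub : Metric.closedBall (toComplex x) r ⊆ W)
    (hM : ∀ z ∈ Metric.closedBall (toComplex x) r, ‖F z‖ ≤ M) (α : Fin n → ℕ)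
    (hα : ((∑ j, α j : ℕ) : ℝ) * ρ ≤ r) :
    ‖hDPow h α (fun y => F (toComplex y)) x‖ ≤ M * (h / ρ) ^ (∑ j, α j) := by
  -- Invariant after k derivatives: the function still extends holomorphically to all of W, and the
  -- k-fold Cauchy bound holds on the ball shrunk by kρ. Should the radius become negative, the
  -- bound is vacuous; `hα` excludes this at the end.
  let P : ℕ → (EuclideanSpace ℝ (Fin n) → ℂ) → Prop := fun k w =>
    ∃ G : EuclideanSpace ℂ (Fin n) → ℂ, DifferentiableOn ℂ G W ∧
      (∀ y, toComplex y ∈ W → w y = G (toComplex y)) ∧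
      ∀ z ∈ Metric.closedBall (toComplex x) (r - k * ρ), ‖G z‖ ≤ M * (h / ρ) ^ k
  have hstep : ∀ k w j, P k w → P (k + 1) (hD h j w) := by
    rintro k w j ⟨G, hG, hwG, hGb⟩
    refine ⟨fun z => ((h : ℂ) / Complex.I) * fderiv ℂ G z (EuclideanSpace.single j 1),
      (differentiableOn_fderiv_apply hW hG _).const_mul _, fun y hy => ?_, fun z hz => ?_⟩
    · have hev : w =ᶠ[𝓝 y] fun y => G (toComplex y) := by
        filter_upwards [(hW.preimage continuous_toComplex).mem_nhds hy] with y' hy'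
        exact hwG y' hy'
      rw [hD, hev.fderiv_eq, (hasFDerivAt_comp_toComplex hW hG hy).fderiv, ← toComplex_single]
      rfl
    · have hk : Metric.closedBall z ρ ⊆ Metric.closedBall (toComplex x) (r - k * ρ) := by
        apply Metric.closedBall_subset_closedBall'
        rw [Metric.mem_closedBall] at hz
        push_cast at hz
        linarith
      have hk0 : Metric.closedBall (toComplex x) (r - k * ρ) ⊆ W :=
        (Metric.closedBall_subset_closedBall (by nlinarith [(k.cast_nonneg : (0 : ℝ) ≤ k)])).trans
          hsub
      have := norm_fderiv_apply_le hW hG hρ (hk.trans hk0) (fun w hw => hGb w (hk hw))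
        (EuclideanSpace.single j 1)
      rw [norm_mul, norm_div, Complex.norm_I, div_one, Complex.norm_real, Real.norm_of_nonneg hh.le]
      calc _ ≤ h * (M * (h / ρ) ^ k / ρ * ‖(EuclideanSpace.single j 1 : EuclideanSpace ℂ (Fin n))‖) := by
            gcongr
        _ = _ := by
          rw [PiLp.norm_single, norm_one, pow_succ]
          ring
  have hiter : ∀ m k w j, P k w → P (m + k) ((hD h j)^[m] w) := by
    intro m k w j hw
    induction m with
    | zero => simpa using hw
    | succ m ih =>
      rw [Function.iterate_succ_apply', show m + 1 + k = m + k + 1 by ring]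
      exact hstep _ _ _ ih
  have hlist : ∀ l : List (Fin n), P ((l.map α).sum)
      (l.foldr (fun j w => (hD h j)^[α j] w) (fun y => F (toComplex y))) := by
    intro l
    induction l with
    | nil => exact ⟨F, hF, fun _ _ => rfl, by simpa using hM⟩
    | cons i l ih =>
      rw [List.map_cons, List.sum_cons, List.foldr_cons]
      exact hiter _ _ _ _ ih
  obtain ⟨G, -, hG, hGb⟩ := hlist (List.finRange n)
  rw [← Fin.sum_univ_def] at hGb
  rw [hDPow, hG x (hsub (Metric.mem_closedBall_self hr))]
  exact hGb _ (Metric.mem_closedBall_self (by linarith))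

/-- The distance over which derivatives are taken is tuned to the order: about h|α|, where the
growth e^{κs/h} is only exponential in |α|, but never more than the available radius r. -/
theorem HolomorphicExtension.cauchyEstimates {X : Set (EuclideanSpace ℝ (Fin n))}
    {x₀ : EuclideanSpace ℝ (Fin n)} {h₀ : ℝ} {u : ℝ → EuclideanSpace ℝ (Fin n) → ℂ}
    (hh₀ : 0 < h₀) (hXm : MeasurableSet X)
    (hu : ∀ h : ℝ, 0 < h → h ≤ h₀ → MemLp (u h) ⊤ (volume.restrict X))
    (H : HolomorphicExtension X x₀ h₀ u) : CauchyEstimates X x₀ h₀ u := by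
  obtain ⟨R, κ, hR, hκ, hRX, hF⟩ := H.exists_bound hh₀ hXm hu
  set r := R / 4 with hr
  have hr0 : 0 < r := by positivity
  refine ⟨Metric.ball x₀ r, Metric.isOpen_ball, Metric.mem_ball_self hr0, compactlyContained_ball
    ((Metric.closedBall_subset_closedBall (by linarith)).trans hRX),
    Real.exp κ * max 1 (1 / r), by positivity, fun h hh hhh₀ => ?_⟩
  obtain ⟨F, hFd, hFu, hFb⟩ := hF h hh hhh₀
  have hrR : Metric.ball x₀ r ⊆ Metric.ball x₀ R := Metric.ball_subset_ball (by linarith)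
  set A := supNorm X (u h)
  have hA0 : 0 ≤ A := supNorm_nonneg _ _
  refine ⟨fun y => F (toComplex y), ?_, ?_, fun α x hx => ?_⟩
  · rw [contDiffOn_infty]
    intro m
    exact ((contDiffOn_of_differentiableOn Metric.isOpen_ball hFd m).restrict_scalars ℝ).comp
      (toComplexLI n).contDiff.contDiffOn fun y hy => toComplex_mem_ball.2 (hrR hy)
  · filter_upwards [hFu] with y hy hyr
    exact hy (hrR hyr)
  have hcb : ∀ s ≤ r, Metric.closedBall (toComplex x) s ⊆ Metric.ball (toComplex x₀) R := by
    intro s hs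
    apply Metric.closedBall_subset_ball'
    rw [dist_eq_norm, ← toComplex_sub, norm_toComplex]
    rw [mem_ball_iff_norm] at hx
    linarith
  have hFs : ∀ s ≤ r, ∀ z ∈ Metric.closedBall (toComplex x) s,
      ‖F z‖ ≤ A * Real.exp (κ * s / h) := by
    intro s hs z hz
    refine (hFb z (hcb s hs hz)).trans ?_
    have : ‖imPart z‖ ≤ s := by
      rw [← imPart_sub_toComplex z x]
      exact (norm_imPart_le _).trans (mem_closedBall_iff_norm.1 hz)
    gcongr
  have hmax1 : 1 ≤ max 1 (1 / r) := le_max_left _ _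
  -- Order zero is separate because the radius s/k below needs k > 0. The ball of radius 0 gives the
  -- constant 1 in front of the norm.
  rcases Nat.eq_zero_or_pos (∑ j, α j) with h0 | hpos
  · have := norm_hDPow_comp_toComplex_le Metric.isOpen_ball hFd (r := 0) (ρ := 1) le_rfl one_pos hh
      (hcb 0 hr0.le) (hFs 0 hr0.le) α (by simp [h0])
    simpa [h0] using this
  set k := ∑ j, α j with hk
  have hk0 : (0 : ℝ) < k := Nat.cast_pos.2 hpos
  set s := min (h * k) r with hs
  have hs0 : 0 < s := by positivity
  have hest := norm_hDPow_comp_toComplex_le Metric.isOpen_ball hFd (r := s) (ρ := s / k) hs0.le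
    (by positivity) hh (hcb s (min_le_right _ _)) (hFs s (min_le_right _ _)) α
    (by rw [← hk]; field_simp; exact le_rfl)
  rw [← hk] at hest
  have hexp : Real.exp (κ * s / h) ≤ Real.exp κ ^ k := by
    rw [← Real.exp_nat_mul]
    apply Real.exp_le_exp.2
    rw [div_le_iff₀ hh]
    have : s ≤ h * k := min_le_left _ _
    nlinarith
  -- If s = hk the left side is 1; if s = r it is hk/r. The factor max(1, 1/r) covers both.
  have hfrac : h / (s / k) ≤ max 1 (1 / r) * (1 + h * k) := by
    rw [div_div_eq_mul_div, div_le_iff₀ hs0]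
    rcases min_choice (h * k) r with h1 | h1
    · rw [hs, h1]
      have h2 : 1 ≤ max 1 (1 / r) * (1 + h * k) := by
        nlinarith [mul_pos hh hk0]
      exact le_mul_of_one_le_left (by positivity) h2
    · rw [hs, h1]
      have h2 : 1 / r ≤ max 1 (1 / r) := le_max_right _ _
      calc h * k = 1 / r * (h * k) * r := by field_simp
        _ ≤ max 1 (1 / r) * (1 + h * k) * r := by
          gcongr
          linarith
  calc _ ≤ A * Real.exp (κ * s / h) * (h / (s / k)) ^ k := hest
    _ ≤ A * Real.exp κ ^ k * (max 1 (1 / r) * (1 + h * k)) ^ k := by gcongr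
    _ = _ := by rw [mul_pow, mul_pow]; ring

end HolomorphicToCauchy

/-! ### Taylor series and holomorphic extension from analytic estimates. -/

section Taylor

/-- Taylor's formula for a sequence of successive derivatives. -/
theorem norm_sub_taylor_sum_le {g : ℕ → ℝ → ℂ} {B : ℝ} (k : ℕ)
    (hd : ∀ j, ∀ t ∈ Icc (0 : ℝ) 1, HasDerivAt (g j) (g (j + 1) t) t)
    (hB : ∀ t ∈ Icc (0 : ℝ) 1, ‖g k t‖ ≤ B) :
    ∀ t ∈ Icc (0 : ℝ) 1,
      ‖g 0 t - ∑ j ∈ Finset.range k, ((t ^ j / j.factorial : ℝ) : ℂ) * g j 0‖ ≤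
        B * (t ^ k / k.factorial) := by
  have hpow : ∀ (k : ℕ) (t : ℝ), HasDerivAt (fun t : ℝ => t ^ (k + 1) / (k + 1).factorial)
      (t ^ k / k.factorial) t := by
    intro k t
    refine ((hasDerivAt_pow (k + 1) t).div_const _).congr_deriv ?_
    rw [Nat.factorial_succ]
    push_cast
    field_simp
  induction k generalizing g with
  | zero => simpa using hB
  | succ k ih =>
    have ih' := ih (g := fun j => g (j + 1)) (fun j => hd (j + 1)) hB
    have hder : ∀ t ∈ Icc (0 : ℝ) 1, HasDerivAt
        (fun t => g 0 t - ∑ j ∈ Finset.range (k + 1), ((t ^ j / j.factorial : ℝ) : ℂ) * g j 0)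
        (g 1 t - ∑ j ∈ Finset.range k, ((t ^ j / j.factorial : ℝ) : ℂ) * g (j + 1) 0) t := by
      intro t ht
      refine (hd 0 t ht).sub ?_
      simp only [Finset.sum_range_succ']
      simp only [pow_zero, Nat.factorial_zero, Nat.cast_one, div_one, Complex.ofReal_one, one_mul]
      refine HasDerivAt.add_const _ ?_
      exact HasDerivAt.fun_sum fun j _ => ((hpow j t).ofReal_comp).mul_const _
    -- The derivative of the remainder is the remainder of order k for the shifted sequence, so the
    -- inductive bound B t^k/k! integrates to B t^{k+1}/(k+1)!.
    refine image_norm_le_of_norm_deriv_right_le_deriv_boundary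
      (fun t ht => (hder t ht).continuousAt.continuousWithinAt)
      (fun t ht => (hder t (Ico_subset_Icc_self ht)).hasDerivWithinAt) ?_
      (fun t => (hpow k t).const_mul B) fun t ht => ih' t (Ico_subset_Icc_self ht)
    simp [Finset.sum_range_succ']

variable {n : ℕ}

/-- The polynomial `∑_{|β| = k} k!/β! z^β v_{α+β}(x)` in `z`. -/
noncomputable def taylorPoly (v : (Fin n → ℕ) → EuclideanSpace ℝ (Fin n) → ℂ) :
    ℕ → (Fin n → ℕ) → EuclideanSpace ℂ (Fin n) → EuclideanSpace ℝ (Fin n) → ℂ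
  | 0, α, _, x => v α x
  | k + 1, α, z, x => ∑ j, z j * taylorPoly v k (α + Pi.single j 1) z x

theorem sum_add_single (α : Fin n → ℕ) (j : Fin n) :
    ∑ i, (α + Pi.single j 1 : Fin n → ℕ) i = ∑ i, α i + 1 := by
  simp [Finset.sum_add_distrib]

theorem differentiable_taylorPoly (v : (Fin n → ℕ) → EuclideanSpace ℝ (Fin n) → ℂ) (k : ℕ)
    (α : Fin n → ℕ) (x : EuclideanSpace ℝ (Fin n)) :
    Differentiable ℂ fun z => taylorPoly v k α z x := by
  induction k generalizing α with
  | zero => simp only [taylorPoly]; fun_prop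
  | succ k ih =>
    simp only [taylorPoly]
    exact Differentiable.fun_sum fun j _ => Differentiable.mul (by fun_prop) (ih _)

/-- The recursion contributes one factor ∑|z_j| per step, so the ℓ¹ norm of z accounts for the
multinomial coefficients. -/
theorem norm_taylorPoly_le {v : (Fin n → ℕ) → EuclideanSpace ℝ (Fin n) → ℂ}
    {x : EuclideanSpace ℝ (Fin n)} {b : ℕ → ℝ} (hb : ∀ α, ‖v α x‖ ≤ b (∑ j, α j))
    (k : ℕ) (α : Fin n → ℕ) (z : EuclideanSpace ℂ (Fin n)) :
    ‖taylorPoly v k α z x‖ ≤ b (∑ j, α j + k) * (∑ j, ‖z j‖) ^ k := by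
  induction k generalizing α with
  | zero => simpa [taylorPoly] using hb α
  | succ k ih =>
    rw [taylorPoly, pow_succ, ← mul_assoc, Finset.mul_sum]
    refine norm_sum_le_of_le _ fun j _ => ?_
    rw [norm_mul, mul_comm]
    have := ih (α + Pi.single j 1)
    rw [sum_add_single, show ∑ i, α i + 1 + k = ∑ i, α i + (k + 1) by ring] at this
    gcongr

theorem fderiv_apply_eq_sum (T : EuclideanSpace ℝ (Fin n) →L[ℝ] ℂ) (y : EuclideanSpace ℝ (Fin n)) :
    T y = ∑ j, (y j : ℂ) * T (EuclideanSpace.single j 1) := by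
  have hy : y = ∑ j, y j • (EuclideanSpace.single j (1 : ℝ) : EuclideanSpace ℝ (Fin n)) := by
    ext i
    simp [Finset.sum_apply, Pi.single_apply]
  conv_lhs => rw [hy]
  simp

/-- The recursion is the chain rule along t ↦ x + ty: raising k by one differentiates once more, so
these polynomials at real z = y are the successive derivatives needed for the one-variable Taylor
formula. -/
theorem hasDerivAt_taylorPoly {v : (Fin n → ℕ) → EuclideanSpace ℝ (Fin n) → ℂ}
    {U : Set (EuclideanSpace ℝ (Fin n))}
    (hd : ∀ α, ∀ x ∈ U, DifferentiableAt ℝ (v α) x)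
    (hpart : ∀ α j, ∀ x ∈ U, fderiv ℝ (v α) x (EuclideanSpace.single j 1) =
      v (α + Pi.single j 1) x)
    (x y : EuclideanSpace ℝ (Fin n)) (k : ℕ) (α : Fin n → ℕ) {t : ℝ} (ht : x + t • y ∈ U) :
    HasDerivAt (fun t : ℝ => taylorPoly v k α (toComplex y) (x + t • y))
      (taylorPoly v (k + 1) α (toComplex y) (x + t • y)) t := by
  induction k generalizing α with
  | zero =>
    simp only [taylorPoly]
    have h2 : HasDerivAt (fun t : ℝ => x + t • y) y t := by
      simpa using ((hasDerivAt_id t).smul_const y).const_add x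
    refine ((hd α _ ht).hasFDerivAt.comp_hasDerivAt t h2).congr_deriv ?_
    rw [fderiv_apply_eq_sum]
    exact Finset.sum_congr rfl fun j _ => by rw [hpart _ _ _ ht, toComplex_apply]
  | succ k ih =>
    rw [taylorPoly]
    exact HasDerivAt.fun_sum fun j _ => (ih _).const_mul _

/-- A smooth function whose derivatives satisfy Cauchy estimates on a ball extends
holomorphically to a complex ball. -/
theorem exists_holomorphic_extension_of_cauchy
    {v : (Fin n → ℕ) → EuclideanSpace ℝ (Fin n) → ℂ} {x₀ : EuclideanSpace ℝ (Fin n)}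
    {r M C : ℝ} (hC : 0 < C) (hM : 0 ≤ M)
    (hd : ∀ α, ∀ x ∈ Metric.ball x₀ r, DifferentiableAt ℝ (v α) x)
    (hpart : ∀ α j, ∀ x ∈ Metric.ball x₀ r, fderiv ℝ (v α) x (EuclideanSpace.single j 1) =
      v (α + Pi.single j 1) x)
    (hb : ∀ α, ∀ x ∈ Metric.ball x₀ r,
      ‖v α x‖ ≤ M * C ^ (∑ j, α j) * (∑ j, α j).factorial)
    {s : ℝ} (hs : 0 < s) (hsr : s ≤ r) (hsC : C * (n * s) ≤ 1 / 2) :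
    ∃ F : EuclideanSpace ℂ (Fin n) → ℂ, DifferentiableOn ℂ F (Metric.ball (toComplex x₀) s) ∧
      (∀ y ∈ Metric.ball x₀ s, F (toComplex y) = v 0 y) ∧
      ∀ z ∈ Metric.ball (toComplex x₀) s, ‖F z‖ ≤ 2 * M := by
  set f : ℕ → EuclideanSpace ℂ (Fin n) → ℂ := fun k z =>
    ((1 / k.factorial : ℝ) : ℂ) * taylorPoly v k 0 (z - toComplex x₀) x₀ with hf
  have hx₀ : x₀ ∈ Metric.ball x₀ r := Metric.mem_ball_self (hs.trans_le hsr)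
  have hnorm1 : ∀ z ∈ Metric.ball (toComplex x₀) s, C * ∑ j, ‖(z - toComplex x₀) j‖ ≤ 1 / 2 := by
    intro z hz
    refine le_trans ?_ hsC
    gcongr
    calc ∑ j, ‖(z - toComplex x₀) j‖ ≤ ∑ _j : Fin n, s := by
          refine Finset.sum_le_sum fun j _ => ?_
          exact (PiLp.norm_apply_le _ j).trans (mem_ball_iff_norm.1 hz).le
      _ = n * s := by simp
  have hterm : ∀ x ∈ Metric.ball x₀ r, ∀ k, ∀ z : EuclideanSpace ℂ (Fin n),
      ‖taylorPoly v k 0 z x‖ ≤ M * (C * ∑ j, ‖z j‖) ^ k * k.factorial := by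
    intro x hx k z
    have := norm_taylorPoly_le (b := fun m => M * C ^ m * m.factorial) (fun α => hb α x hx) k 0 z
    simp only [Pi.zero_apply, Finset.sum_const_zero, zero_add] at this
    refine this.trans (le_of_eq ?_)
    rw [mul_pow]; ring
  have hfb : ∀ k, ∀ z ∈ Metric.ball (toComplex x₀) s, ‖f k z‖ ≤ M * (1 / 2) ^ k := by
    intro k z hz
    rw [hf]
    simp only
    rw [norm_mul, Complex.norm_real, Real.norm_of_nonneg (by positivity)]
    calc _ ≤ 1 / (k.factorial : ℝ) * (M * (C * ∑ j, ‖(z - toComplex x₀) j‖) ^ k * k.factorial) := by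
          gcongr
          exact hterm x₀ hx₀ k _
      _ = M * (C * ∑ j, ‖(z - toComplex x₀) j‖) ^ k := by field_simp
      _ ≤ _ := by
        gcongr
        exact hnorm1 z hz
  have hsum : HasSum (fun k : ℕ => M * (1 / 2 : ℝ) ^ k) (M * 2) := hasSum_geometric_two.mul_left M
  -- Weierstrass M-test with ratio 1/2. The same geometric factor bounds the Taylor remainder on the
  -- real segment from x₀ to y, which identifies the sum with v there.
  have hunif := tendstoUniformlyOn_tsum_nat hsum.summable hfb
  refine ⟨fun z => ∑' k, f k z, ?_, fun y hy => ?_, fun z hz => ?_⟩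
  · refine differentiableOn_of_tendstoUniformlyOn Metric.isOpen_ball (fun N => ?_) hunif
    refine DifferentiableOn.fun_sum fun k _ => DifferentiableOn.const_mul ?_ _
    exact ((differentiable_taylorPoly v k 0 x₀).comp
      (differentiable_id.sub_const (toComplex x₀))).differentiableOn
  · have hy' := toComplex_mem_ball.2 hy
    refine tendsto_nhds_unique (hunif.tendsto_at hy') ?_
    have hmem : ∀ t ∈ Icc (0 : ℝ) 1, x₀ + t • (y - x₀) ∈ Metric.ball x₀ r := by
      intro t ht
      rw [mem_ball_iff_norm, add_sub_cancel_left, norm_smul, Real.norm_of_nonneg ht.1]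
      rw [mem_ball_iff_norm] at hy
      calc t * ‖y - x₀‖ ≤ 1 * ‖y - x₀‖ := by gcongr; exact ht.2
        _ < r := by linarith
    have hb : ∀ N, ‖∑ k ∈ Finset.range N, f k (toComplex y) - v 0 y‖ ≤ M * (1 / 2) ^ N := by
      intro N
      have := norm_sub_taylor_sum_le (g := fun k t => taylorPoly v k 0 (toComplex (y - x₀))
        (x₀ + t • (y - x₀))) (B := M * (1 / 2) ^ N * N.factorial) N
        (fun j t ht => hasDerivAt_taylorPoly hd hpart x₀ (y - x₀) j 0 (hmem t ht))
        (fun t ht => (hterm _ (hmem t ht) N _).trans (by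
          gcongr
          rw [toComplex_sub]
          exact hnorm1 _ hy')) 1 (by simp)
      simp only [one_pow, one_smul, zero_smul, add_zero, add_sub_cancel, taylorPoly.eq_1] at this
      rw [norm_sub_rev]
      refine (le_of_eq ?_).trans (this.trans (le_of_eq ?_))
      · simp only [hf, toComplex_sub]
      · field_simp
    rw [tendsto_iff_norm_sub_tendsto_zero]
    refine squeeze_zero (fun _ => norm_nonneg _) hb ?_
    simpa using (tendsto_pow_atTop_nhds_zero_of_lt_one (r := (1 / 2 : ℝ)) (by norm_num)
      (by norm_num)).const_mul M
  · exact (tsum_of_norm_bounded hsum fun k => hfb k z hz).trans (by linarith)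

end Taylor

/-! ### From the Cauchy estimates to the holomorphic extension. -/

section CauchyToHolomorphic

variable {n : ℕ} {U : Set (EuclideanSpace ℝ (Fin n))} {h : ℝ}
  {w w' : EuclideanSpace ℝ (Fin n) → ℂ}

theorem hD_congr (hU : IsOpen U) (hw : EqOn w w' U) (j : Fin n) :
    EqOn (hD h j w) (hD h j w') U := by
  intro x hx
  have : w =ᶠ[𝓝 x] w' := eventually_of_mem (hU.mem_nhds hx) hw
  rw [hD, hD, this.fderiv_eq]

theorem hD_contDiffOn (hU : IsOpen U) (hw : ContDiffOn ℝ ∞ w U) (j : Fin n) :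
    ContDiffOn ℝ ∞ (hD h j w) U := by
  refine contDiffOn_const.mul (ContDiffOn.clm_apply ?_ contDiffOn_const)
  exact hw.fderiv_of_isOpen hU (by simp)

theorem hD_iterate_congr (hU : IsOpen U) (hw : EqOn w w' U) (j : Fin n) (m : ℕ) :
    EqOn ((hD h j)^[m] w) ((hD h j)^[m] w') U := by
  induction m with
  | zero => exact hw
  | succ m ih =>
    rw [Function.iterate_succ_apply', Function.iterate_succ_apply']
    exact hD_congr hU ih j

theorem hD_iterate_contDiffOn (hU : IsOpen U) (hw : ContDiffOn ℝ ∞ w U) (j : Fin n) (m : ℕ) :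
    ContDiffOn ℝ ∞ ((hD h j)^[m] w) U := by
  induction m with
  | zero => exact hw
  | succ m ih =>
    rw [Function.iterate_succ_apply']
    exact hD_contDiffOn hU ih j

theorem hD_comm (hU : IsOpen U) (hw : ContDiffOn ℝ ∞ w U) (i j : Fin n) :
    EqOn (hD h i (hD h j w)) (hD h j (hD h i w)) U := by
  intro x hx
  have hsymm : IsSymmSndFDerivAt ℝ w x :=
    (hw.contDiffAt (hU.mem_nhds hx)).isSymmSndFDerivAt (by simp; norm_cast)
  have hd : DifferentiableAt ℝ (fderiv ℝ w) x :=
    ((hw.fderiv_of_isOpen hU (m := 1) (by norm_cast)).differentiableOn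
      (by simp)).differentiableAt (hU.mem_nhds hx)
  have hsnd : ∀ i j : Fin n, hD h i (hD h j w) x = (h : ℂ) / Complex.I * ((h : ℂ) / Complex.I *
      fderiv ℝ (fderiv ℝ w) x (EuclideanSpace.single i 1) (EuclideanSpace.single j 1)) := by
    intro i j
    have h1 : HasFDerivAt (hD h j w) _ x :=
      (hd.hasFDerivAt.clm_apply (hasFDerivAt_const (EuclideanSpace.single j (1 : ℝ)) x)).const_mul
        ((h : ℂ) / Complex.I)
    rw [hD, h1.fderiv]
    simp
  rw [hsnd, hsnd, hsymm.eq]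

theorem hD_iterate_comm (hU : IsOpen U) (hw : ContDiffOn ℝ ∞ w U) (i j : Fin n) (m : ℕ) :
    EqOn (hD h j ((hD h i)^[m] w)) ((hD h i)^[m] (hD h j w)) U := by
  induction m with
  | zero => exact fun _ _ => rfl
  | succ m ih =>
    rw [Function.iterate_succ_apply', Function.iterate_succ_apply']
    exact (hD_comm hU (hD_iterate_contDiffOn hU hw i m) j i).trans (hD_congr hU ih i)

theorem hDPow_contDiffOn (hU : IsOpen U) (hw : ContDiffOn ℝ ∞ w U) (α : Fin n → ℕ) :
    ContDiffOn ℝ ∞ (hDPow h α w) U := by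
  rw [hDPow]
  induction List.finRange n with
  | nil => exact hw
  | cons i l ih => exact hD_iterate_contDiffOn hU ih i _

/-- The composition in (hD)^α has a fixed order, so an extra D_j must be commuted past the factors
standing before D_j in the list. Symmetry of second derivatives allows this on an open set where w
is smooth. -/
theorem hD_hDPow (hU : IsOpen U) (hw : ContDiffOn ℝ ∞ w U) (α : Fin n → ℕ) (j : Fin n) :
    EqOn (hD h j (hDPow h α w)) (hDPow h (α + Pi.single j 1) w) U := by
  have hsmooth : ∀ l : List (Fin n),
      ContDiffOn ℝ ∞ (l.foldr (fun j w => (hD h j)^[α j] w) w) U := by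
    intro l
    induction l with
    | nil => exact hw
    | cons i l ih => exact hD_iterate_contDiffOn hU ih i _
  have hnot : ∀ l : List (Fin n), j ∉ l →
      l.foldr (fun i w => (hD h i)^[(α + Pi.single j 1 : Fin n → ℕ) i] w) w =
        l.foldr (fun i w => (hD h i)^[α i] w) w := by
    intro l hl
    induction l with
    | nil => rfl
    | cons i l ih =>
      rw [List.mem_cons, not_or] at hl
      rw [List.foldr_cons, List.foldr_cons, ih hl.2]
      simp [Pi.single_eq_of_ne (Ne.symm hl.1)]
  have hmem : ∀ l : List (Fin n), l.Nodup → j ∈ l →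
      EqOn (hD h j (l.foldr (fun i w => (hD h i)^[α i] w) w))
        (l.foldr (fun i w => (hD h i)^[(α + Pi.single j 1 : Fin n → ℕ) i] w) w) U := by
    intro l hnd hl
    induction l with
    | nil => simp at hl
    | cons i l ih =>
      rw [List.nodup_cons] at hnd
      rw [List.foldr_cons, List.foldr_cons]
      rcases eq_or_ne j i with rfl | hne
      · rw [hnot l hnd.1, ← Function.iterate_succ_apply' (hD h j)]
        intro x _
        simp
      · have hl' : j ∈ l := (List.mem_cons.1 hl).resolve_left hne
        refine (hD_iterate_comm hU (hsmooth l) i j _).trans ?_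
        have h2 : (α + Pi.single j 1 : Fin n → ℕ) i = α i := by
          simp [Pi.single_eq_of_ne (Ne.symm hne)]
        rw [h2]
        exact hD_iterate_congr hU (ih hnd.2 hl') i _
  exact hmem _ (List.nodup_finRange n) (List.mem_finRange j)

/-- Removing h^{|α|} turns the bound into C^k (1/h + k)^k, and x^k/k! ≤ e^x at x = 1/h + k gives
e^{1/h} (Ce)^k k!. The radius of convergence therefore does not depend on h. -/
theorem CauchyEstimates.holomorphicExtension {X : Set (EuclideanSpace ℝ (Fin n))}
    {x₀ : EuclideanSpace ℝ (Fin n)} {h₀ : ℝ} {u : ℝ → EuclideanSpace ℝ (Fin n) → ℂ}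
    (H : CauchyEstimates X x₀ h₀ u) : HolomorphicExtension X x₀ h₀ u := by
  obtain ⟨U, hU, hx₀, ⟨-, hUX⟩, C, hC, hv⟩ := H
  obtain ⟨r, hr, hrU⟩ := Metric.isOpen_iff.1 hU x₀ hx₀
  set C' := C * Real.exp 1 with hC'
  have hC'0 : 0 < C' := by positivity
  -- The smallness needed is C'ns ≤ 1/2; n + 1 replaces n so that the quotient is positive also for
  -- n = 0.
  set s := min (r / 2) (1 / (2 * C' * (n + 1))) with hs
  have hs0 : 0 < s := by positivity
  have hsC : C' * (n * s) ≤ 1 / 2 := by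
    have : s ≤ 1 / (2 * C' * (n + 1)) := min_le_right _ _
    calc C' * (n * s) ≤ C' * ((n + 1) * (1 / (2 * C' * (n + 1)))) := by
          gcongr
          linarith
      _ = 1 / 2 := by field_simp
  have hsr : s ≤ r / 2 := min_le_left _ _
  refine ⟨Metric.ball (toComplex x₀) s, Metric.isOpen_ball, Metric.mem_ball_self hs0,
    compactlyContained_ball fun z hz => ?_, 1, 2, one_pos, two_pos, fun h hh hhh₀ => ?_⟩
  · refine hUX (subset_closure (hrU ?_))
    rw [mem_closedBall_iff_norm] at hz
    rw [mem_ball_iff_norm, ← rePart_sub_toComplex]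
    exact (norm_rePart_le _).trans_lt (by linarith)
  obtain ⟨v, hvs, hvu, hvb⟩ := hv h hh hhh₀
  have hhC : (h : ℂ) ≠ 0 := by exact_mod_cast hh.ne'
  have hA0 := supNorm_nonneg X (u h)
  -- The factor (i/h)^{|α|} undoes the normalisation of hD, so this family consists of the plain
  -- derivatives ∂^α v.
  obtain ⟨F, hFd, hFv, hFb⟩ := exists_holomorphic_extension_of_cauchy
    (v := fun α x => (Complex.I / h) ^ (∑ j, α j) * hDPow h α v x) (x₀ := x₀) (r := r) (C := C')
    (M := supNorm X (u h) * Real.exp (1 / h)) hC'0 (by positivity)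
    (fun α x hx => (((hDPow_contDiffOn hU hvs α).differentiableOn (by simp)).differentiableAt
      (hU.mem_nhds (hrU hx))).const_mul _)
    (fun α j x hx => by
      have hd := ((hDPow_contDiffOn (h := h) hU hvs α).differentiableOn (by simp)).differentiableAt
        (hU.mem_nhds (hrU hx))
      rw [fderiv_const_mul hd, ← hD_hDPow hU hvs α j (hrU hx), sum_add_single, hD, pow_succ]
      simp only [smul_apply, smul_eq_mul]
      field_simp)
    (fun α x hx => by
      set k := ∑ j, α j
      rw [norm_mul, norm_pow, norm_div, Complex.norm_I, Complex.norm_real,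
        Real.norm_of_nonneg hh.le]
      have hexp := Real.pow_div_factorial_le_exp (x := 1 / h + k) (by positivity) k
      rw [div_le_iff₀ (by positivity), Real.exp_add] at hexp
      calc (1 / h) ^ k * ‖hDPow h α v x‖
          ≤ (1 / h) ^ k * (C ^ k * (1 + h * k) ^ k * supNorm X (u h)) := by
            gcongr
            exact hvb α x (hrU hx)
        _ = supNorm X (u h) * C ^ k * (1 / h + k) ^ k := by
            have : (1 / h + k) ^ k = (1 / h) ^ k * (1 + h * k) ^ k := by
              rw [← mul_pow]; congr 1; field_simp
            rw [this]; ring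
        _ ≤ supNorm X (u h) * C ^ k * (Real.exp (1 / h) * Real.exp k * k.factorial) := by gcongr
        _ = _ := by
            rw [hC', mul_pow, ← Real.exp_nat_mul, mul_one]; ring)
    hs0 (by linarith) hsC
  refine ⟨F, hFd, ?_, fun z hz => (hFb z hz).trans (le_of_eq (by ring))⟩
  filter_upwards [hvu] with x hx hxs
  have hxs' := toComplex_mem_ball.1 hxs
  rw [hFv x hxs', ← hx (hrU (Metric.ball_subset_ball (by linarith) hxs'))]
  simp only [Pi.zero_apply, Finset.sum_const_zero, pow_zero, one_mul]
  rw [hDPow]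
  induction List.finRange n with
  | nil => rfl
  | cons i l ih => simp

end CauchyToHolomorphic

/-! ### Integration by parts and deformation of the contour. -/

section Integrals

variable {n : ℕ}

/-- Integration by parts against the constant function 1. -/
theorem integral_lineDeriv_eq_zero {Ψ D : EuclideanSpace ℝ (Fin n) → ℂ}
    {e : EuclideanSpace ℝ (Fin n)} (hΨ : Integrable Ψ) (hD : Integrable D)
    (hder : ∀ y, HasLineDerivAt ℝ Ψ (D y) y e) : ∫ y, D y = 0 := by
  have := integral_bilinear_hasLineDerivAt_right_eq_neg_left_of_integrable
    (μ := (volume : Measure (EuclideanSpace ℝ (Fin n)))) (f := fun _ => (1 : ℂ))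
    (f' := fun _ => 0) (g := Ψ) (g' := D) (v := e) (B := ContinuousLinearMap.mul ℝ ℂ)
    (by simp) (by simpa using hD) (by simpa using hΨ)
    (fun y _ => by simpa using (hasFDerivAt_const (𝕜 := ℝ) (1 : ℂ) y).hasLineDerivAt e) fun y _ => hder y
  simpa using this

/-- Differentiation under the integral sign over a compact set. -/
theorem hasDerivAt_setIntegral_of_continuousOn {Y : Type*} [TopologicalSpace Y]
    [MeasurableSpace Y] [OpensMeasurableSpace Y] [T2Space Y] [SecondCountableTopology Y]
    {μ : Measure Y} [IsFiniteMeasureOnCompacts μ] {K : Set Y} (hK : IsCompact K) {I : Set ℝ}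
    (hI : IsOpen I) {Φ Φ' : ℝ → Y → ℂ} (hΦ : ∀ t ∈ I, ContinuousOn (Φ t) K)
    (hΦ' : ContinuousOn (Function.uncurry Φ') (I ×ˢ K))
    (hder : ∀ t ∈ I, ∀ y ∈ K, HasDerivAt (fun t => Φ t y) (Φ' t y) t) {t : ℝ} (ht : t ∈ I) :
    HasDerivAt (fun t => ∫ y in K, Φ t y ∂μ) (∫ y in K, Φ' t y ∂μ) t := by
  obtain ⟨δ, hδ, hδI⟩ := Metric.nhds_basis_closedBall.mem_iff.1 (hI.mem_nhds ht)
  obtain ⟨C, hC⟩ := ((isCompact_closedBall t δ).prod hK).exists_bound_of_continuousOn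
    (hΦ'.mono (prod_mono hδI subset_rfl))
  have hΦ't : ContinuousOn (Φ' t) K :=
    hΦ'.comp (f := fun y => (t, y)) (by fun_prop) fun y hy => ⟨ht, hy⟩
  refine (hasDerivAt_integral_of_dominated_loc_of_deriv_le (bound := fun _ => C)
    (Metric.closedBall_mem_nhds t hδ) ?_ ?_ ?_ ?_ ?_ ?_).2
  · exact eventually_of_mem (hI.mem_nhds ht) fun s hs =>
      (hΦ s hs).aestronglyMeasurable hK.measurableSet
  · exact (hΦ t ht).integrableOn_compact hK
  · exact hΦ't.aestronglyMeasurable hK.measurableSet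
  · exact (ae_restrict_iff' hK.measurableSet).2 (ae_of_all _ fun y hy s hs => hC (s, y) ⟨hs, hy⟩)
  · have : IsFiniteMeasure (μ.restrict K) := ⟨by simpa using hK.measure_lt_top⟩
    exact integrable_const _
  · exact (ae_restrict_iff' hK.measurableSet).2 (ae_of_all _ fun y hy s hs => hder s (hδI hs) y hy)

/-- Shifting the real domain of integration into the complex domain. -/
theorem integral_contour_shift {G : EuclideanSpace ℂ (Fin n) → ℂ}
    {W : Set (EuclideanSpace ℂ (Fin n))} (hW : IsOpen W) (hG : DifferentiableOn ℂ G W)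
    {θ : EuclideanSpace ℝ (Fin n) → ℝ} (hθ : ContDiff ℝ 1 θ) {x₀ e : EuclideanSpace ℝ (Fin n)}
    {R : ℝ} (hsupp : tsupport θ ⊆ Metric.ball x₀ R)
    (hmem : ∀ y ∈ Metric.closedBall x₀ R, ∀ τ ∈ Ioo (-2 : ℝ) 2,
      toComplex y - (Complex.I * τ * θ y) • toComplex e ∈ W) :
    ∫ y in Metric.closedBall x₀ R, G (toComplex y - (Complex.I * θ y) • toComplex e) *
        (1 - Complex.I * (fderiv ℝ θ y e : ℝ)) =
      ∫ y in Metric.closedBall x₀ R, G (toComplex y) := by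
  set K := Metric.closedBall x₀ R with hKdef
  have hK : IsCompact K := isCompact_closedBall _ _
  set Γ : ℝ → EuclideanSpace ℝ (Fin n) → EuclideanSpace ℂ (Fin n) := fun τ y =>
    toComplex y - (Complex.I * τ * θ y) • toComplex e with hΓ
  set G' : EuclideanSpace ℂ (Fin n) → ℂ := fun z => fderiv ℂ G z (toComplex e) with hG'
  have hG'c : ContinuousOn G' W := (differentiableOn_fderiv_apply hW hG _).continuousOn
  -- Pullback of G dz to the contour y ↦ y − iτθ(y)e. The Jacobian matrix is a rank-one perturbation
  -- of the identity, with determinant 1 − iτ ∂_eθ.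
  set Φ : ℝ → EuclideanSpace ℝ (Fin n) → ℂ := fun τ y =>
    G (Γ τ y) * (1 - Complex.I * τ * (fderiv ℝ θ y e : ℝ)) with hΦ
  set D : ℝ → EuclideanSpace ℝ (Fin n) → ℂ := fun τ y =>
    -(Complex.I * (fderiv ℝ θ y e : ℝ)) * G (Γ τ y) -
      Complex.I * θ y * (1 - Complex.I * τ * (fderiv ℝ θ y e : ℝ)) * G' (Γ τ y) with hD
  have hθc : Continuous θ := hθ.continuous
  have hθ'c : Continuous fun y => fderiv ℝ θ y e :=
    (hθ.continuous_fderiv (by simp)).clm_apply continuous_const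
  have hΓc : Continuous (Function.uncurry Γ) := by
    have := continuous_toComplex (n := n)
    simp only [hΓ, Function.uncurry_def]
    fun_prop
  have hΓτ : ∀ τ, Continuous (Γ τ) := fun τ => hΓc.comp (Continuous.prodMk_right τ)
  have hmem' : MapsTo (Function.uncurry Γ) (Ioo (-2 : ℝ) 2 ×ˢ K) W :=
    fun p hp => hmem p.2 hp.2 p.1 hp.1
  have hDc : ContinuousOn (Function.uncurry D) (Ioo (-2 : ℝ) 2 ×ˢ K) := by
    have h1 : ContinuousOn (fun p : ℝ × EuclideanSpace ℝ (Fin n) => G (Γ p.1 p.2))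
        (Ioo (-2 : ℝ) 2 ×ˢ K) := hG.continuousOn.comp hΓc.continuousOn hmem'
    have h2 : ContinuousOn (fun p : ℝ × EuclideanSpace ℝ (Fin n) => G' (Γ p.1 p.2))
        (Ioo (-2 : ℝ) 2 ×ˢ K) := hG'c.comp hΓc.continuousOn hmem'
    simp only [hD, Function.uncurry_def]
    refine ContinuousOn.sub (ContinuousOn.mul ?_ h1) (ContinuousOn.mul ?_ h2)
    · exact Continuous.continuousOn (by fun_prop)
    · exact Continuous.continuousOn (by fun_prop)
  have hline : ∀ y, HasDerivAt (fun s : ℝ => θ (y + s • e)) (fderiv ℝ θ y e) 0 := by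
    intro y
    exact (hθ.differentiable (by simp) y).hasFDerivAt.hasLineDerivAt e
  have hder : ∀ τ ∈ Ioo (-2 : ℝ) 2, ∀ y ∈ K, HasDerivAt (fun τ => Φ τ y) (D τ y) τ := by
    intro τ hτ y hy
    have h0 : HasDerivAt (fun τ : ℝ => (τ : ℂ)) 1 τ := by
      simpa using (hasDerivAt_id τ).ofReal_comp
    have h1 : HasDerivAt (fun τ : ℝ => Γ τ y) (-((Complex.I * 1 * θ y) • toComplex e)) τ :=
      (((h0.const_mul Complex.I).mul_const (θ y : ℂ)).smul_const (toComplex e)).const_sub _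
    have h2 := ((hG.differentiableAt (hW.mem_nhds (hmem y hy τ hτ))).hasFDerivAt.restrictScalars
      ℝ).comp_hasDerivAt τ h1
    have h3 : HasDerivAt (fun τ : ℝ => 1 - Complex.I * τ * (fderiv ℝ θ y e : ℝ))
        (-(Complex.I * 1 * (fderiv ℝ θ y e : ℝ))) τ :=
      (((h0.const_mul Complex.I).mul_const _)).const_sub _
    refine (h2.mul h3).congr_deriv ?_
    simp only [hD, hG', hΓ, ContinuousLinearMap.coe_restrictScalars', map_neg, map_smul,
      smul_eq_mul, Function.comp]
    ring
  -- The τ-derivative of the pullback is exact: it is the derivative in direction e of −iθ G∘Γ_τ,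
  -- which has compact support. Hence its integral vanishes and the integral over the contour is
  -- independent of τ.
  have hDzero : ∀ τ ∈ Ioo (-2 : ℝ) 2, ∫ y in K, D τ y = 0 := by
    intro τ hτ
    have hD0 : ∀ y, y ∉ tsupport θ → D τ y = 0 := by
      intro y hy
      have h1 : θ y = 0 := image_eq_zero_of_notMem_tsupport hy
      have h2 : fderiv ℝ θ y = 0 := by
        have : fderiv ℝ θ y = 0 := by
          by_contra hne
          exact hy (support_fderiv_subset ℝ hne)
        exact this
      simp [hD, h1, h2]
    have hsK : tsupport θ ⊆ K := hsupp.trans Metric.ball_subset_closedBall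
    have hDK : ContinuousOn (D τ) K :=
      hDc.comp (f := fun y => (τ, y)) (by fun_prop) fun y hy => ⟨hτ, hy⟩
    have hDint : Integrable (D τ) := by
      rw [← integrableOn_iff_integrable_of_support_subset (s := K)]
      · exact hDK.integrableOn_compact hK
      · intro y hy
        by_contra hyK
        exact hy (hD0 y fun h => hyK (hsK h))
    have hΨint : Integrable fun y => -(Complex.I * θ y) * G (Γ τ y) := by
      rw [← integrableOn_iff_integrable_of_support_subset (s := K)]
      · refine ContinuousOn.integrableOn_compact hK ?_
        refine ContinuousOn.mul (Continuous.continuousOn (by fun_prop)) ?_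
        exact hG.continuousOn.comp (hΓτ τ).continuousOn fun y hy => hmem y hy τ hτ
      · intro y hy
        by_contra hyK
        refine hy ?_
        simp [image_eq_zero_of_notMem_tsupport fun h => hyK (hsK h)]
    rw [setIntegral_eq_integral_of_forall_compl_eq_zero fun y hy => hD0 y fun h => hy (hsK h)]
    refine integral_lineDeriv_eq_zero (e := e) hΨint hDint fun y => ?_
    by_cases hy : y ∈ tsupport θ
    · have hθd := (hline y).ofReal_comp
      have hc : HasDerivAt (fun s : ℝ => toComplex (y + s • e)) (toComplex e) 0 := by
        have : HasDerivAt (fun s : ℝ => y + s • e) e 0 := by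
          simpa using ((hasDerivAt_id (0 : ℝ)).smul_const e).const_add y
        exact (toComplexLI n).toContinuousLinearMap.hasFDerivAt.comp_hasDerivAt 0 this
      have h1 : HasDerivAt (fun s : ℝ => Γ τ (y + s • e))
          (toComplex e - (Complex.I * τ * (fderiv ℝ θ y e : ℝ)) • toComplex e) 0 :=
        hc.sub ((hθd.const_mul (Complex.I * τ)).smul_const (toComplex e))
      have hy0 : Γ τ (y + (0 : ℝ) • e) ∈ W := by
        rw [zero_smul, add_zero]
        exact hmem y (hsK hy) τ hτ
      have h2 := ((hG.differentiableAt (hW.mem_nhds hy0)).hasFDerivAt.restrictScalars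
        ℝ).comp_hasDerivAt (0 : ℝ) h1
      have h3 := (hθd.const_mul Complex.I).neg.mul h2
      refine h3.congr_deriv ?_
      simp only [hD, hG', ContinuousLinearMap.coe_restrictScalars', map_sub, map_smul,
        smul_eq_mul, Function.comp, zero_smul, add_zero, Pi.neg_apply]
      ring
    -- Off the support of θ the point may lie outside W, where nothing is known of G, but the
    -- product vanishes identically near y.
    · rw [hD0 y hy]
      have hev : (fun s : ℝ => -(Complex.I * θ (y + s • e)) * G (Γ τ (y + s • e))) =ᶠ[𝓝 0]
          fun _ => 0 := by
        have hcont : Continuous fun s : ℝ => y + s • e := by fun_prop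
        have : ∀ᶠ s : ℝ in 𝓝 0, y + s • e ∈ (tsupport θ)ᶜ := by
          refine hcont.continuousAt.eventually_mem ?_
          simpa using (isClosed_tsupport θ).isOpen_compl.mem_nhds hy
        filter_upwards [this] with s hs
        simp [image_eq_zero_of_notMem_tsupport hs]
      exact (hasDerivAt_const (0 : ℝ) (0 : ℂ)).congr_of_eventuallyEq hev
  have hJ : ∀ τ ∈ Ioo (-2 : ℝ) 2, HasDerivAt (fun τ => ∫ y in K, Φ τ y) 0 τ := by
    intro τ hτ
    rw [← hDzero τ hτ]
    refine hasDerivAt_setIntegral_of_continuousOn hK isOpen_Ioo (fun s hs => ?_) hDc hder hτ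
    refine ContinuousOn.mul ?_ (Continuous.continuousOn (by fun_prop))
    exact hG.continuousOn.comp (hΓτ s).continuousOn fun y hy => hmem y hy s hs
  have hsub : Icc (0 : ℝ) 1 ⊆ Ioo (-2) 2 := fun t ht => ⟨by linarith [ht.1], by linarith [ht.2]⟩
  have := constant_of_has_deriv_right_zero (f := fun τ => ∫ y in K, Φ τ y) (a := 0) (b := 1)
    (fun τ hτ => (hJ τ (hsub hτ)).continuousAt.continuousWithinAt)
    (fun τ hτ => (hJ τ (hsub (Ico_subset_Icc_self hτ))).hasDerivWithinAt) 1 (by simp)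
  simpa [hΦ, hΓ] using this

end Integrals

/-! ### The kernel of the FBI transform at complex points, and Gaussian integrals. -/

section Phase

variable {n : ℕ}

/-- The kernel `exp (i a·ξ/t - a·a/(2t))` of the FBI transform, for `a ∈ ℂⁿ`. -/
noncomputable def fbiKernel (t : ℝ) (a : EuclideanSpace ℂ (Fin n)) (ξ : EuclideanSpace ℝ (Fin n)) :
    ℂ :=
  Complex.exp ((Complex.I * ∑ j, a j * ξ j - (∑ j, a j ^ 2) / 2) / t)

theorem norm_fbiKernel (t : ℝ) (a : EuclideanSpace ℂ (Fin n)) (ξ : EuclideanSpace ℝ (Fin n)) :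
    ‖fbiKernel t a ξ‖ =
      Real.exp ((-inner ℝ (imPart a) ξ - (‖rePart a‖ ^ 2 - ‖imPart a‖ ^ 2) / 2) / t) := by
  rw [fbiKernel, Complex.norm_exp, Complex.div_ofReal_re, Complex.sub_re, Complex.mul_re,
    Complex.re_sum, Complex.im_sum, show ((2 : ℂ)) = ((2 : ℝ) : ℂ) by simp, Complex.div_ofReal_re,
    Complex.re_sum]
  simp only [EuclideanSpace.norm_sq_eq, ← Finset.sum_sub_distrib, PiLp.inner_apply]
  congr 4
  · simp [mul_comm]
  · refine Finset.sum_congr rfl fun j _ => ?_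
    rw [pow_two, Complex.mul_re]
    simp [pow_two]

theorem norm_fbiKernel_le {t : ℝ} (ht : 0 < t) (a : EuclideanSpace ℂ (Fin n))
    (ξ : EuclideanSpace ℝ (Fin n)) :
    ‖fbiKernel t a ξ‖ ≤ Real.exp ((‖imPart a‖ * ‖ξ‖ + ‖imPart a‖ ^ 2 / 2) / t) *
      Real.exp (-‖rePart a‖ ^ 2 / (2 * t)) := by
  rw [norm_fbiKernel, ← Real.exp_add]
  apply Real.exp_le_exp.2
  have h1 : -inner ℝ (imPart a) ξ ≤ ‖imPart a‖ * ‖ξ‖ :=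
    (neg_le_abs _).trans (abs_real_inner_le_norm _ _)
  have h2 : -‖rePart a‖ ^ 2 / (2 * t) = -‖rePart a‖ ^ 2 / 2 / t := by rw [div_div]
  rw [h2, ← add_div]
  gcongr
  linarith

theorem fbi_eq (t : ℝ) (v : EuclideanSpace ℝ (Fin n) → ℂ) (x ξ : EuclideanSpace ℝ (Fin n)) :
    fbi t v x ξ = (((2 : ℝ) ^ (-(n : ℝ) / 2) * (Real.pi * t) ^ (-(3 * (n : ℝ)) / 4) : ℝ) : ℂ) *
      ∫ y, fbiKernel t (toComplex x - toComplex y) ξ * v y := by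
  rw [fbi]
  congr 2
  ext1 y
  congr 1
  rw [fbiKernel]
  congr 1
  rw [EuclideanSpace.norm_sq_eq, PiLp.inner_apply]
  push_cast
  simp only [PiLp.sub_apply, toComplex_apply, Real.norm_eq_abs, sq_abs, RCLike.inner_apply,
    conj_trivial, ← Complex.ofReal_sub, ← Complex.ofReal_mul, ← Complex.ofReal_pow,
    ← Complex.ofReal_sum]
  rw [sub_div, div_div]
  simp only [mul_comm (ξ _)]
  ring

theorem differentiable_fbiKernel (t : ℝ) (ξ : EuclideanSpace ℝ (Fin n)) :
    Differentiable ℂ fun a => fbiKernel t a ξ := by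
  simp only [fbiKernel]
  fun_prop

@[fun_prop]
theorem continuous_fbiKernel {α : Type*} [TopologicalSpace α] (t : ℝ)
    {f : α → EuclideanSpace ℂ (Fin n)} {g : α → EuclideanSpace ℝ (Fin n)} (hf : Continuous f)
    (hg : Continuous g) : Continuous fun x => fbiKernel t (f x) (g x) := by
  simp only [fbiKernel]
  fun_prop

theorem integrable_gaussian {b : ℝ} (hb : 0 < b) (x : EuclideanSpace ℝ (Fin n)) :
    Integrable fun y => Real.exp (-‖x - y‖ ^ 2 / b) := by
  have h1 := (GaussianFourier.integrable_cexp_neg_mul_sq_norm_add (V := EuclideanSpace ℝ (Fin n))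
    (b := ((1 / b : ℝ) : ℂ)) (by simpa using hb) 0 0).norm
  have h2 : Integrable fun y : EuclideanSpace ℝ (Fin n) => Real.exp (-‖y‖ ^ 2 / b) := by
    refine h1.congr (ae_of_all _ fun y => ?_)
    simp only [Complex.norm_exp]
    congr 1
    rw [← Complex.ofReal_neg, ← Complex.ofReal_pow, ← Complex.ofReal_mul, zero_mul, add_zero,
      Complex.ofReal_re]
    ring
  exact h2.comp_sub_left x

theorem integral_gaussian_sub {b : ℝ} (x : EuclideanSpace ℝ (Fin n)) :
    ∫ y, Real.exp (-‖x - y‖ ^ 2 / b) =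
      ∫ y : EuclideanSpace ℝ (Fin n), Real.exp (-‖y‖ ^ 2 / b) :=
  integral_sub_left_eq_self (fun y : EuclideanSpace ℝ (Fin n) => Real.exp (-‖y‖ ^ 2 / b)) volume x

theorem integrable_fbiKernel_mul {t A : ℝ} (ht : 0 < t) {v : EuclideanSpace ℝ (Fin n) → ℂ}
    (hvm : AEStronglyMeasurable v) (hv : ∀ᵐ y, ‖v y‖ ≤ A) (z : EuclideanSpace ℂ (Fin n))
    (ξ : EuclideanSpace ℝ (Fin n)) :
    Integrable fun y => fbiKernel t (z - toComplex y) ξ * v y := by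
  have hc : Continuous fun y => fbiKernel t (z - toComplex y) ξ :=
    (differentiable_fbiKernel t ξ).continuous.comp (continuous_const.sub continuous_toComplex)
  refine Integrable.mul_bdd (c := A) ?_ hvm hv
  refine ((integrable_gaussian (b := 2 * t) (by positivity) (rePart z)).const_mul
    (Real.exp ((‖imPart z‖ * ‖ξ‖ + ‖imPart z‖ ^ 2 / 2) / t))).mono' hc.aestronglyMeasurable
    (ae_of_all _ fun y => ?_)
  have := norm_fbiKernel_le ht (z - toComplex y) ξ
  rwa [rePart_sub_toComplex, imPart_sub_toComplex] at this

/-- Absorbs the prefactors, negative powers of the scale, at the price of half the decay rate. -/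
theorem exists_rpow_neg_mul_exp_le {q δ : ℝ} (hq : 0 ≤ q) (hδ : 0 < δ) :
    ∃ C > 0, ∀ t : ℝ, 0 < t →
      t ^ (-q) * Real.exp (-δ / t) ≤ C * Real.exp (-(δ / 2) / t) := by
  obtain ⟨m, hm⟩ := exists_nat_ge q
  set d := δ / 2 with hd
  have hd0 : 0 < d := by positivity
  refine ⟨m.factorial / d ^ m * Real.exp d, by positivity, fun t ht => ?_⟩
  have hs : 0 < t⁻¹ := by positivity
  -- Using 1 + 1/t instead of 1/t keeps the base at least 1, so q may be rounded up to the integer m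
  -- for large t too.
  have h1 := Real.pow_div_factorial_le_exp (x := d * (1 + t⁻¹)) (by positivity) m
  rw [div_le_iff₀ (by positivity), mul_pow, mul_add, Real.exp_add, mul_one] at h1
  have h2 : t ^ (-q) ≤ m.factorial / d ^ m * Real.exp d * Real.exp (d * t⁻¹) := by
    calc t ^ (-q) = t⁻¹ ^ q := by rw [Real.inv_rpow ht.le, Real.rpow_neg ht.le]
      _ ≤ (1 + t⁻¹) ^ q := by gcongr; linarith
      _ ≤ (1 + t⁻¹) ^ (m : ℝ) := Real.rpow_le_rpow_of_exponent_le (by linarith) hm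
      _ = d ^ m * (1 + t⁻¹) ^ m / d ^ m := by rw [Real.rpow_natCast]; field_simp
      _ ≤ Real.exp d * Real.exp (d * t⁻¹) * m.factorial / d ^ m := by gcongr
      _ = _ := by ring
  have h3 : Real.exp (-d / t) = Real.exp (d * t⁻¹) * Real.exp (-δ / t) := by
    rw [← Real.exp_add, hd]
    ring_nf
  rw [h3, ← mul_assoc]
  exact mul_le_mul_of_nonneg_right h2 (Real.exp_pos _).le

end Phase

/-! ### From the holomorphic extension to decay of the FBI transform. -/

section HolomorphicToFBI

variable {n : ℕ}

theorem aestronglyMeasurable_indicator_of_memLp {X : Set (EuclideanSpace ℝ (Fin n))}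
    (hXm : MeasurableSet X) {v : EuclideanSpace ℝ (Fin n) → ℂ}
    (hv : MemLp v ⊤ (volume.restrict X)) : AEStronglyMeasurable (X.indicator v) :=
  (aestronglyMeasurable_indicator_iff hXm).2 hv.1

theorem ae_norm_indicator_le {X : Set (EuclideanSpace ℝ (Fin n))}
    (hXm : MeasurableSet X) {v : EuclideanSpace ℝ (Fin n) → ℂ}
    (hv : MemLp v ⊤ (volume.restrict X)) : ∀ᵐ y, ‖X.indicator v y‖ ≤ supNorm X v := by
  filter_upwards [(ae_restrict_iff' hXm).1 (ae_norm_le_supNorm hv)] with y hy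
  by_cases hyX : y ∈ X
  · rw [indicator_of_mem hyX]; exact hy hyX
  · rw [indicator_of_notMem hyX, norm_zero]; exact supNorm_nonneg _ _

set_option maxHeartbeats 1000000 in
-- Near x₀ the contour is pushed by −iθ(y)ξ/|ξ|, and the real part of the exponent, multiplied by
-- h', is at most −θ|ξ| − |x−y|²/2 + θ²/2 + κθ. For |ξ| ≥ κ + 1 and 0 ≤ θ ≤ 1 this is at most −θ/2 −
-- |x−y|²/2: either θ is maximal, or y is far from x.
theorem HolomorphicExtension.fbiDecay {X : Set (EuclideanSpace ℝ (Fin n))}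
    {x₀ : EuclideanSpace ℝ (Fin n)} {h₀ : ℝ} {u : ℝ → EuclideanSpace ℝ (Fin n) → ℂ}
    (hh₀ : 0 < h₀) (hXm : MeasurableSet X)
    (hu : ∀ h : ℝ, 0 < h → h ≤ h₀ → MemLp (u h) ⊤ (volume.restrict X))
    (H : HolomorphicExtension X x₀ h₀ u) : FBIDecay X x₀ h₀ u := by
  obtain ⟨R, κ, hR, hκ, hRX, hF⟩ := H.exists_bound hh₀ hXm hu
  set r := R / 8 with hr
  have hr0 : 0 < r := by positivity
  -- ε ≤ r keeps the shifted contour, run up to τ = 2, inside the R-ball: 4r + 2ε < 8r. ε ≤ 1 gives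
  -- θ² ≤ θ.
  set ε := min r 1 with hε
  have hε0 : 0 < ε := by positivity
  have hεr : ε ≤ r := min_le_left _ _
  have hε1 : ε ≤ 1 := min_le_right _ _
  let χ : ContDiffBump x₀ := ⟨2 * r, 3 * r, by positivity, by linarith⟩
  set θ : EuclideanSpace ℝ (Fin n) → ℝ := fun y => ε * χ y with hθdef
  have hθ : ContDiff ℝ 1 θ := contDiff_const.mul χ.contDiff
  have hθsupp : HasCompactSupport θ := χ.hasCompactSupport.mul_left
  have hθts : tsupport θ ⊆ Metric.ball x₀ (4 * r) := by
    refine (tsupport_mul_subset_right (f := fun _ => ε) (g := χ)).trans ?_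
    rw [χ.tsupport_eq]
    exact Metric.closedBall_subset_ball (by simp only [χ]; linarith)
  have hθ0 : ∀ y, 0 ≤ θ y := fun y => mul_nonneg hε0.le χ.nonneg
  have hθε : ∀ y, θ y ≤ ε := fun y => mul_le_of_le_one_right hε0.le χ.le_one
  obtain ⟨B, hB⟩ := (hθsupp.fderiv (𝕜 := ℝ)).exists_bound_of_continuous
    (hθ.continuous_fderiv (by simp))
  have hB0 : 0 ≤ B := (norm_nonneg _).trans (hB x₀)
  set K := Metric.closedBall x₀ (4 * r) with hK
  set I₀ := ∫ y : EuclideanSpace ℝ (Fin n), Real.exp (-‖y‖ ^ 2 / (4 * h₀)) with hI₀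
  have hI₀0 : 0 ≤ I₀ := integral_nonneg fun y => (Real.exp_pos _).le
  -- ε/2 is the gain where θ = ε, on the 2r-ball; r²/2 is the Gaussian gain outside it, where |x −
  -- y| ≥ r.
  set δ := min ε (r ^ 2) / 2 with hδ
  have hδ0 : 0 < δ := by positivity
  have hδε : δ ≤ ε / 2 := by rw [hδ]; gcongr; exact min_le_left _ _
  have hδr : δ ≤ r ^ 2 / 2 := by rw [hδ]; gcongr; exact min_le_right _ _
  obtain ⟨Cp, hCp, hCpb⟩ := exists_rpow_neg_mul_exp_le (q := 3 * (n : ℝ) / 4) (by positivity) hδ0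
  set C₁ := (2 : ℝ) ^ (-(n : ℝ) / 2) * (Real.pi ^ (-(3 * (n : ℝ)) / 4)) * Cp *
    ((1 + B) * volume.real K + I₀ + 1) with hC₁
  refine ⟨Metric.ball x₀ r, Metric.isOpen_ball, Metric.mem_ball_self hr0, compactlyContained_ball
    ((Metric.closedBall_subset_closedBall (by linarith)).trans hRX), κ + 1, C₁, δ / 2,
    by positivity, by positivity, by positivity, fun h' h hh' hh'h hhh₀ x hx ξ hξ => ?_⟩
  have hh : 0 < h := hh'.trans_le hh'h
  obtain ⟨F, hFd, hFu, hFb⟩ := hF h hh hhh₀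
  set A := supNorm X (u h) with hA
  have hA0 : 0 ≤ A := supNorm_nonneg _ _
  set v := X.indicator (u h) with hv
  have hvm : AEStronglyMeasurable v := aestronglyMeasurable_indicator_of_memLp hXm (hu h hh hhh₀)
  have hvb : ∀ᵐ y, ‖v y‖ ≤ A := ae_norm_indicator_le hXm (hu h hh hhh₀)
  have hint := integrable_fbiKernel_mul hh' hvm hvb (toComplex x) ξ
  have hKm : MeasurableSet K := Metric.isClosed_closedBall.measurableSet
  have hξ0 : 0 < ‖ξ‖ := lt_of_lt_of_le (by positivity) hξ
  rw [mem_ball_iff_norm] at hx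
  -- the part away from `x₀`
  have hout : ‖∫ y in Kᶜ, fbiKernel h' (toComplex x - toComplex y) ξ * v y‖ ≤
      A * Real.exp (-δ / h') * I₀ := by
    have hg := (integrable_gaussian (b := 4 * h₀) (by positivity) x).const_mul
      (A * Real.exp (-δ / h'))
    rw [hI₀, ← integral_gaussian_sub (b := 4 * h₀) x, ← integral_const_mul]
    refine (norm_integral_le_of_norm_le hg.integrableOn ?_).trans
      (setIntegral_le_integral hg (ae_of_all _ fun y => by positivity))
    refine (ae_restrict_iff' hKm.compl).2 ?_
    filter_upwards [hvb] with y hy hyK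
    rw [norm_mul, norm_fbiKernel, rePart_sub_toComplex, imPart_sub_toComplex,
      show rePart (toComplex x) = x by ext j; simp,
      show imPart (toComplex x) = 0 by ext j; simp]
    have hxy : 3 * r ≤ ‖x - y‖ := by
      rw [hK, mem_compl_iff, mem_closedBall_iff_norm, not_le] at hyK
      have := norm_sub_le_norm_sub_add_norm_sub y x x₀
      rw [norm_sub_rev y x] at this
      linarith
    -- The Gaussian is split in two halves: one gives e^{−δ/h'} because |x − y| ≥ 3r, the other is
    -- enlarged to scale h₀ so that its integral is uniform in h'.
    have hexp : Real.exp ((-inner ℝ (0 : EuclideanSpace ℝ (Fin n)) ξ -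
        (‖x - y‖ ^ 2 - ‖(0 : EuclideanSpace ℝ (Fin n))‖ ^ 2) / 2) / h') ≤
        Real.exp (-δ / h') * Real.exp (-‖x - y‖ ^ 2 / (4 * h₀)) := by
      rw [← Real.exp_add, inner_zero_left, norm_zero]
      apply Real.exp_le_exp.2
      have h1 : ‖x - y‖ ^ 2 / (4 * h₀) ≤ ‖x - y‖ ^ 2 / (4 * h') := by
        gcongr
        linarith
      have h2 : -‖x - y‖ ^ 2 / (4 * h') = (-‖x - y‖ ^ 2 / 4) / h' := by rw [div_div]
      calc _ ≤ (-δ + -‖x - y‖ ^ 2 / 4) / h' := by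
            gcongr
            nlinarith
        _ = -δ / h' + -‖x - y‖ ^ 2 / (4 * h') := by rw [h2, add_div]
        _ ≤ _ := by
          rw [neg_div (4 * h') _, neg_div (4 * h₀) _]
          linarith
    calc _ ≤ Real.exp (-δ / h') * Real.exp (-‖x - y‖ ^ 2 / (4 * h₀)) * A := by gcongr
      _ = _ := by ring
  -- the part near `x₀`
  set e := ‖ξ‖⁻¹ • ξ with he
  have he1 : ‖e‖ = 1 := by
    rw [he, norm_smul, norm_inv, norm_norm, inv_mul_cancel₀ hξ0.ne']
  have heξ : inner ℝ e ξ = ‖ξ‖ := by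
    rw [he, inner_smul_left, real_inner_self_eq_norm_sq]
    simp only [conj_trivial]
    field_simp
  have hmem : ∀ y ∈ K, ∀ τ ∈ Ioo (-2 : ℝ) 2,
      toComplex y - (Complex.I * τ * θ y) • toComplex e ∈ Metric.ball (toComplex x₀) R := by
    intro y hy τ hτ
    rw [hK, mem_closedBall_iff_norm] at hy
    rw [mem_ball_iff_norm]
    have h1 : ‖(Complex.I * τ * θ y) • toComplex e‖ ≤ 2 * ε := by
      rw [norm_smul, norm_toComplex, he1, mul_one, norm_mul, norm_mul, Complex.norm_I, one_mul,
        Complex.norm_real, Complex.norm_real, Real.norm_of_nonneg (hθ0 y)]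
      have : ‖τ‖ ≤ 2 := abs_le.2 ⟨hτ.1.le, hτ.2.le⟩
      exact mul_le_mul this (hθε y) (hθ0 y) (by norm_num)
    calc ‖toComplex y - (Complex.I * τ * θ y) • toComplex e - toComplex x₀‖
        = ‖toComplex (y - x₀) - (Complex.I * τ * θ y) • toComplex e‖ := by
          rw [toComplex_sub]; congr 1; abel
      _ ≤ ‖y - x₀‖ + 2 * ε := (norm_sub_le _ _).trans (by rw [norm_toComplex]; gcongr)
      _ < R := by linarith
  have hGd : DifferentiableOn ℂ (fun z => fbiKernel h' (toComplex x - z) ξ * F z)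
      (Metric.ball (toComplex x₀) R) := by
    refine DifferentiableOn.mul (Differentiable.differentiableOn ?_) hFd
    exact (differentiable_fbiKernel h' ξ).comp (differentiable_id.const_sub _)
  have hshift := integral_contour_shift Metric.isOpen_ball hGd hθ hθts hmem
  have hKeq : ∫ y in K, fbiKernel h' (toComplex x - toComplex y) ξ * v y =
      ∫ y in K, fbiKernel h' (toComplex x - toComplex y) ξ * F (toComplex y) := by
    refine setIntegral_congr_ae hKm ?_
    filter_upwards [hFu] with y hy hyK
    have h1 : y ∈ Metric.ball x₀ R := Metric.closedBall_subset_ball (by linarith) hyK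
    rw [hy h1, hv, indicator_of_mem (hRX (Metric.ball_subset_closedBall h1))]
  have hin : ‖∫ y in K, fbiKernel h' (toComplex x - toComplex y) ξ * v y‖ ≤
      A * Real.exp (-δ / h') * (1 + B) * volume.real K := by
    rw [hKeq, ← hshift]
    refine norm_setIntegral_le_of_norm_le_const (isCompact_closedBall _ _).measure_lt_top ?_
    intro y hy
    have hΓ := hmem y hy 1 (by norm_num)
    rw [Complex.ofReal_one, mul_one] at hΓ
    set Γ := toComplex y - (Complex.I * θ y) • toComplex e with hΓdef
    have him : imPart Γ = -(θ y • e) := by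
      ext j
      simp [hΓdef]
    have hFΓ := hFb Γ hΓ
    rw [him, norm_neg, norm_smul, he1, mul_one, Real.norm_of_nonneg (hθ0 y)] at hFΓ
    have hre1 : rePart (toComplex x - Γ) = x - y := by
      ext j
      simp [hΓdef]
    have him1 : imPart (toComplex x - Γ) = θ y • e := by
      ext j
      simp [hΓdef]
    have hker : ‖fbiKernel h' (toComplex x - Γ) ξ‖ =
        Real.exp ((-(θ y * ‖ξ‖) - (‖x - y‖ ^ 2 - θ y ^ 2) / 2) / h') := by
      rw [norm_fbiKernel, hre1, him1, inner_smul_left, heξ, norm_smul, he1, mul_one,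
        Real.norm_of_nonneg (hθ0 y)]
      simp
    have hjac : ‖1 - Complex.I * (fderiv ℝ θ y e : ℝ)‖ ≤ 1 + B := by
      refine (norm_sub_le _ _).trans ?_
      rw [norm_one, norm_mul, Complex.norm_I, one_mul, Complex.norm_real]
      gcongr
      have := (fderiv ℝ θ y).le_opNorm e
      rw [he1, mul_one] at this
      exact this.trans (hB y)
    have hmain : ‖fbiKernel h' (toComplex x - Γ) ξ‖ * ‖F Γ‖ ≤ A * Real.exp (-δ / h') := by
      -- Here h' ≤ h enters: the growth of F, measured at scale h, is compared with a kernel gain at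
      -- scale h'.
      have hκ' : κ * θ y / h ≤ κ * θ y / h' := by
        gcongr
        exact mul_nonneg hκ.le (hθ0 y)
      have hneg : -(θ y * ‖ξ‖) - (‖x - y‖ ^ 2 - θ y ^ 2) / 2 + κ * θ y ≤ -δ := by
        have h1 : θ y * (κ + 1) ≤ θ y * ‖ξ‖ := mul_le_mul_of_nonneg_left hξ (hθ0 y)
        have h2 : θ y ^ 2 ≤ θ y := by
          have := (hθε y).trans hε1
          nlinarith [hθ0 y]
        by_cases hy2 : y ∈ Metric.closedBall x₀ (2 * r)
        · have : θ y = ε := by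
            rw [hθdef]
            simp only
            rw [χ.one_of_mem_closedBall hy2, mul_one]
          linarith [sq_nonneg ‖x - y‖]
        · rw [mem_closedBall_iff_norm, not_le] at hy2
          have h3 := norm_sub_le_norm_sub_add_norm_sub y x x₀
          rw [norm_sub_rev y x] at h3
          have h4 : r ≤ ‖x - y‖ := by linarith
          have h5 : r ^ 2 ≤ ‖x - y‖ ^ 2 := by gcongr
          linarith [hθ0 y]
      calc ‖fbiKernel h' (toComplex x - Γ) ξ‖ * ‖F Γ‖
          ≤ Real.exp ((-(θ y * ‖ξ‖) - (‖x - y‖ ^ 2 - θ y ^ 2) / 2) / h') *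
            (A * Real.exp (κ * θ y / h')) := by
            rw [hker]
            gcongr
            exact hFΓ.trans (by gcongr)
        _ = A * Real.exp ((-(θ y * ‖ξ‖) - (‖x - y‖ ^ 2 - θ y ^ 2) / 2 + κ * θ y) / h') := by
            rw [add_div, Real.exp_add]; ring
        _ ≤ _ := by gcongr
    rw [norm_mul, norm_mul]
    gcongr
  have htot : ‖∫ y, fbiKernel h' (toComplex x - toComplex y) ξ * v y‖ ≤
      A * Real.exp (-δ / h') * ((1 + B) * volume.real K + I₀ + 1) := by
    rw [← integral_add_compl hKm hint]
    refine (norm_add_le _ _).trans ((add_le_add hin hout).trans ?_)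
    have : 0 ≤ A * Real.exp (-δ / h') := by positivity
    nlinarith
  have hpre : (Real.pi * h') ^ (-(3 * (n : ℝ)) / 4) * Real.exp (-δ / h') ≤
      Real.pi ^ (-(3 * (n : ℝ)) / 4) * Cp * Real.exp (-(δ / 2) / h') := by
    rw [Real.mul_rpow Real.pi_pos.le hh'.le, mul_assoc, mul_assoc]
    refine mul_le_mul_of_nonneg_left ?_ (by positivity)
    rw [neg_div]
    exact hCpb h' hh'
  rw [fbi_eq, norm_mul, Complex.norm_real, Real.norm_of_nonneg (by positivity)]
  calc _ ≤ 2 ^ (-(n : ℝ) / 2) * (Real.pi * h') ^ (-(3 * (n : ℝ)) / 4) *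
        (A * Real.exp (-δ / h') * ((1 + B) * volume.real K + I₀ + 1)) := by gcongr
    _ = 2 ^ (-(n : ℝ) / 2) * ((Real.pi * h') ^ (-(3 * (n : ℝ)) / 4) * Real.exp (-δ / h')) * A *
        ((1 + B) * volume.real K + I₀ + 1) := by ring
    _ ≤ 2 ^ (-(n : ℝ) / 2) * (Real.pi ^ (-(3 * (n : ℝ)) / 4) * Cp * Real.exp (-(δ / 2) / h')) * A *
        ((1 + B) * volume.real K + I₀ + 1) := by gcongr
    _ = _ := by rw [hC₁]; ring

end HolomorphicToFBI

/-! ### Superpositions of FBI kernels with a compactly supported amplitude. -/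

section Synthesis

variable {n : ℕ}

/-- The superposition `∫∫ b(ξ) exp (i(z-y)·ξ/t - (z-y)²/(2t)) v(y) dξ dy`. -/
noncomputable def fbiSynthesis (b : EuclideanSpace ℝ (Fin n) → ℝ) (t : ℝ)
    (v : EuclideanSpace ℝ (Fin n) → ℂ) (z : EuclideanSpace ℂ (Fin n)) : ℂ :=
  ∫ p : EuclideanSpace ℝ (Fin n) × EuclideanSpace ℝ (Fin n),
    b p.1 * fbiKernel t (z - toComplex p.2) p.1 * v p.2

theorem norm_fbiKernel_sub_le {t : ℝ} (ht : 0 < t) (z : EuclideanSpace ℂ (Fin n))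
    (y ξ : EuclideanSpace ℝ (Fin n)) :
    ‖fbiKernel t (z - toComplex y) ξ‖ ≤
      Real.exp ((‖imPart z‖ * ‖ξ‖ + ‖imPart z‖ ^ 2 / 2) / t) *
        Real.exp (-‖rePart z - y‖ ^ 2 / (2 * t)) := by
  have := norm_fbiKernel_le ht (z - toComplex y) ξ
  rwa [rePart_sub_toComplex, imPart_sub_toComplex] at this

/-- A bound on the FBI kernel which is locally uniform in `z`. -/
theorem norm_fbiKernel_sub_le_of_mem_ball {t B : ℝ} (ht : 0 < t) {z z₀ : EuclideanSpace ℂ (Fin n)}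
    (hz : z ∈ Metric.ball z₀ 1) (y : EuclideanSpace ℝ (Fin n)) {ξ : EuclideanSpace ℝ (Fin n)}
    (hξ : ‖ξ‖ ≤ B) :
    ‖fbiKernel t (z - toComplex y) ξ‖ ≤
      Real.exp (((‖z₀‖ + 1) * B + (‖z₀‖ + 1) ^ 2 / 2 + 1 / 2) / t) *
        Real.exp (-‖rePart z₀ - y‖ ^ 2 / (4 * t)) := by
  refine (norm_fbiKernel_sub_le ht z y ξ).trans ?_
  rw [mem_ball_iff_norm] at hz
  have h1 : ‖imPart z‖ ≤ ‖z₀‖ + 1 := by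
    have := norm_add_le (z - z₀) z₀
    rw [sub_add_cancel] at this
    linarith [norm_imPart_le z]
  have h2 : ‖rePart z₀ - rePart z‖ ≤ 1 := by
    have h3 : rePart z₀ - rePart z = rePart (z₀ - z) := by ext j; simp
    rw [h3]
    refine (norm_rePart_le _).trans ?_
    rw [norm_sub_rev]
    exact hz.le
  -- From (1 + a)² ≤ 2a² + 2; the factor 2 is why the Gaussian widens from 2t to 4t.
  have h4 : ‖rePart z₀ - y‖ ^ 2 ≤ 2 * ‖rePart z - y‖ ^ 2 + 2 := by
    have h5 := norm_add_le (rePart z₀ - rePart z) (rePart z - y)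
    rw [sub_add_sub_cancel] at h5
    have h6 : ‖rePart z₀ - y‖ ≤ 1 + ‖rePart z - y‖ := by linarith
    have h7 : ‖rePart z₀ - y‖ ^ 2 ≤ (1 + ‖rePart z - y‖) ^ 2 := by gcongr
    nlinarith [sq_nonneg (‖rePart z - y‖ - 1)]
  rw [← Real.exp_add, ← Real.exp_add]
  apply Real.exp_le_exp.2
  have h8 : -‖rePart z - y‖ ^ 2 / (2 * t) = (-‖rePart z - y‖ ^ 2 / 2) / t := by rw [div_div]
  have h9 : -‖rePart z₀ - y‖ ^ 2 / (4 * t) = (-‖rePart z₀ - y‖ ^ 2 / 4) / t := by rw [div_div]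
  rw [h8, h9, ← add_div, ← add_div]
  have hξ0 := norm_nonneg ξ
  have h10 : ‖imPart z‖ * ‖ξ‖ ≤ (‖z₀‖ + 1) * B := by gcongr
  have h11 : ‖imPart z‖ ^ 2 ≤ (‖z₀‖ + 1) ^ 2 := by gcongr
  refine div_le_div_of_nonneg_right ?_ ht.le
  linarith

theorem continuous_fbiKernel_sub (t : ℝ) (z : EuclideanSpace ℂ (Fin n)) :
    Continuous fun p : EuclideanSpace ℝ (Fin n) × EuclideanSpace ℝ (Fin n) =>
      fbiKernel t (z - toComplex p.2) p.1 :=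
  continuous_fbiKernel t (continuous_const.sub (continuous_toComplex.comp continuous_snd))
    continuous_fst

theorem hasCompactSupport_of_norm_gt {b : EuclideanSpace ℝ (Fin n) → ℝ} {B : ℝ}
    (hB : ∀ ξ, B < ‖ξ‖ → b ξ = 0) : HasCompactSupport b := by
  refine HasCompactSupport.intro (isCompact_closedBall 0 B) fun ξ hξ => hB ξ ?_
  simpa using hξ

variable {b : EuclideanSpace ℝ (Fin n) → ℝ} {v : EuclideanSpace ℝ (Fin n) → ℂ} {A B t : ℝ}

theorem aestronglyMeasurable_fbiSynthesis (hb : Continuous b) (hv : Measurable v)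
    (z : EuclideanSpace ℂ (Fin n)) : AEStronglyMeasurable
      fun p : EuclideanSpace ℝ (Fin n) × EuclideanSpace ℝ (Fin n) =>
        (b p.1 : ℂ) * fbiKernel t (z - toComplex p.2) p.1 * v p.2 := by
  have h1 : Continuous fun p : EuclideanSpace ℝ (Fin n) × EuclideanSpace ℝ (Fin n) =>
      (b p.1 : ℂ) * fbiKernel t (z - toComplex p.2) p.1 :=
    (Complex.continuous_ofReal.comp (hb.comp continuous_fst)).mul (continuous_fbiKernel_sub t z)
  exact (h1.measurable.mul (hv.comp measurable_snd)).aestronglyMeasurable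

theorem norm_fbiSynthesis_integrand_le (ht : 0 < t) (hvA : ∀ y, ‖v y‖ ≤ A)
    (hB : ∀ ξ, B < ‖ξ‖ → b ξ = 0) {z z₀ : EuclideanSpace ℂ (Fin n)} (hz : z ∈ Metric.ball z₀ 1)
    (p : EuclideanSpace ℝ (Fin n) × EuclideanSpace ℝ (Fin n)) :
    ‖(b p.1 : ℂ) * fbiKernel t (z - toComplex p.2) p.1 * v p.2‖ ≤ |b p.1| *
      (Real.exp (((‖z₀‖ + 1) * B + (‖z₀‖ + 1) ^ 2 / 2 + 1 / 2) / t) * A *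
        Real.exp (-‖rePart z₀ - p.2‖ ^ 2 / (4 * t))) := by
  rw [norm_mul, norm_mul, Complex.norm_real, Real.norm_eq_abs, mul_assoc]
  rcases le_or_gt ‖p.1‖ B with h | h
  · have := norm_fbiKernel_sub_le_of_mem_ball ht hz p.2 h
    calc _ ≤ |b p.1| * (Real.exp (((‖z₀‖ + 1) * B + (‖z₀‖ + 1) ^ 2 / 2 + 1 / 2) / t) *
        Real.exp (-‖rePart z₀ - p.2‖ ^ 2 / (4 * t)) * A) := by
          gcongr
          exact hvA _
      _ = _ := by ring
  · simp [hB _ h]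

theorem integrable_fbiSynthesis_bound (ht : 0 < t) (hb : Continuous b)
    (hB : ∀ ξ, B < ‖ξ‖ → b ξ = 0) (C : ℝ) (x : EuclideanSpace ℝ (Fin n)) :
    Integrable fun p : EuclideanSpace ℝ (Fin n) × EuclideanSpace ℝ (Fin n) =>
      |b p.1| * (C * Real.exp (-‖x - p.2‖ ^ 2 / (4 * t))) :=
  Integrable.mul_prod (hb.integrable_of_hasCompactSupport (hasCompactSupport_of_norm_gt hB)).abs
    ((integrable_gaussian (by positivity) x).const_mul C)

theorem integrable_fbiSynthesis (ht : 0 < t) (hb : Continuous b) (hB : ∀ ξ, B < ‖ξ‖ → b ξ = 0)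
    (hv : Measurable v) (hvA : ∀ y, ‖v y‖ ≤ A) (z : EuclideanSpace ℂ (Fin n)) :
    Integrable fun p : EuclideanSpace ℝ (Fin n) × EuclideanSpace ℝ (Fin n) =>
      (b p.1 : ℂ) * fbiKernel t (z - toComplex p.2) p.1 * v p.2 :=
  (integrable_fbiSynthesis_bound ht hb hB _ _).mono' (aestronglyMeasurable_fbiSynthesis hb hv z)
    (ae_of_all _ (norm_fbiSynthesis_integrand_le ht hvA hB (Metric.mem_ball_self one_pos)))

theorem differentiable_fbiSynthesis (ht : 0 < t) (hb : Continuous b)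
    (hB : ∀ ξ, B < ‖ξ‖ → b ξ = 0) (hv : Measurable v) (hvA : ∀ y, ‖v y‖ ≤ A) :
    Differentiable ℂ (fbiSynthesis b t v) := by
  intro z₀
  refine (differentiableOn_integral (W := Metric.ball z₀ 1) Metric.isOpen_ball
    (integrable_fbiSynthesis_bound ht hb hB _ (rePart z₀))
    (fun z _ => aestronglyMeasurable_fbiSynthesis hb hv z) (fun p => ?_)
    (fun z hz p => norm_fbiSynthesis_integrand_le ht hvA hB hz p)).differentiableAt
    (Metric.ball_mem_nhds z₀ one_pos)
  refine DifferentiableOn.mul_const (DifferentiableOn.const_mul (Differentiable.differentiableOn ?_)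
    _) _
  exact (differentiable_fbiKernel t p.1).comp (differentiable_id.sub_const _)

/-- In this order the inner integral is an unnormalised FBI transform, to which decay applies. -/
theorem fbiSynthesis_eq_integral_fst (ht : 0 < t) (hb : Continuous b)
    (hB : ∀ ξ, B < ‖ξ‖ → b ξ = 0) (hv : Measurable v) (hvA : ∀ y, ‖v y‖ ≤ A)
    (z : EuclideanSpace ℂ (Fin n)) :
    fbiSynthesis b t v z = ∫ ξ, (b ξ : ℂ) * ∫ y, fbiKernel t (z - toComplex y) ξ * v y := by
  rw [fbiSynthesis, Measure.volume_eq_prod,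
    integral_prod _ (integrable_fbiSynthesis ht hb hB hv hvA z)]
  refine integral_congr_ae (ae_of_all _ fun ξ => ?_)
  simp only [mul_assoc, integral_const_mul]

/-- In this order the inner integral is a convolution kernel independent of v, suited to
differentiating in t and to the limit t → 0. -/
theorem fbiSynthesis_eq_integral_snd (ht : 0 < t) (hb : Continuous b)
    (hB : ∀ ξ, B < ‖ξ‖ → b ξ = 0) (hv : Measurable v) (hvA : ∀ y, ‖v y‖ ≤ A)
    (z : EuclideanSpace ℂ (Fin n)) :
    fbiSynthesis b t v z = ∫ y, (∫ ξ, (b ξ : ℂ) * fbiKernel t (z - toComplex y) ξ) * v y := by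
  rw [fbiSynthesis, Measure.volume_eq_prod,
    integral_prod_symm _ (integrable_fbiSynthesis ht hb hB hv hvA z)]
  refine integral_congr_ae (ae_of_all _ fun y => ?_)
  simp only [integral_mul_const]

theorem norm_integral_fbiKernel_le (ht : 0 < t) (hb : Continuous b)
    (hB : ∀ ξ, B < ‖ξ‖ → b ξ = 0) (z : EuclideanSpace ℂ (Fin n)) (y : EuclideanSpace ℝ (Fin n)) :
    ‖∫ ξ, (b ξ : ℂ) * fbiKernel t (z - toComplex y) ξ‖ ≤
      (∫ ξ, |b ξ|) * (Real.exp ((‖imPart z‖ * B + ‖imPart z‖ ^ 2 / 2) / t) *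
        Real.exp (-‖rePart z - y‖ ^ 2 / (2 * t))) := by
  rw [← integral_mul_const]
  refine norm_integral_le_of_norm_le ((hb.integrable_of_hasCompactSupport
    (hasCompactSupport_of_norm_gt hB)).abs.mul_const _) (ae_of_all _ fun ξ => ?_)
  rw [norm_mul, Complex.norm_real, Real.norm_eq_abs]
  rcases le_or_gt ‖ξ‖ B with h | h
  · gcongr
    exact (norm_fbiKernel_sub_le ht z y ξ).trans (by gcongr)
  · simp [hB _ h]

/-- The crude bound with no decay assumed; at t = h it provides the growth e^{C/h} of the extension.
-/
theorem norm_fbiSynthesis_le (ht : 0 < t) (hb : Continuous b) (hB : ∀ ξ, B < ‖ξ‖ → b ξ = 0)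
    (hv : Measurable v) (hvA : ∀ y, ‖v y‖ ≤ A) (z : EuclideanSpace ℂ (Fin n)) :
    ‖fbiSynthesis b t v z‖ ≤ (∫ ξ, |b ξ|) *
      Real.exp ((‖imPart z‖ * B + ‖imPart z‖ ^ 2 / 2) / t) * A *
        ∫ y : EuclideanSpace ℝ (Fin n), Real.exp (-‖y‖ ^ 2 / (2 * t)) := by
  rw [fbiSynthesis_eq_integral_snd ht hb hB hv hvA, ← integral_gaussian_sub (rePart z),
    ← integral_const_mul]
  refine norm_integral_le_of_norm_le
    ((integrable_gaussian (by positivity) (rePart z)).const_mul _) (ae_of_all _ fun y => ?_)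
  rw [norm_mul]
  calc _ ≤ (∫ ξ, |b ξ|) * (Real.exp ((‖imPart z‖ * B + ‖imPart z‖ ^ 2 / 2) / t) *
        Real.exp (-‖rePart z - y‖ ^ 2 / (2 * t))) * A := by
        gcongr
        · exact norm_integral_fbiKernel_le ht hb hB z y
        · exact hvA y
    _ = _ := by ring

/-- The analytic continuation of the FBI integral in the base variable. -/
theorem differentiable_integral_fbiKernel (ht : 0 < t) (hv : Measurable v)
    (hvA : ∀ y, ‖v y‖ ≤ A) (ξ : EuclideanSpace ℝ (Fin n)) :
    Differentiable ℂ fun z => ∫ y, fbiKernel t (z - toComplex y) ξ * v y := by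
  intro z₀
  have hA : 0 ≤ A := (norm_nonneg _).trans (hvA 0)
  refine (differentiableOn_integral (W := Metric.ball z₀ 1) Metric.isOpen_ball
    (b := fun y => Real.exp (((‖z₀‖ + 1) * ‖ξ‖ + (‖z₀‖ + 1) ^ 2 / 2 + 1 / 2) / t) *
        Real.exp (-‖rePart z₀ - y‖ ^ 2 / (4 * t)) * A)
    (((integrable_gaussian (by positivity) (rePart z₀)).const_mul _).mul_const _)
    (fun z _ => ?_) (fun y => ?_) (fun z hz y => ?_)).differentiableAt
    (Metric.ball_mem_nhds z₀ one_pos)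
  · exact (integrable_fbiKernel_mul ht hv.aestronglyMeasurable (ae_of_all _ hvA) z ξ).1
  · refine DifferentiableOn.mul_const (Differentiable.differentiableOn ?_) _
    exact (differentiable_fbiKernel t ξ).comp (differentiable_id.sub_const _)
  · rw [norm_mul]
    gcongr
    · exact norm_fbiKernel_sub_le_of_mem_ball ht hz y le_rfl
    · exact hvA y

theorem norm_integral_fbiKernel_mul_le (ht : 0 < t) (hvA : ∀ y, ‖v y‖ ≤ A)
    (z : EuclideanSpace ℂ (Fin n)) (ξ : EuclideanSpace ℝ (Fin n)) :
    ‖∫ y, fbiKernel t (z - toComplex y) ξ * v y‖ ≤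
      Real.exp ((‖imPart z‖ * ‖ξ‖ + ‖imPart z‖ ^ 2 / 2) / t) * A *
        ∫ y : EuclideanSpace ℝ (Fin n), Real.exp (-‖y‖ ^ 2 / (2 * t)) := by
  have hA : 0 ≤ A := (norm_nonneg _).trans (hvA 0)
  rw [← integral_gaussian_sub (rePart z), ← integral_const_mul]
  refine norm_integral_le_of_norm_le
    ((integrable_gaussian (by positivity) (rePart z)).const_mul _) (ae_of_all _ fun y => ?_)
  rw [norm_mul, mul_right_comm]
  gcongr
  · exact norm_fbiKernel_sub_le ht z y ξ
  · exact hvA y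

end Synthesis

/-! ### The kernel identity for the derivative in the scale. -/

section Evolution

variable {n : ℕ}

/-- The `j`-th partial derivative. -/
noncomputable def partialDeriv (j : Fin n) (χ : EuclideanSpace ℝ (Fin n) → ℝ) :
    EuclideanSpace ℝ (Fin n) → ℝ :=
  fun ξ => fderiv ℝ χ ξ (EuclideanSpace.single j 1)

theorem contDiff_partialDeriv {χ : EuclideanSpace ℝ (Fin n) → ℝ} (hχ : ContDiff ℝ ∞ χ)
    (j : Fin n) : ContDiff ℝ ∞ (partialDeriv j χ) :=
  (hχ.fderiv_right (by simp)).clm_apply contDiff_const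

theorem partialDeriv_eq_zero {χ : EuclideanSpace ℝ (Fin n) → ℝ} {U : Set (EuclideanSpace ℝ (Fin n))}
    (hU : IsOpen U) {c : ℝ} (h : ∀ ξ ∈ U, χ ξ = c) (j : Fin n) :
    ∀ ξ ∈ U, partialDeriv j χ ξ = 0 := by
  intro ξ hξ
  have : χ =ᶠ[𝓝 ξ] fun _ => c := eventually_of_mem (hU.mem_nhds hξ) h
  rw [partialDeriv, this.fderiv_eq]
  simp

/-- The amplitude `ξ·∇χ/t - Δχ/2`. -/
noncomputable def evolutionSymbol (χ : EuclideanSpace ℝ (Fin n) → ℝ) (t : ℝ)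
    (ξ : EuclideanSpace ℝ (Fin n)) : ℝ :=
  (∑ j, ξ j * partialDeriv j χ ξ) / t - (∑ j, partialDeriv j (partialDeriv j χ) ξ) / 2

theorem continuous_evolutionSymbol {χ : EuclideanSpace ℝ (Fin n) → ℝ} (hχ : ContDiff ℝ ∞ χ)
    (t : ℝ) : Continuous (evolutionSymbol χ t) := by
  have h1 := fun j => (contDiff_partialDeriv hχ j).continuous
  have h2 := fun j => (contDiff_partialDeriv (contDiff_partialDeriv hχ j) j).continuous
  unfold evolutionSymbol
  fun_prop

/-- Only derivatives of χ occur, so the low frequencies where χ = 1, on which no decay is known,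
drop out. -/
theorem evolutionSymbol_eq_zero {χ : EuclideanSpace ℝ (Fin n) → ℝ}
    {U : Set (EuclideanSpace ℝ (Fin n))} (hU : IsOpen U) {c : ℝ} (h : ∀ ξ ∈ U, χ ξ = c) (t : ℝ) :
    ∀ ξ ∈ U, evolutionSymbol χ t ξ = 0 := by
  intro ξ hξ
  have h1 := fun j => partialDeriv_eq_zero hU h j
  have h2 := fun j => partialDeriv_eq_zero hU (h1 j) j
  simp [evolutionSymbol, h1 _ ξ hξ, h2 _ ξ hξ]

theorem hasLineDerivAt_fbiKernel (t : ℝ) (a : EuclideanSpace ℂ (Fin n))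
    (ξ : EuclideanSpace ℝ (Fin n)) (j : Fin n) :
    HasLineDerivAt ℝ (fbiKernel t a) (Complex.I * a j / t * fbiKernel t a ξ) ξ
      (EuclideanSpace.single j 1) := by
  have h0 : ∀ i, HasDerivAt (fun s : ℝ => (((ξ + s • EuclideanSpace.single j (1 : ℝ)) i : ℝ) : ℂ))
      (if i = j then 1 else 0) 0 := by
    intro i
    have h1 : HasDerivAt (fun s : ℝ => (ξ + s • EuclideanSpace.single j (1 : ℝ)) i)
        (if i = j then 1 else 0) 0 := by
      simp only [PiLp.add_apply, PiLp.smul_apply, PiLp.single_apply, smul_eq_mul]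
      simpa using ((hasDerivAt_id (0 : ℝ)).mul_const (if i = j then (1 : ℝ) else 0)).const_add (ξ i)
    refine h1.ofReal_comp.congr_deriv ?_
    split_ifs <;> simp
  have h2 : HasDerivAt (fun s : ℝ => (Complex.I * ∑ i, a i *
      (((ξ + s • EuclideanSpace.single j (1 : ℝ)) i : ℝ) : ℂ) - (∑ i, a i ^ 2) / 2) / t)
      (Complex.I * (∑ i, a i * (if i = j then 1 else 0)) / t) 0 :=
    (((HasDerivAt.fun_sum fun i _ => (h0 i).const_mul (a i)).const_mul Complex.I).sub_const
      _).div_const _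
  refine h2.cexp.congr_deriv ?_
  simp only [mul_ite, mul_one, mul_zero, Finset.sum_ite_eq', Finset.mem_univ, if_true, zero_smul,
    add_zero]
  rw [fbiKernel, mul_comm]

theorem hasLineDerivAt_of_contDiff {χ : EuclideanSpace ℝ (Fin n) → ℝ} (hχ : ContDiff ℝ ∞ χ)
    (ξ : EuclideanSpace ℝ (Fin n)) (j : Fin n) :
    HasLineDerivAt ℝ (fun ξ => (χ ξ : ℂ)) (partialDeriv j χ ξ : ℂ) ξ
      (EuclideanSpace.single j 1) :=
  HasDerivAt.ofReal_comp ((hχ.differentiable (by simp) ξ).hasFDerivAt.hasLineDerivAt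
    (EuclideanSpace.single j 1))

/-- The kernel identity behind the inversion formula: integration by parts turns the derivative
in the scale into an amplitude supported where `χ` is not locally constant. -/
theorem integral_evolution {χ : EuclideanSpace ℝ (Fin n) → ℝ} (hχ : ContDiff ℝ ∞ χ)
    (hχc : HasCompactSupport χ) {t : ℝ} (ht : 0 < t) (a : EuclideanSpace ℂ (Fin n)) :
    ∫ ξ, (χ ξ : ℂ) * ((-n / t - (Complex.I * ∑ j, a j * ξ j - (∑ j, a j ^ 2) / 2) / t ^ 2) *
        fbiKernel t a ξ) = ∫ ξ, (evolutionSymbol χ t ξ : ℂ) * fbiKernel t a ξ := by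
  have hd := fun j => contDiff_partialDeriv hχ j
  have hdd := fun j => contDiff_partialDeriv (hd j) j
  have hdc : ∀ j, HasCompactSupport (partialDeriv j χ) := fun j =>
    hχc.fderiv_apply (𝕜 := ℝ) (EuclideanSpace.single j (1 : ℝ))
  have hddc : ∀ j, HasCompactSupport (partialDeriv j (partialDeriv j χ)) := fun j =>
    (hdc j).fderiv_apply (𝕜 := ℝ) (EuclideanSpace.single j (1 : ℝ))
  have hχ' := hχ.continuous
  have hd' := fun j => (hd j).continuous
  have hdd' := fun j => (hdd j).continuous
  have hk : Continuous (fbiKernel t a) := continuous_fbiKernel t continuous_const continuous_id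
  have hint : ∀ {f : EuclideanSpace ℝ (Fin n) → ℝ} {g : EuclideanSpace ℝ (Fin n) → ℂ},
      Continuous f → Continuous g → HasCompactSupport f → Integrable fun ξ => (f ξ : ℂ) * g ξ := by
    intro f g hf hg hfc
    have hfc' : HasCompactSupport fun ξ => (f ξ : ℂ) := hfc.comp_left (g := Complex.ofReal) (by simp)
    exact ((Complex.continuous_ofReal.comp hf).mul hg).integrable_of_hasCompactSupport hfc'.mul_right
  have htC : (t : ℂ) ≠ 0 := by exact_mod_cast ht.ne'
  set q : Fin n → EuclideanSpace ℝ (Fin n) → ℂ := fun j ξ =>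
    -- Since ∂_j k = (i a_j/t) k, the product q_j k is −ξ_j k/t − ½∂_j k, and its divergence is the
    -- scale derivative of the kernel. Then Ψ_j = χ q_j k + ½ ∂_jχ k is the flux whose divergence is
    -- the difference of the two integrands.
    -(ξ j / t) - Complex.I * a j / t / 2 with hq
  have hqc : ∀ j, Continuous (q j) := fun j => by simp only [hq]; fun_prop
  set Ψ : Fin n → EuclideanSpace ℝ (Fin n) → ℂ := fun j ξ =>
    χ ξ * (q j ξ * fbiKernel t a ξ) + partialDeriv j χ ξ * (1 / 2 * fbiKernel t a ξ) with hΨ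
  set D : Fin n → EuclideanSpace ℝ (Fin n) → ℂ := fun j ξ =>
    χ ξ * ((-(1 / t) + q j ξ * (Complex.I * a j / t)) * fbiKernel t a ξ) +
      (partialDeriv j χ ξ * ((q j ξ + 1 / 2 * (Complex.I * a j / t)) * fbiKernel t a ξ) +
        partialDeriv j (partialDeriv j χ) ξ * (1 / 2 * fbiKernel t a ξ)) with hD
  have hΨint : ∀ j, Integrable (Ψ j) := fun j =>
    (hint hχ' ((hqc j).mul hk) hχc).add (hint (hd' j) (continuous_const.mul hk) (hdc j))
  have hDint : ∀ j, Integrable (D j) := by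
    intro j
    have := hqc j
    exact (hint hχ' (by fun_prop) hχc).add ((hint (hd' j) (by fun_prop) (hdc j)).add
      (hint (hdd' j) (by fun_prop) (hddc j)))
  have hzero : ∀ j, ∫ ξ, D j ξ = 0 := by
    intro j
    refine integral_lineDeriv_eq_zero (e := EuclideanSpace.single j 1) (hΨint j) (hDint j)
      fun ξ => ?_
    have h1 := hasLineDerivAt_of_contDiff hχ ξ j
    have h2 := hasLineDerivAt_of_contDiff (hd j) ξ j
    have h3 := hasLineDerivAt_fbiKernel t a ξ j
    have h4 : HasLineDerivAt ℝ (q j) (-(1 / t)) ξ (EuclideanSpace.single j 1) := by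
      have h5 : HasDerivAt (fun s : ℝ => (ξ + s • EuclideanSpace.single j (1 : ℝ)) j) 1 0 := by
        simp only [PiLp.add_apply, PiLp.smul_apply, PiLp.single_apply, smul_eq_mul]
        simpa using (hasDerivAt_id (0 : ℝ)).const_add (ξ j)
      have := ((h5.ofReal_comp.div_const (t : ℂ)).neg).sub_const (Complex.I * a j / t / 2)
      exact this.congr_deriv (by simp)
    have h6 := (HasDerivAt.mul h1 (HasDerivAt.mul h4 h3)).add
      (HasDerivAt.mul h2 (HasDerivAt.const_mul (1 / 2 : ℂ) h3))
    refine HasDerivAt.congr_deriv h6 ?_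
    simp only [hD, zero_smul, add_zero, Pi.mul_apply]
    ring
  rw [← sub_eq_zero, ← integral_sub]
  · have hsum : ∫ ξ, ∑ j, D j ξ = 0 := by
      rw [integral_finsetSum _ fun j _ => hDint j]
      simp [hzero]
    rw [← hsum]
    refine integral_congr_ae (ae_of_all _ fun ξ => ?_)
    have hDj : ∀ j, D j ξ = (χ ξ * (-(1 / t) - (Complex.I * (a j * ξ j) - a j ^ 2 / 2) / t ^ 2) -
        (ξ j * partialDeriv j χ ξ / t - partialDeriv j (partialDeriv j χ) ξ / 2)) *
          fbiKernel t a ξ := by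
      intro j
      simp only [hD, hq]
      field_simp
      ring_nf
      rw [Complex.I_sq]
      ring
    simp only [hDj, ← Finset.sum_mul, Finset.sum_sub_distrib, ← Finset.mul_sum, evolutionSymbol,
      ← Finset.sum_div, Finset.sum_const, Finset.card_univ, Fintype.card_fin, nsmul_eq_mul]
    push_cast
    ring
  · exact hint hχ' (by fun_prop) hχc
  · refine hint (continuous_evolutionSymbol hχ t) hk ?_
    have h1 : HasCompactSupport fun ξ : EuclideanSpace ℝ (Fin n) => evolutionSymbol χ t ξ := by
      refine hχc.mono' ?_
      intro ξ hξ
      by_contra hne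
      exact hξ (evolutionSymbol_eq_zero (isClosed_tsupport χ).isOpen_compl
        (fun ξ hξ => image_eq_zero_of_notMem_tsupport hξ) t ξ hne)
    exact h1

end Evolution

/-! ### Differentiating the truncated inversion formula in the scale. -/

section ScaleDerivative

variable {n : ℕ} {χ : EuclideanSpace ℝ (Fin n) → ℝ} {v : EuclideanSpace ℝ (Fin n) → ℂ} {A B : ℝ}

theorem hasDerivAt_fbiKernel_scale {t : ℝ} (ht : 0 < t) (a : EuclideanSpace ℂ (Fin n))
    (ξ : EuclideanSpace ℝ (Fin n)) :
    HasDerivAt (fun t : ℝ => ((t : ℂ) ^ n)⁻¹ * fbiKernel t a ξ)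
      (((t : ℂ) ^ n)⁻¹ * ((-n / t - (Complex.I * ∑ j, a j * ξ j - (∑ j, a j ^ 2) / 2) / t ^ 2) *
        fbiKernel t a ξ)) t := by
  have htC : (t : ℂ) ≠ 0 := by exact_mod_cast ht.ne'
  have h0 : HasDerivAt (fun t : ℝ => (t : ℂ)) 1 t := by
    simpa using (hasDerivAt_id t).ofReal_comp
  set N := Complex.I * ∑ j, a j * ξ j - (∑ j, a j ^ 2) / 2 with hN
  have h1 : HasDerivAt (fun t : ℝ => N / (t : ℂ)) (-N / (t : ℂ) ^ 2) t := by
    refine ((hasDerivAt_const t N).div h0 htC).congr_deriv ?_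
    ring
  have h2 := ((h0.pow n).inv (pow_ne_zero n htC)).mul h1.cexp
  have h3 : Complex.exp (N / t) = fbiKernel t a ξ := rfl
  refine h2.congr_deriv ?_
  rw [h3]
  have h4 : -((n : ℂ) * (t : ℂ) ^ (n - 1) * 1) / ((t : ℂ) ^ n) ^ 2 = ((t : ℂ) ^ n)⁻¹ * (-n / t) := by
    rcases Nat.eq_zero_or_pos n with rfl | hn
    · simp
    · obtain ⟨m, rfl⟩ := Nat.exists_eq_succ_of_ne_zero hn.ne'
      simp only [Nat.succ_eq_add_one, Nat.add_sub_cancel]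
      field_simp
      ring
  simp only [Pi.inv_apply, Pi.pow_apply]
  rw [h4]
  ring

theorem hasDerivAt_integral_fbiKernel_scale (hχ : ContDiff ℝ ∞ χ)
    (hB : ∀ ξ, B < ‖ξ‖ → χ ξ = 0) {t : ℝ} (ht : 0 < t) (a : EuclideanSpace ℂ (Fin n)) :
    HasDerivAt (fun t : ℝ => ((t : ℂ) ^ n)⁻¹ * ∫ ξ, (χ ξ : ℂ) * fbiKernel t a ξ)
      (((t : ℂ) ^ n)⁻¹ * ∫ ξ, (evolutionSymbol χ t ξ : ℂ) * fbiKernel t a ξ) t := by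
  have hχc := hχ.continuous
  have hKint : ∀ g : EuclideanSpace ℝ (Fin n) → ℂ,
      ∫ ξ in Metric.closedBall 0 B, (χ ξ : ℂ) * g ξ = ∫ ξ, (χ ξ : ℂ) * g ξ := by
    intro g
    refine setIntegral_eq_integral_of_forall_compl_eq_zero fun ξ hξ => ?_
    rw [mem_closedBall_zero_iff, not_le] at hξ
    rw [hB ξ hξ]
    simp
  have key := hasDerivAt_setIntegral_of_continuousOn
    (μ := (volume : Measure (EuclideanSpace ℝ (Fin n))))
    (isCompact_closedBall (0 : EuclideanSpace ℝ (Fin n)) B) (isOpen_Ioi (a := (0 : ℝ)))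
    (Φ := fun t ξ => (χ ξ : ℂ) * (((t : ℂ) ^ n)⁻¹ * fbiKernel t a ξ))
    (Φ' := fun t ξ => (χ ξ : ℂ) * (((t : ℂ) ^ n)⁻¹ *
      ((-n / t - (Complex.I * ∑ j, a j * ξ j - (∑ j, a j ^ 2) / 2) / t ^ 2) * fbiKernel t a ξ)))
    (fun t _ => Continuous.continuousOn (by fun_prop)) ?_
    (fun t ht ξ _ => (hasDerivAt_fbiKernel_scale ht a ξ).const_mul _) ht
  · simp only [hKint] at key
    rw [← integral_evolution hχ (hasCompactSupport_of_norm_gt hB) ht a]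
    simp only [mul_left_comm (χ _ : ℂ), integral_const_mul] at key
    simp only [mul_left_comm (χ _ : ℂ)]
    exact key
  · simp only [Function.uncurry_def, fbiKernel]
    have h0 : ∀ p ∈ Ioi (0 : ℝ) ×ˢ Metric.closedBall (0 : EuclideanSpace ℝ (Fin n)) B,
        (p.1 : ℂ) ≠ 0 := fun p hp => by exact_mod_cast (ne_of_gt hp.1)
    have h1 : ContinuousOn (fun p : ℝ × EuclideanSpace ℝ (Fin n) => (p.1 : ℂ))
      (Ioi (0 : ℝ) ×ˢ Metric.closedBall (0 : EuclideanSpace ℝ (Fin n)) B) :=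
      Continuous.continuousOn (by fun_prop)
    have h2 : ContinuousOn (fun p : ℝ × EuclideanSpace ℝ (Fin n) =>
        Complex.I * ∑ j, a j * p.2 j - (∑ j, a j ^ 2) / 2)
      (Ioi (0 : ℝ) ×ˢ Metric.closedBall (0 : EuclideanSpace ℝ (Fin n)) B) :=
      Continuous.continuousOn (by fun_prop)
    have h3 : ContinuousOn (fun p : ℝ × EuclideanSpace ℝ (Fin n) => (χ p.2 : ℂ))
      (Ioi (0 : ℝ) ×ˢ Metric.closedBall (0 : EuclideanSpace ℝ (Fin n)) B) :=
      Continuous.continuousOn (by fun_prop)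
    refine h3.mul (((h1.pow n).inv₀ fun p hp => pow_ne_zero n (h0 p hp)).mul (ContinuousOn.mul
      ((continuousOn_const.div h1 h0).sub (h2.div (h1.pow 2) fun p hp => pow_ne_zero 2 (h0 p hp)))
      (h2.div h1 h0).cexp))

theorem evolutionSymbol_eq_zero_of_norm_gt (hB : ∀ ξ, B < ‖ξ‖ → χ ξ = 0) (t : ℝ) :
    ∀ ξ, B < ‖ξ‖ → evolutionSymbol χ t ξ = 0 :=
  evolutionSymbol_eq_zero (U := {ξ | B < ‖ξ‖}) (isOpen_lt continuous_const continuous_norm) hB t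

/-- The blow-up as t → 0 is only polynomial, hence absorbed by the exponential decay. -/
theorem exists_integral_abs_evolutionSymbol_le (hχ : ContDiff ℝ ∞ χ)
    (hB : ∀ ξ, B < ‖ξ‖ → χ ξ = 0) :
    ∃ M₁ M₂ : ℝ, 0 ≤ M₁ ∧ 0 ≤ M₂ ∧ ∀ t > 0, ∫ ξ, |evolutionSymbol χ t ξ| ≤ M₁ / t + M₂ := by
  have hU : IsOpen {ξ : EuclideanSpace ℝ (Fin n) | B < ‖ξ‖} :=
    isOpen_lt continuous_const continuous_norm
  have hd := fun j => contDiff_partialDeriv hχ j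
  have hdd := fun j => contDiff_partialDeriv (hd j) j
  have hd' := fun j => (hd j).continuous
  have hdd' := fun j => (hdd j).continuous
  have h0 := fun j => partialDeriv_eq_zero hU (c := 0) hB j
  have h00 := fun j => partialDeriv_eq_zero hU (h0 j) j
  have i1 : Integrable fun ξ : EuclideanSpace ℝ (Fin n) => |∑ j, ξ j * partialDeriv j χ ξ| := by
    refine (Continuous.integrable_of_hasCompactSupport (by fun_prop)
      (hasCompactSupport_of_norm_gt (B := B) fun ξ hξ => ?_)).abs
    simp [h0 _ ξ hξ]
  have i2 : Integrable fun ξ : EuclideanSpace ℝ (Fin n) =>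
      |∑ j, partialDeriv j (partialDeriv j χ) ξ| := by
    refine (Continuous.integrable_of_hasCompactSupport (by fun_prop)
      (hasCompactSupport_of_norm_gt (B := B) fun ξ hξ => ?_)).abs
    simp [h00 _ ξ hξ]
  refine ⟨∫ ξ : EuclideanSpace ℝ (Fin n), |∑ j, ξ j * partialDeriv j χ ξ|,
    (∫ ξ : EuclideanSpace ℝ (Fin n), |∑ j, partialDeriv j (partialDeriv j χ) ξ|) / 2,
    integral_nonneg fun _ => abs_nonneg _,
    div_nonneg (integral_nonneg fun _ => abs_nonneg _) zero_le_two, fun t ht => ?_⟩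
  rw [← integral_div, ← integral_div, ← integral_add (i1.div_const _) (i2.div_const _)]
  refine integral_mono_of_nonneg (ae_of_all _ fun _ => abs_nonneg _)
    ((i1.div_const _).add (i2.div_const _)) (ae_of_all _ fun ξ => ?_)
  simp only [evolutionSymbol]
  refine (abs_sub _ _).trans (le_of_eq ?_)
  rw [abs_div, abs_div, abs_of_pos ht, abs_of_pos (two_pos : (0 : ℝ) < 2)]

/-- The derivative in the scale of the frequency-truncated inversion formula. -/
theorem hasDerivAt_fbiSynthesis (hχ : ContDiff ℝ ∞ χ) (hB0 : 0 ≤ B)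
    (hB : ∀ ξ, B < ‖ξ‖ → χ ξ = 0) (hv : Measurable v) (hvA : ∀ y, ‖v y‖ ≤ A)
    (z : EuclideanSpace ℂ (Fin n)) {t₀ : ℝ} (ht₀ : 0 < t₀) :
    HasDerivAt (fun t : ℝ => ((t : ℂ) ^ n)⁻¹ * fbiSynthesis χ t v z)
      (((t₀ : ℂ) ^ n)⁻¹ * fbiSynthesis (evolutionSymbol χ t₀) t₀ v z) t₀ := by
  have hA : 0 ≤ A := (norm_nonneg _).trans (hvA 0)
  have hb := fun t => continuous_evolutionSymbol hχ t
  have hbB := fun t => evolutionSymbol_eq_zero_of_norm_gt hB t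
  obtain ⟨M₁, M₂, hM₁, hM₂, hM⟩ := exists_integral_abs_evolutionSymbol_le hχ hB
  have hmeas : ∀ {b : EuclideanSpace ℝ (Fin n) → ℝ} (t : ℝ), Continuous b → AEStronglyMeasurable
      (fun y => ((t : ℂ) ^ n)⁻¹ * (∫ ξ, (b ξ : ℂ) * fbiKernel t (z - toComplex y) ξ) * v y) := by
    intro b t hb
    have h1 : Continuous (Function.uncurry fun y ξ : EuclideanSpace ℝ (Fin n) =>
        (b ξ : ℂ) * fbiKernel t (z - toComplex y) ξ) := by
      have := continuous_toComplex (n := n)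
      simp only [Function.uncurry_def]
      fun_prop
    exact (((h1.stronglyMeasurable.integral_prod_right (ν := volume)).const_mul _).mul
      hv.stronglyMeasurable).aestronglyMeasurable
  set c := ‖imPart z‖ * B + ‖imPart z‖ ^ 2 / 2 with hc
  have hc0 : 0 ≤ c := by positivity
  -- Domination on t₀/2 < t < 2t₀: every factor blowing up as t → 0 is taken at t₀/2, and the
  -- Gaussian at 2t₀.
  set C := ((t₀ / 2) ^ n)⁻¹ * ((M₁ / (t₀ / 2) + M₂) * Real.exp (c / (t₀ / 2))) * A with hC
  have hnbhd : Ioo (t₀ / 2) (2 * t₀) ∈ 𝓝 t₀ := Ioo_mem_nhds (by linarith) (by linarith)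
  have key := (hasDerivAt_integral_of_dominated_loc_of_deriv_le (μ := volume)
    (F := fun (t : ℝ) y => ((t : ℂ) ^ n)⁻¹ * (∫ ξ, (χ ξ : ℂ) * fbiKernel t (z - toComplex y) ξ) * v y)
    (F' := fun (t : ℝ) y => ((t : ℂ) ^ n)⁻¹ *
      (∫ ξ, (evolutionSymbol χ t ξ : ℂ) * fbiKernel t (z - toComplex y) ξ) * v y)
    (bound := fun y => C * Real.exp (-‖rePart z - y‖ ^ 2 / (4 * t₀))) hnbhd
    (Eventually.of_forall fun t : ℝ => hmeas t hχ.continuous) ?_ (hmeas t₀ (hb t₀)) ?_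
    ((integrable_gaussian (by positivity) _).const_mul C) ?_).2
  · have hI : ∀ {b : EuclideanSpace ℝ (Fin n) → ℝ} {t : ℝ}, 0 < t → Continuous b →
        (∀ ξ, B < ‖ξ‖ → b ξ = 0) → ((t : ℂ) ^ n)⁻¹ * fbiSynthesis b t v z =
        ∫ y, ((t : ℂ) ^ n)⁻¹ * (∫ ξ, (b ξ : ℂ) * fbiKernel t (z - toComplex y) ξ) * v y := by
      intro b t ht hbc hbB
      rw [fbiSynthesis_eq_integral_snd ht hbc hbB hv hvA]
      simp only [mul_assoc, integral_const_mul]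
    rw [hI ht₀ (hb t₀) (hbB t₀)]
    refine key.congr_of_eventuallyEq ?_
    filter_upwards [hnbhd] with t ht
    exact hI (by linarith [ht.1]) hχ.continuous hB
  · refine ((integrable_gaussian (b := 2 * t₀) (by positivity) (rePart z)).const_mul
      ((t₀ ^ n)⁻¹ * ((∫ ξ, |χ ξ|) * Real.exp (c / t₀)) * A)).mono' (hmeas t₀ hχ.continuous)
      (ae_of_all _ fun y => ?_)
    rw [norm_mul, norm_mul, norm_inv, norm_pow, Complex.norm_real, Real.norm_of_nonneg ht₀.le]
    calc _ ≤ (t₀ ^ n)⁻¹ * ((∫ ξ, |χ ξ|) * (Real.exp (c / t₀) *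
          Real.exp (-‖rePart z - y‖ ^ 2 / (2 * t₀)))) * A := by
          gcongr
          · exact norm_integral_fbiKernel_le ht₀ hχ.continuous hB z y
          · exact hvA y
      _ = _ := by ring
  · refine ae_of_all _ fun y t ht => ?_
    have ht0 : 0 < t := by linarith [ht.1]
    rw [norm_mul, norm_mul, norm_inv, norm_pow, Complex.norm_real, Real.norm_of_nonneg ht0.le]
    have h1 : ∫ ξ, |evolutionSymbol χ t ξ| ≤ M₁ / (t₀ / 2) + M₂ := by
      refine (hM t ht0).trans ?_
      have := ht.1.le
      gcongr
    have h2 : Real.exp (c / t) ≤ Real.exp (c / (t₀ / 2)) := by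
      have := ht.1.le
      gcongr
    have h3 : Real.exp (-‖rePart z - y‖ ^ 2 / (2 * t)) ≤
        Real.exp (-‖rePart z - y‖ ^ 2 / (4 * t₀)) := by
      apply Real.exp_le_exp.2
      rw [neg_div (2 * t) _, neg_div (4 * t₀) _, neg_le_neg_iff]
      exact div_le_div_of_nonneg_left (sq_nonneg _) (by positivity) (by linarith [ht.2])
    have h4 : (t ^ n)⁻¹ ≤ ((t₀ / 2) ^ n)⁻¹ := by
      have := ht.1.le
      gcongr
    calc _ ≤ ((t₀ / 2) ^ n)⁻¹ * ((M₁ / (t₀ / 2) + M₂) * (Real.exp (c / (t₀ / 2)) *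
          Real.exp (-‖rePart z - y‖ ^ 2 / (4 * t₀)))) * A := by
          gcongr
          · refine (norm_integral_fbiKernel_le ht0 (hb t) (hbB t) z y).trans ?_
            gcongr
          · exact hvA y
      _ = _ := by rw [hC]; ring
  · refine ae_of_all _ fun y t ht => ?_
    exact (hasDerivAt_integral_fbiKernel_scale hχ hB (by linarith [ht.1]) _).mul_const _

end ScaleDerivative

/-! ### The limit t → 0 in the sense of distributions. -/

section WeakLimit

variable {n : ℕ} {χ : EuclideanSpace ℝ (Fin n) → ℝ} {v : EuclideanSpace ℝ (Fin n) → ℂ} {A B : ℝ}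

/-- The inverse Fourier transform `∫ χ(ξ) exp (i s·ξ) dξ`. -/
noncomputable def oscillatory (χ : EuclideanSpace ℝ (Fin n) → ℝ) (s : EuclideanSpace ℝ (Fin n)) :
    ℂ :=
  ∫ ξ, (χ ξ : ℂ) * Complex.exp (Complex.I * (inner ℝ s ξ : ℝ))

open FourierTransform in
-- This is the Fourier transform of χ rescaled by −1/(2π). Integrability holds since χ is a Schwartz
-- function, and the total mass is Fourier inversion at the origin.
theorem integrable_oscillatory (hχ : ContDiff ℝ ∞ χ) (hχc : HasCompactSupport χ) :
    Integrable (oscillatory χ) ∧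
      ∫ s, oscillatory χ s = ((2 * Real.pi) ^ n : ℝ) * χ 0 := by
  set f : EuclideanSpace ℝ (Fin n) → ℂ := fun ξ => (χ ξ : ℂ) with hf
  have hfs : ContDiff ℝ ∞ f := Complex.ofRealCLM.contDiff.comp hχ
  have hfc : HasCompactSupport f := hχc.comp_left (g := Complex.ofReal) (by simp)
  have hfi : Integrable f := hfs.continuous.integrable_of_hasCompactSupport hfc
  have hFi : Integrable (𝓕 f) := by
    have := (𝓕 (hfc.toSchwartzMap hfs)).integrable (μ := volume)
    rwa [SchwartzMap.fourier_coe] at this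
  have heq : oscillatory χ = fun s => 𝓕 f ((-(2 * Real.pi)⁻¹) • s) := by
    ext1 s
    rw [oscillatory, Real.fourier_eq']
    refine integral_congr_ae (ae_of_all _ fun ξ => ?_)
    simp only [inner_smul_right, hf, smul_eq_mul]
    rw [mul_comm, real_inner_comm]
    congr 2
    have : (Real.pi : ℂ) ≠ 0 := by exact_mod_cast Real.pi_ne_zero
    push_cast
    field_simp
  have hne : (-(2 * Real.pi)⁻¹ : ℝ) ≠ 0 := by
    have := Real.pi_pos
    simp [this.ne']
  refine ⟨?_, ?_⟩
  · rw [heq]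
    exact hFi.comp_smul hne
  · rw [heq, Measure.integral_comp_smul]
    have h1 := hfi.fourierInv_fourier_eq hFi (v := 0) hfs.continuous.continuousAt
    rw [Real.fourierInv_eq'] at h1
    simp only [inner_zero_right, mul_zero, Complex.ofReal_zero, zero_mul, Complex.exp_zero,
      one_smul] at h1
    rw [h1, finrank_euclideanSpace_fin, hf, Complex.real_smul]
    congr 2
    rw [abs_inv, abs_pow, abs_neg, abs_of_pos (by positivity), inv_pow, inv_inv]

theorem fbiKernel_toComplex_smul {t : ℝ} (ht : 0 < t) (s ξ : EuclideanSpace ℝ (Fin n)) :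
    fbiKernel t (toComplex (t • s)) ξ =
      Complex.exp (Complex.I * (inner ℝ s ξ : ℝ)) * (Real.exp (-(t * ‖s‖ ^ 2 / 2)) : ℂ) := by
  have htC : (t : ℂ) ≠ 0 := by exact_mod_cast ht.ne'
  rw [fbiKernel, Complex.ofReal_exp, ← Complex.exp_add]
  congr 1
  rw [EuclideanSpace.norm_sq_eq, PiLp.inner_apply]
  simp only [toComplex_apply, PiLp.smul_apply, smul_eq_mul, Real.norm_eq_abs, sq_abs,
    RCLike.inner_apply, conj_trivial]
  push_cast
  have h1 : ∑ j, (t : ℂ) * s j * ξ j = t * ∑ j, (ξ j : ℂ) * s j := by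
    rw [Finset.mul_sum]
    exact Finset.sum_congr rfl fun j _ => by ring
  have h2 : ∑ j, ((t : ℂ) * s j) ^ 2 = t ^ 2 * ∑ j, (s j : ℂ) ^ 2 := by
    rw [Finset.mul_sum]
    exact Finset.sum_congr rfl fun j _ => by ring
  rw [h1, h2]
  field_simp
  ring

/-- The truncated inversion formula as a convolution with an approximate identity. -/
theorem fbiSynthesis_toComplex (hχ : ContDiff ℝ ∞ χ) (hB : ∀ ξ, B < ‖ξ‖ → χ ξ = 0)
    (hv : Measurable v) (hvA : ∀ y, ‖v y‖ ≤ A) {t : ℝ} (ht : 0 < t)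
    (x : EuclideanSpace ℝ (Fin n)) :
    ((t : ℂ) ^ n)⁻¹ * fbiSynthesis χ t v (toComplex x) =
      ∫ s, oscillatory χ s * (Real.exp (-(t * ‖s‖ ^ 2 / 2)) : ℂ) * v (x - t • s) := by
  have htC : (t : ℂ) ≠ 0 := by exact_mod_cast ht.ne'
  rw [fbiSynthesis_eq_integral_snd ht hχ.continuous hB hv hvA,
    ← integral_sub_left_eq_self (fun y => (∫ ξ, (χ ξ : ℂ) *
      fbiKernel t (toComplex x - toComplex y) ξ) * v y) volume x]
  -- The substitution y = x − ts uses up t^{-n} and leaves the phase independent of t; only the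
  -- factor e^{−t|s|²/2} → 1 remains.
  have h1 := Measure.integral_comp_smul (volume : Measure (EuclideanSpace ℝ (Fin n)))
    (fun y => (∫ ξ, (χ ξ : ℂ) * fbiKernel t (toComplex x - toComplex (x - y)) ξ) * v (x - y)) t
  rw [finrank_euclideanSpace_fin, abs_of_pos (by positivity), Complex.real_smul] at h1
  push_cast at h1
  rw [← h1]
  refine integral_congr_ae (ae_of_all _ fun s => ?_)
  simp only
  congr 1
  rw [oscillatory, ← integral_mul_const]
  refine integral_congr_ae (ae_of_all _ fun ξ => ?_)
  simp only
  rw [← toComplex_sub, sub_sub_cancel, fbiKernel_toComplex_smul ht, mul_assoc]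

/-- As v is merely bounded and measurable, the limit is taken against test functions: the
translation by ts moves onto the continuous φ, and dominated convergence applies. -/
theorem tendsto_integral_mul_fbiSynthesis (hχ : ContDiff ℝ ∞ χ) (hB : ∀ ξ, B < ‖ξ‖ → χ ξ = 0)
    (hv : Measurable v) (hvA : ∀ y, ‖v y‖ ≤ A) {φ : EuclideanSpace ℝ (Fin n) → ℝ}
    (hφ : Continuous φ) (hφc : HasCompactSupport φ) :
    Tendsto (fun t : ℝ => ∫ x, (φ x : ℂ) * (((t : ℂ) ^ n)⁻¹ * fbiSynthesis χ t v (toComplex x)))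
      (𝓝[>] 0) (𝓝 (((2 * Real.pi) ^ n : ℝ) * χ 0 * ∫ x, (φ x : ℂ) * v x)) := by
  have hA : 0 ≤ A := (norm_nonneg _).trans (hvA 0)
  obtain ⟨hψi, hψ⟩ := integrable_oscillatory hχ (hasCompactSupport_of_norm_gt hB)
  have hφi : Integrable fun x => (φ x : ℂ) := (hφ.integrable_of_hasCompactSupport hφc).ofReal
  have hexp1 : ∀ t : ℝ, 0 < t → ∀ s : EuclideanSpace ℝ (Fin n),
      ‖(Real.exp (-(t * ‖s‖ ^ 2 / 2)) : ℂ)‖ ≤ 1 := by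
    intro t ht s
    rw [Complex.norm_real, Real.norm_of_nonneg (Real.exp_pos _).le, Real.exp_le_one_iff]
    have : 0 ≤ t * ‖s‖ ^ 2 / 2 := by positivity
    linarith
  have hswap : ∀ t : ℝ, 0 < t → ∫ x, (φ x : ℂ) * (((t : ℂ) ^ n)⁻¹ * fbiSynthesis χ t v (toComplex x)) =
      ∫ s, oscillatory χ s * (Real.exp (-(t * ‖s‖ ^ 2 / 2)) : ℂ) *
        ∫ x, (φ (x + t • s) : ℂ) * v x := by
    intro t ht
    simp only [fbiSynthesis_toComplex hχ hB hv hvA ht, ← integral_const_mul]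
    rw [integral_integral_swap]
    · refine integral_congr_ae (ae_of_all _ fun s => ?_)
      simp only
      rw [← integral_add_right_eq_self (fun x => (φ x : ℂ) * (oscillatory χ s *
        (Real.exp (-(t * ‖s‖ ^ 2 / 2)) : ℂ) * v (x - t • s))) (t • s)]
      simp only [add_sub_cancel_right]
      refine integral_congr_ae (ae_of_all _ fun x => ?_)
      simp only
      ring
    · refine ((hφi.norm.mul_prod hψi.norm).mul_const A).mono' ?_ (ae_of_all _ fun p => ?_)
      · refine AEStronglyMeasurable.mul ?_ (AEStronglyMeasurable.mul
          (AEStronglyMeasurable.mul ?_ ?_) ?_)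
        · exact hφi.1.comp_fst
        · exact hψi.1.comp_snd
        · exact Continuous.aestronglyMeasurable (by fun_prop)
        · exact (hv.comp (by fun_prop)).aestronglyMeasurable
      · simp only [Function.uncurry_def]
        rw [norm_mul, norm_mul, norm_mul]
        calc _ ≤ ‖(φ p.1 : ℂ)‖ * (‖oscillatory χ p.2‖ * 1 * A) := by
              gcongr
              · exact hexp1 t ht p.2
              · exact hvA _
          _ = _ := by ring
  have hgoal : Tendsto (fun t : ℝ => ∫ s, oscillatory χ s *
      (Real.exp (-(t * ‖s‖ ^ 2 / 2)) : ℂ) * ∫ x, (φ (x + t • s) : ℂ) * v x) (𝓝[>] 0)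
      (𝓝 (∫ s, oscillatory χ s * ∫ x, (φ x : ℂ) * v x)) := by
    have hinner : ∀ (t : ℝ) (s : EuclideanSpace ℝ (Fin n)),
        ‖∫ x, (φ (x + t • s) : ℂ) * v x‖ ≤ (∫ x, ‖(φ x : ℂ)‖) * A := by
      intro t s
      rw [← integral_mul_const,
        ← integral_add_right_eq_self (fun x => ‖(φ x : ℂ)‖ * A) (t • s)]
      refine norm_integral_le_of_norm_le
        ((hφi.comp_add_right (t • s)).norm.mul_const A) (ae_of_all _ fun x => ?_)
      rw [norm_mul]
      gcongr
      exact hvA x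
    refine tendsto_integral_filter_of_dominated_convergence
      (fun s => ‖oscillatory χ s‖ * ((∫ x, ‖(φ x : ℂ)‖) * A)) ?_ ?_ (hψi.norm.mul_const _) ?_
    · refine Eventually.of_forall fun t => AEStronglyMeasurable.mul (hψi.1.mul ?_) ?_
      · exact Continuous.aestronglyMeasurable (by fun_prop)
      · have h1 : StronglyMeasurable (Function.uncurry fun s x : EuclideanSpace ℝ (Fin n) =>
            (φ (x + t • s) : ℂ) * v x) := by
          simp only [Function.uncurry_def]
          refine Measurable.stronglyMeasurable (Measurable.mul ?_ (hv.comp measurable_snd))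
          exact Continuous.measurable (by fun_prop)
        exact h1.integral_prod_right.aestronglyMeasurable
    · filter_upwards [self_mem_nhdsWithin] with t ht
      refine ae_of_all _ fun s => ?_
      rw [norm_mul, norm_mul]
      calc _ ≤ ‖oscillatory χ s‖ * 1 * ((∫ x, ‖(φ x : ℂ)‖) * A) := by
            gcongr
            · exact hexp1 t ht s
            · exact hinner t s
        _ = _ := by ring
    · refine ae_of_all _ fun s => ?_
      have h1 : Tendsto (fun t : ℝ => (Real.exp (-(t * ‖s‖ ^ 2 / 2)) : ℂ)) (𝓝[>] 0) (𝓝 1) := by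
        have : Continuous fun t : ℝ => (Real.exp (-(t * ‖s‖ ^ 2 / 2)) : ℂ) := by fun_prop
        simpa using (this.tendsto 0).mono_left nhdsWithin_le_nhds
      have h2 : Tendsto (fun t : ℝ => ∫ x, (φ (x + t • s) : ℂ) * v x) (𝓝[>] 0)
          (𝓝 (∫ x, (φ x : ℂ) * v x)) := by
        obtain ⟨R, hR⟩ := hφc.isBounded.subset_closedBall (0 : EuclideanSpace ℝ (Fin n))
        obtain ⟨C, hC⟩ := hφc.exists_bound_of_continuous hφ
        have hC0 : 0 ≤ C := (norm_nonneg _).trans (hC 0)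
        have hsupp : ∀ x, R < ‖x‖ → φ x = 0 := by
          intro x hx
          by_contra hne
          have := hR (subset_tsupport φ hne)
          rw [mem_closedBall_zero_iff] at this
          linarith
        refine tendsto_integral_filter_of_dominated_convergence
          ((Metric.closedBall (0 : EuclideanSpace ℝ (Fin n)) (R + ‖s‖)).indicator
            fun _ => C * A) ?_ ?_ ?_ ?_
        · refine Eventually.of_forall fun t => AEStronglyMeasurable.mul ?_ hv.aestronglyMeasurable
          exact Continuous.aestronglyMeasurable (by fun_prop)
        · filter_upwards [self_mem_nhdsWithin, Ioo_mem_nhdsGT (zero_lt_one' ℝ)] with t ht ht1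
          refine ae_of_all _ fun x => ?_
          by_cases hx : x ∈ Metric.closedBall (0 : EuclideanSpace ℝ (Fin n)) (R + ‖s‖)
          · rw [indicator_of_mem hx, norm_mul, Complex.norm_real]
            gcongr
            · exact hC _
            · exact hvA x
          · rw [indicator_of_notMem hx]
            rw [mem_closedBall_zero_iff, not_le] at hx
            rw [hsupp]
            · simp
            · have h3 := norm_sub_le (x + t • s) (t • s)
              rw [add_sub_cancel_right, norm_smul, Real.norm_of_nonneg ht1.1.le] at h3
              have h4 : t * ‖s‖ ≤ 1 * ‖s‖ := by
                gcongr
                exact ht1.2.le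
              linarith
        · exact (integrable_indicator_iff Metric.isClosed_closedBall.measurableSet).2
            (integrableOn_const (isCompact_closedBall _ _).measure_lt_top.ne)
        · refine ae_of_all _ fun x => Tendsto.mul_const _ ?_
          have : Continuous fun t : ℝ => (φ (x + t • s) : ℂ) := by fun_prop
          simpa using (this.tendsto 0).mono_left nhdsWithin_le_nhds
      simpa using (tendsto_const_nhds.mul h1).mul h2
  rw [integral_mul_const, hψ] at hgoal
  refine hgoal.congr' ?_
  filter_upwards [self_mem_nhdsWithin] with t ht
  exact (hswap t ht).symm

end WeakLimit

/-! ### Holomorphic limit of the truncated inversion formula. -/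

section Inversion

variable {n : ℕ} {χ : EuclideanSpace ℝ (Fin n) → ℝ} {v : EuclideanSpace ℝ (Fin n) → ℂ} {A B : ℝ}

/-- Exponential decay of the FBI integral at real points persists at nearby complex points. -/
theorem norm_integral_fbiKernel_mul_le_of_decay {t D r δ : ℝ} (ht : 0 < t) (hr : 0 < r)
    (hδ : 0 < δ) (hv : Measurable v) (hvA : ∀ y, ‖v y‖ ≤ A)
    (hD : ∫ y : EuclideanSpace ℝ (Fin n), Real.exp (-‖y‖ ^ 2 / (2 * t)) ≤ D)
    {ξ : EuclideanSpace ℝ (Fin n)} (hξ : ‖ξ‖ ≤ B) {x w : EuclideanSpace ℝ (Fin n)}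
    (hreal : ∀ x' ∈ Metric.closedBall x r,
      ‖∫ y, fbiKernel t (toComplex x' - toComplex y) ξ * v y‖ ≤ A * D * Real.exp (-δ / t))
    (hw : ‖w‖ ≤ r) (hw' : 4 * ‖w‖ * (δ + 2 * r * B + 2 * r ^ 2) ≤ r * δ) :
    ‖∫ y, fbiKernel t (toComplex x + Complex.I • toComplex w - toComplex y) ξ * v y‖ ≤
      A * D * Real.exp (-(δ / 2) / t) := by
  have hA : 0 ≤ A := (norm_nonneg _).trans (hvA 0)
  have hB : 0 ≤ B := (norm_nonneg _).trans hξ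
  -- On the complex ball of radius 2r the trivial bound is e^{(2rB + 2r²)/t}, so L/t with L = δ +
  -- 2rB + 2r² is its excess over the real decay e^{−δ/t}. By `hw'` the interpolated loss 2‖w‖L/r is
  -- at most δ/2.
  have h1 := two_constants_tube (F := fun z => ∫ y, fbiKernel t (z - toComplex y) ξ * v y)
    isOpen_univ (differentiable_integral_fbiKernel ht hv hvA ξ).differentiableOn (x := x) (w := w)
    (A := A * D * Real.exp (-δ / t)) (L := (δ + 2 * r * B + 2 * r ^ 2) / t) hr (by positivity)
    (subset_univ _) (fun z hz => ?_) hreal hw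
  · refine h1.trans ?_
    have hD0 : 0 ≤ D := (integral_nonneg fun y => (Real.exp_pos _).le).trans hD
    rw [mul_assoc (A * D), ← Real.exp_add]
    gcongr
    have h2 : 2 * ‖w‖ * ((δ + 2 * r * B + 2 * r ^ 2) / t) / r =
        2 * ‖w‖ * (δ + 2 * r * B + 2 * r ^ 2) / r / t := by field_simp
    rw [h2, ← add_div]
    gcongr
    have h3 : 2 * ‖w‖ * (δ + 2 * r * B + 2 * r ^ 2) / r ≤ δ / 2 := by
      rw [div_le_iff₀ hr]
      linarith
    linarith
  · refine (norm_integral_fbiKernel_mul_le ht hvA z ξ).trans ?_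
    have him : ‖imPart z‖ ≤ 2 * r := by
      rw [← imPart_sub_toComplex z x]
      exact (norm_imPart_le _).trans (mem_closedBall_iff_norm.1 hz)
    calc _ ≤ Real.exp ((2 * r * B + (2 * r) ^ 2 / 2) / t) * A * D := by
          gcongr
      _ = A * D * Real.exp (-δ / t + (δ + 2 * r * B + 2 * r ^ 2) / t) := by
          rw [← add_div]
          ring_nf
      _ = _ := by rw [Real.exp_add]; ring

theorem norm_fbiSynthesis_le_of_forall {b : EuclideanSpace ℝ (Fin n) → ℝ} {t S : ℝ} (ht : 0 < t)
    (hb : Continuous b) (hB : ∀ ξ, B < ‖ξ‖ → b ξ = 0) (hv : Measurable v) (hvA : ∀ y, ‖v y‖ ≤ A)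
    {z : EuclideanSpace ℂ (Fin n)}
    (hS : ∀ ξ, b ξ ≠ 0 → ‖∫ y, fbiKernel t (z - toComplex y) ξ * v y‖ ≤ S) :
    ‖fbiSynthesis b t v z‖ ≤ (∫ ξ, |b ξ|) * S := by
  rw [fbiSynthesis_eq_integral_fst ht hb hB hv hvA, ← integral_mul_const]
  refine norm_integral_le_of_norm_le ((hb.integrable_of_hasCompactSupport
    (hasCompactSupport_of_norm_gt hB)).abs.mul_const _) (ae_of_all _ fun ξ => ?_)
  rw [norm_mul, Complex.norm_real, Real.norm_eq_abs]
  by_cases h : b ξ = 0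
  · simp [h]
  · gcongr
    exact hS ξ h

/-- If the truncated inversion formula varies at bounded speed with the scale, it converges
uniformly to a holomorphic function. -/
theorem exists_limit_fbiSynthesis (hχ : ContDiff ℝ ∞ χ) (hB0 : 0 ≤ B)
    (hB : ∀ ξ, B < ‖ξ‖ → χ ξ = 0) (hv : Measurable v) (hvA : ∀ y, ‖v y‖ ≤ A)
    {W : Set (EuclideanSpace ℂ (Fin n))} (hW : IsOpen W) {h K : ℝ} (hh : 0 < h)
    (hK : ∀ t : ℝ, 0 < t → t ≤ h → ∀ z ∈ W,
      ‖((t : ℂ) ^ n)⁻¹ * fbiSynthesis (evolutionSymbol χ t) t v z‖ ≤ K) :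
    ∃ G : EuclideanSpace ℂ (Fin n) → ℂ, DifferentiableOn ℂ G W ∧
      ∀ t : ℝ, 0 < t → t ≤ h → ∀ z ∈ W,
        ‖((t : ℂ) ^ n)⁻¹ * fbiSynthesis χ t v z - G z‖ ≤ K * t := by
  set F : ℝ → EuclideanSpace ℂ (Fin n) → ℂ := fun t z => ((t : ℂ) ^ n)⁻¹ * fbiSynthesis χ t v z
    with hF
  have hlip : ∀ z ∈ W, ∀ s t : ℝ, 0 < s → s ≤ t → t ≤ h → ‖F t z - F s z‖ ≤ K * t := by
    intro z hz s t hs hst hth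
    have hK0 : 0 ≤ K := (norm_nonneg _).trans (hK h hh le_rfl z hz)
    have h1 := (convex_Ioc 0 h).norm_image_sub_le_of_norm_hasDerivWithin_le
      (f := fun t => F t z) (x := s) (y := t)
      (fun t ht => (hasDerivAt_fbiSynthesis hχ hB0 hB hv hvA z ht.1).hasDerivWithinAt)
      (fun t ht => hK t ht.1 ht.2 z hz) ⟨hs, hst.trans hth⟩ ⟨hs.trans_le hst, hth⟩
    refine h1.trans ?_
    rw [Real.norm_of_nonneg (sub_nonneg.2 hst)]
    gcongr
    linarith
  set τ : ℕ → ℝ := fun k => h / (k + 1) with hτ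
  have hτ0 : ∀ k, 0 < τ k := fun k => by positivity
  have hτh : ∀ k, τ k ≤ h := fun k => div_le_self hh.le (by simp)
  have hτanti : ∀ j k, j ≤ k → τ k ≤ τ j := fun j k hjk => by
    simp only [hτ]
    gcongr
  have hτlim : Tendsto τ atTop (𝓝 0) := by
    have := (tendsto_one_div_add_atTop_nhds_zero_nat (𝕜 := ℝ)).const_mul h
    simpa only [hτ, mul_one_div, mul_zero] using this
  have hcauchy : ∀ z ∈ W, ∃ g, Tendsto (fun k => F (τ k) z) atTop (𝓝 g) := by
    intro z hz
    have hK0 : 0 ≤ K := (norm_nonneg _).trans (hK h hh le_rfl z hz)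
    refine cauchySeq_tendsto_of_complete (cauchySeq_of_le_tendsto_0 (fun k => 2 * (K * τ k))
      (fun j k N hj hk => ?_) (by simpa using (hτlim.const_mul K).const_mul 2))
    have h1 := hlip z hz (τ j) (τ N) (hτ0 j) (hτanti N j hj) (hτh N)
    have h2 := hlip z hz (τ k) (τ N) (hτ0 k) (hτanti N k hk) (hτh N)
    rw [← dist_eq_norm] at h1 h2
    have := dist_triangle_left (F (τ j) z) (F (τ k) z) (F (τ N) z)
    linarith
  choose! G hG using hcauchy
  have hGF : ∀ t : ℝ, 0 < t → t ≤ h → ∀ z ∈ W, ‖F t z - G z‖ ≤ K * t := by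
    intro t ht hth z hz
    refine le_of_tendsto (tendsto_const_nhds.sub (hG z hz)).norm ?_
    filter_upwards [hτlim.eventually (Iic_mem_nhds ht)] with k hk
    exact hlip z hz (τ k) t (hτ0 k) hk hth
  refine ⟨G, differentiableOn_of_tendstoUniformlyOn hW (f := fun k => F (τ k)) (fun k => ?_) ?_,
    hGF⟩
  · exact ((differentiable_fbiSynthesis (hτ0 k) hχ.continuous hB hv hvA).const_mul
      _).differentiableOn
  · rw [Metric.tendstoUniformlyOn_iff]
    intro ε hε
    have h1 : Tendsto (fun k => K * τ k) atTop (𝓝 0) := by simpa using hτlim.const_mul K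
    filter_upwards [h1.eventually (Iio_mem_nhds hε)] with k hk z hz
    rw [dist_comm, dist_eq_norm]
    exact (hGF (τ k) (hτ0 k) (hτh k) z hz).trans_lt hk

/-- The limit of the truncated inversion formula recovers `v` at real points. -/
theorem ae_eq_of_limit_fbiSynthesis (hχ : ContDiff ℝ ∞ χ) (hB : ∀ ξ, B < ‖ξ‖ → χ ξ = 0)
    (hv : Measurable v) (hvA : ∀ y, ‖v y‖ ≤ A) {U : Set (EuclideanSpace ℝ (Fin n))} (hU : IsOpen U)
    {h K M : ℝ} (hh : 0 < h) {g : EuclideanSpace ℝ (Fin n) → ℂ} (hg : ContinuousOn g U)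
    (hgM : ∀ x ∈ U, ‖g x‖ ≤ M)
    (hK : ∀ t : ℝ, 0 < t → t ≤ h → ∀ x ∈ U,
      ‖((t : ℂ) ^ n)⁻¹ * fbiSynthesis χ t v (toComplex x) - g x‖ ≤ K * t) :
    ∀ᵐ x, x ∈ U → g x = ((2 * Real.pi) ^ n : ℝ) * χ 0 * v x := by
  set c : ℂ := ((2 * Real.pi) ^ n : ℝ) * χ 0 with hc
  have hvl : LocallyIntegrable v := by
    refine (locallyIntegrable_const A).mono hv.aestronglyMeasurable (ae_of_all _ fun y => ?_)
    exact (hvA y).trans (le_abs_self A)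
  have hloc : LocallyIntegrableOn (fun x => g x - c * v x) U :=
    (hg.locallyIntegrableOn hU.measurableSet).sub ((hvl.smul c).locallyIntegrableOn U)
  have key := hU.ae_eq_zero_of_integral_contDiff_smul_eq_zero hloc fun φ hφ hφc hφU => ?_
  · filter_upwards [key] with x hx hxU
    exact sub_eq_zero.1 (hx hxU)
  have hφ0 : ∀ x, x ∉ U → φ x = 0 := fun x hx => image_eq_zero_of_notMem_tsupport fun h => hx (hφU h)
  have hφi : Integrable fun x => (φ x : ℂ) :=
    (hφ.continuous.integrable_of_hasCompactSupport hφc).ofReal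
  have hφv : Integrable fun x => (φ x : ℂ) * (c * v x) := by
    refine hφi.mul_bdd (c := ‖c‖ * A) (hv.const_mul c).aestronglyMeasurable (ae_of_all _ fun x => ?_)
    rw [norm_mul]
    gcongr
    exact hvA x
  have hFm : ∀ t : ℝ, 0 < t → AEStronglyMeasurable fun x : EuclideanSpace ℝ (Fin n) =>
      (φ x : ℂ) * (((t : ℂ) ^ n)⁻¹ * fbiSynthesis χ t v (toComplex x)) := by
    intro t ht
    have h1 := (differentiable_fbiSynthesis ht hχ.continuous hB hv hvA).continuous.comp
      (continuous_toComplex (n := n))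
    exact hφi.1.mul (continuous_const.mul h1).aestronglyMeasurable
  -- The same integrals have two limits: the weak one, involving v, and the uniform one, involving
  -- g. Their equality for all test functions gives equality almost everywhere.
  have hlim1 := (tendsto_integral_mul_fbiSynthesis hχ hB hv hvA hφ.continuous hφc)
  have hev : ∀ᶠ t : ℝ in 𝓝[>] 0, t ∈ Ioc 0 h := Ioc_mem_nhdsGT hh
  have hptw : ∀ x, Tendsto (fun t : ℝ => (φ x : ℂ) * (((t : ℂ) ^ n)⁻¹ *
      fbiSynthesis χ t v (toComplex x))) (𝓝[>] 0) (𝓝 ((φ x : ℂ) * g x)) := by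
    intro x
    by_cases hx : x ∈ U
    · refine Tendsto.const_mul _ ?_
      rw [tendsto_iff_norm_sub_tendsto_zero]
      refine squeeze_zero' (Eventually.of_forall fun _ => norm_nonneg _)
        (hev.mono fun t ht => hK t ht.1 ht.2 x hx) ?_
      have : Continuous fun t : ℝ => K * t := by fun_prop
      simpa using (this.tendsto 0).mono_left nhdsWithin_le_nhds
    · simp [hφ0 x hx]
  have hlim2 : Tendsto (fun t : ℝ => ∫ x, (φ x : ℂ) * (((t : ℂ) ^ n)⁻¹ *
      fbiSynthesis χ t v (toComplex x))) (𝓝[>] 0) (𝓝 (∫ x, (φ x : ℂ) * g x)) := by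
    refine tendsto_integral_filter_of_dominated_convergence
      (fun x => ‖(φ x : ℂ)‖ * (M + |K| * h)) (hev.mono fun t ht => hFm t ht.1)
      (hev.mono fun t ht => ae_of_all _ fun x => ?_) (hφi.norm.mul_const _) (ae_of_all _ hptw)
    by_cases hx : x ∈ U
    · rw [norm_mul]
      gcongr
      have h1 := hK t ht.1 ht.2 x hx
      have h2 : K * t ≤ |K| * h := mul_le_mul (le_abs_self K) ht.2 ht.1.le (abs_nonneg K)
      have h3 := norm_le_norm_add_norm_sub' (((t : ℂ) ^ n)⁻¹ * fbiSynthesis χ t v (toComplex x))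
        (g x)
      linarith [hgM x hx]
    · simp [hφ0 x hx]
  have heq := tendsto_nhds_unique hlim2 hlim1
  have hgm : AEStronglyMeasurable fun x => (φ x : ℂ) * g x := by
    -- Nothing is known of g outside U, but φ vanishes there.
    have h1 : (fun x => (φ x : ℂ) * g x) = U.indicator fun x => (φ x : ℂ) * g x := by
      ext x
      by_cases hx : x ∈ U
      · rw [indicator_of_mem hx]
      · rw [indicator_of_notMem hx, hφ0 x hx]
        simp
    rw [h1, aestronglyMeasurable_indicator_iff hU.measurableSet]
    exact hφi.1.restrict.mul (hg.aestronglyMeasurable hU.measurableSet)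
  have hgi : Integrable fun x => (φ x : ℂ) * g x := by
    refine (hφi.norm.mul_const M).mono' hgm (ae_of_all _ fun x => ?_)
    by_cases hx : x ∈ U
    · rw [norm_mul]
      gcongr
      exact hgM x hx
    · simp [hφ0 x hx]
  simp only [Complex.real_smul, mul_sub]
  rw [integral_sub hgi hφv, heq, sub_eq_zero, ← integral_const_mul]
  refine integral_congr_ae (ae_of_all _ fun x => ?_)
  simp only
  ring

end Inversion

/-! ### From decay of the FBI transform to the holomorphic extension. -/

section FBIToHolomorphic

variable {n : ℕ}

theorem exists_measurable_bounded_ae_eq {v : EuclideanSpace ℝ (Fin n) → ℂ} {A : ℝ} (hA : 0 ≤ A)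
    (hvm : AEStronglyMeasurable v) (hv : ∀ᵐ y, ‖v y‖ ≤ A) :
    ∃ v' : EuclideanSpace ℝ (Fin n) → ℂ, Measurable v' ∧ (∀ y, ‖v' y‖ ≤ A) ∧ v =ᵐ[volume] v' := by
  have hm := hvm.stronglyMeasurable_mk.measurable
  refine ⟨{y | ‖hvm.mk v y‖ ≤ A}.indicator (hvm.mk v),
    hm.indicator (measurableSet_le hm.norm measurable_const), fun y => ?_, ?_⟩
  · by_cases hy : y ∈ {y | ‖hvm.mk v y‖ ≤ A}
    · rw [indicator_of_mem hy]; exact hy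
    · rw [indicator_of_notMem hy, norm_zero]; exact hA
  · filter_upwards [hvm.ae_eq_mk, hv] with y h1 h2
    have hy : y ∈ {y | ‖hvm.mk v y‖ ≤ A} := show ‖hvm.mk v y‖ ≤ A by rwa [← h1]
    rw [indicator_of_mem hy, h1]

/-- Removing the normalisation of the FBI transform. -/
theorem norm_integral_fbiKernel_le_of_fbi {v : EuclideanSpace ℝ (Fin n) → ℂ}
    {x ξ : EuclideanSpace ℝ (Fin n)} {t h₀ M : ℝ} (ht : 0 < t) (hth : t ≤ h₀)
    (hM : ‖fbi t v x ξ‖ ≤ M) :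
    ‖∫ y, fbiKernel t (toComplex x - toComplex y) ξ * v y‖ ≤
      M / ((2 : ℝ) ^ (-(n : ℝ) / 2) * (Real.pi * h₀) ^ (-(3 * (n : ℝ)) / 4)) := by
  have hh₀ : 0 < h₀ := ht.trans_le hth
  have := Real.pi_pos
  rw [fbi_eq, norm_mul, Complex.norm_real, Real.norm_of_nonneg (by positivity)] at hM
  rw [le_div_iff₀ (by positivity), mul_comm]
  refine le_trans ?_ hM
  gcongr ?_ * ?_ * ?_
  refine Real.rpow_le_rpow_of_nonpos (by positivity) (by gcongr) ?_
  have : 0 ≤ 3 * (n : ℝ) / 4 := by positivity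
  linarith

set_option maxHeartbeats 1000000 in
-- The limit G of the truncated inversion formula, divided by (2π)^n, is the extension. Convergence
-- uses the decay at all scales t ≤ h, while the bound on G is read off at t = h.
theorem FBIDecay.holomorphicExtension {X : Set (EuclideanSpace ℝ (Fin n))}
    {x₀ : EuclideanSpace ℝ (Fin n)} {h₀ : ℝ} {u : ℝ → EuclideanSpace ℝ (Fin n) → ℂ}
    (hh₀ : 0 < h₀) (hXm : MeasurableSet X)
    (hu : ∀ h : ℝ, 0 < h → h ≤ h₀ → MemLp (u h) ⊤ (volume.restrict X))
    (H : FBIDecay X x₀ h₀ u) : HolomorphicExtension X x₀ h₀ u := by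
  obtain ⟨V, hV, hx₀, ⟨-, hVX⟩, C₀, C₁, δ, hC₀, hC₁, hδ, hfbi⟩ := H
  obtain ⟨R, hR, hRV⟩ := Metric.nhds_basis_closedBall.mem_iff.1 (hV.mem_nhds hx₀)
  have hπ := Real.pi_pos
  let χ' : ContDiffBump (0 : EuclideanSpace ℝ (Fin n)) := ⟨C₀, C₀ + 1, hC₀, by linarith⟩
  set χ : EuclideanSpace ℝ (Fin n) → ℝ := fun ξ => χ' ξ with hχdef
  set B := C₀ + 1 with hBdef
  have hB0 : 0 ≤ B := by positivity
  have hχ : ContDiff ℝ ∞ χ := χ'.contDiff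
  have hχB : ∀ ξ, B < ‖ξ‖ → χ ξ = 0 := fun ξ hξ =>
    χ'.zero_of_le_dist (by rw [dist_zero_right]; exact hξ.le)
  have hχ1 : ∀ ξ ∈ Metric.ball (0 : EuclideanSpace ℝ (Fin n)) C₀, χ ξ = 1 := fun ξ hξ =>
    χ'.one_of_mem_closedBall (Metric.ball_subset_closedBall hξ)
  have hχ0 : χ 0 = 1 := hχ1 0 (Metric.mem_ball_self hC₀)
  obtain ⟨M₁, M₂, hM₁, hM₂, hM⟩ := exists_integral_abs_evolutionSymbol_le hχ hχB
  set ρ := R / 2 with hρ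
  have hρ0 : 0 < ρ := by positivity
  set L := δ + 2 * ρ * B + 2 * ρ ^ 2 with hL
  have hL0 : 0 < L := by positivity
  -- The largest imaginary part for which interpolation still keeps half of the decay rate δ.
  set s := min ρ (ρ * δ / (4 * L)) with hs
  have hs0 : 0 < s := by positivity
  have hsρ : s ≤ ρ := min_le_left _ _
  have hsL : 4 * s * L ≤ ρ * δ := by
    have : s ≤ ρ * δ / (4 * L) := min_le_right _ _
    rw [le_div_iff₀ (by positivity)] at this
    linarith
  set c₀ := (2 : ℝ) ^ (-(n : ℝ) / 2) * (Real.pi * h₀) ^ (-(3 * (n : ℝ)) / 4) with hc₀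
  have hc₀0 : 0 < c₀ := by positivity
  set I₀ := ∫ y : EuclideanSpace ℝ (Fin n), Real.exp (-‖y‖ ^ 2 / (2 * h₀)) with hI₀
  have hI₀0 : 0 ≤ I₀ := integral_nonneg fun y => (Real.exp_pos _).le
  have hI : ∀ t : ℝ, 0 < t → t ≤ h₀ →
      ∫ y : EuclideanSpace ℝ (Fin n), Real.exp (-‖y‖ ^ 2 / (2 * t)) ≤ I₀ := by
    intro t ht hth
    have h1 := integrable_gaussian (b := 2 * h₀) (by positivity) (0 : EuclideanSpace ℝ (Fin n))
    simp only [zero_sub, norm_neg] at h1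
    refine integral_mono_of_nonneg (ae_of_all _ fun y => (Real.exp_pos _).le) h1
      (ae_of_all _ fun y => Real.exp_le_exp.2 ?_)
    rw [neg_div (2 * t) _, neg_div (2 * h₀) _, neg_le_neg_iff]
    gcongr
  -- One constant serves both as the real decay constant, freed of the FBI normalisation, and as a
  -- bound for the Gaussian integrals; the interpolation needs the same D in both.
  set D := C₁ / c₀ + I₀ with hD
  have hD0 : 0 ≤ D := by positivity
  obtain ⟨Ce, hCe, hCeb⟩ := exists_rpow_neg_mul_exp_le (q := (n : ℝ) + 1) (δ := δ / 2)
    (by positivity) (by positivity)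
  obtain ⟨Cn, hCn, hCnb⟩ := exists_rpow_neg_mul_exp_le (q := (n : ℝ)) (δ := 2)
    (by positivity) two_pos
  set D' := Ce * ((M₁ + M₂ * h₀) * D) with hD'
  have hD'0 : 0 ≤ D' := by positivity
  set Iχ := ∫ ξ, |χ ξ| with hIχ
  have hIχ0 : 0 ≤ Iχ := integral_nonneg fun _ => abs_nonneg _
  set κ := ρ * B + ρ ^ 2 / 2 with hκ
  have hκ0 : 0 ≤ κ := by positivity
  set Q := Cn * Iχ * I₀ + D' * h₀ with hQ
  have hQ0 : 0 ≤ Q := by positivity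
  have hballV : ∀ {x}, x ∈ Metric.ball x₀ s → Metric.closedBall x ρ ⊆ V := fun {x} hx =>
    (Metric.closedBall_subset_closedBall' (by
      rw [Metric.mem_ball] at hx
      linarith)).trans hRV
  have him : ∀ {z}, z ∈ Metric.ball (toComplex x₀) s → ‖imPart z‖ ≤ s := fun {z} hz => by
    rw [← imPart_sub_toComplex z x₀]
    exact (norm_imPart_le _).trans (mem_ball_iff_norm.1 hz).le
  have hre : ∀ {z}, z ∈ Metric.ball (toComplex x₀) s → rePart z ∈ Metric.ball x₀ s :=
    fun {z} hz => by
      rw [mem_ball_iff_norm, ← rePart_sub_toComplex]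
      exact (norm_rePart_le _).trans_lt (mem_ball_iff_norm.1 hz)
  refine ⟨Metric.ball (toComplex x₀) s, Metric.isOpen_ball, Metric.mem_ball_self hs0,
    compactlyContained_ball fun z hz => ?_, κ + 1, (Q + 1) / (2 * Real.pi) ^ n, by positivity,
    by positivity, fun h hh hhh₀ => ?_⟩
  · refine hVX (subset_closure (hRV ?_))
    rw [mem_closedBall_iff_norm] at hz
    rw [mem_closedBall_iff_norm, ← rePart_sub_toComplex]
    exact (norm_rePart_le _).trans (by linarith)
  set A := supNorm X (u h) with hA
  have hA0 : 0 ≤ A := supNorm_nonneg _ _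
  obtain ⟨v, hv, hvA, hvu⟩ := exists_measurable_bounded_ae_eq hA0
    (aestronglyMeasurable_indicator_of_memLp hXm (hu h hh hhh₀))
    (ae_norm_indicator_le hXm (hu h hh hhh₀))
  have hdecay : ∀ t : ℝ, 0 < t → t ≤ h → ∀ z ∈ Metric.ball (toComplex x₀) s,
      ∀ ξ, evolutionSymbol χ t ξ ≠ 0 →
      ‖∫ y, fbiKernel t (z - toComplex y) ξ * v y‖ ≤ A * D * Real.exp (-(δ / 2) / t) := by
    intro t ht hth z hz ξ hξ
    have hξB : ‖ξ‖ ≤ B := by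
      by_contra! hlt
      exact hξ (evolutionSymbol_eq_zero_of_norm_gt hχB t ξ hlt)
    have hξC : C₀ ≤ ‖ξ‖ := by
      by_contra! hlt
      exact hξ (evolutionSymbol_eq_zero Metric.isOpen_ball hχ1 t ξ (by simpa using hlt))
    rw [eq_toComplex_add z]
    refine norm_integral_fbiKernel_mul_le_of_decay ht hρ0 hδ hv hvA
      ((hI t ht (hth.trans hhh₀)).trans (le_add_of_nonneg_left (by positivity))) hξB
      (fun x hx => ?_) ((him hz).trans hsρ) (le_trans ?_ hsL)
    · have h1 : ∫ y, fbiKernel t (toComplex x - toComplex y) ξ * v y =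
          ∫ y, fbiKernel t (toComplex x - toComplex y) ξ * X.indicator (u h) y := by
        refine integral_congr_ae ?_
        filter_upwards [hvu] with y hy
        rw [hy]
      rw [h1]
      refine (norm_integral_fbiKernel_le_of_fbi ht (hth.trans hhh₀)
        (hfbi t h ht hth hhh₀ x (hballV (hre hz) hx) ξ hξC)).trans ?_
      calc C₁ * Real.exp (-δ / t) * A / c₀ = A * (C₁ / c₀) * Real.exp (-δ / t) := by ring
        _ ≤ _ := by
          gcongr
          exact le_add_of_nonneg_right hI₀0
    · gcongr
      exact him hz
  have hK : ∀ t : ℝ, 0 < t → t ≤ h → ∀ z ∈ Metric.ball (toComplex x₀) s,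
      ‖((t : ℂ) ^ n)⁻¹ * fbiSynthesis (evolutionSymbol χ t) t v z‖ ≤ A * D' := by
    intro t ht hth z hz
    have h1 := norm_fbiSynthesis_le_of_forall ht (continuous_evolutionSymbol hχ t)
      (evolutionSymbol_eq_zero_of_norm_gt hχB t) hv hvA (hdecay t ht hth z hz)
    -- With this 1/t the total prefactor is t^{−(n+1)}, which half of the remaining decay absorbs.
    have h2 : ∫ ξ, |evolutionSymbol χ t ξ| ≤ (M₁ + M₂ * h₀) * t⁻¹ := by
      refine (hM t ht).trans ?_
      have : M₂ * t ≤ M₂ * h₀ := by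
        gcongr
        exact hth.trans hhh₀
      rw [← div_eq_mul_inv, le_div_iff₀ ht, add_mul, div_mul_cancel₀ _ ht.ne']
      linarith
    have h3 : (t ^ n)⁻¹ * t⁻¹ = t ^ (-((n : ℝ) + 1)) := by
      rw [Real.rpow_neg ht.le, ← mul_inv, ← pow_succ, ← Real.rpow_natCast]
      push_cast
      rfl
    have h4 : Real.exp (-(δ / 2 / 2) / t) ≤ 1 := by
      rw [Real.exp_le_one_iff, neg_div]
      have : 0 ≤ δ / 2 / 2 / t := by positivity
      linarith
    rw [norm_mul, norm_inv, norm_pow, Complex.norm_real, Real.norm_of_nonneg ht.le]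
    calc _ ≤ (t ^ n)⁻¹ * ((M₁ + M₂ * h₀) * t⁻¹ * (A * D * Real.exp (-(δ / 2) / t))) := by
          gcongr
          exact h1.trans (by gcongr)
      _ = (M₁ + M₂ * h₀) * D * A * (t ^ (-((n : ℝ) + 1)) * Real.exp (-(δ / 2) / t)) := by
          rw [← h3]; ring
      _ ≤ (M₁ + M₂ * h₀) * D * A * (Ce * 1) :=
          mul_le_mul_of_nonneg_left ((hCeb t ht).trans (by gcongr)) (by positivity)
      _ = _ := by rw [hD']; ring
  obtain ⟨G, hGd, hGF⟩ := exists_limit_fbiSynthesis hχ hB0 hχB hv hvA Metric.isOpen_ball hh hK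
  -- G is within A D' h of the formula at scale h, whose growth is e^{κ/h}. The extra 1 in κ + 1
  -- pays for h^{-n}.
  have hGb : ∀ z ∈ Metric.ball (toComplex x₀) s, ‖G z‖ ≤ Q * Real.exp ((κ + 1) / h) * A := by
    intro z hz
    have h1 := norm_fbiSynthesis_le hh hχ.continuous hχB hv hvA z
    have h2 : (‖imPart z‖ * B + ‖imPart z‖ ^ 2 / 2) / h ≤ κ / h := by
      have := (him hz).trans hsρ
      rw [hκ]
      gcongr
    have h3 : (h ^ n)⁻¹ ≤ Cn * Real.exp (1 / h) := by
      have h4 := hCnb h hh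
      rw [Real.rpow_neg hh.le, Real.rpow_natCast] at h4
      have h5 : Real.exp (-(2 / 2) / h) = Real.exp (1 / h) * Real.exp (-2 / h) := by
        rw [← Real.exp_add]
        ring_nf
      rw [h5, ← mul_assoc] at h4
      exact le_of_mul_le_mul_right h4 (Real.exp_pos _)
    have h6 : ‖((h : ℂ) ^ n)⁻¹ * fbiSynthesis χ h v z‖ ≤
        Cn * Iχ * I₀ * Real.exp ((κ + 1) / h) * A := by
      rw [norm_mul, norm_inv, norm_pow, Complex.norm_real, Real.norm_of_nonneg hh.le]
      calc _ ≤ Cn * Real.exp (1 / h) * (Iχ * Real.exp (κ / h) * A * I₀) := by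
            gcongr
            refine h1.trans ?_
            gcongr
            exact hI h hh hhh₀
        _ = _ := by rw [add_div κ, Real.exp_add]; ring
    have h7 := hGF h hh le_rfl z hz
    have h8 : A * D' * h ≤ D' * h₀ * Real.exp ((κ + 1) / h) * A := by
      have : 1 ≤ Real.exp ((κ + 1) / h) := Real.one_le_exp (by positivity)
      calc A * D' * h ≤ A * D' * h₀ := by gcongr
        _ = D' * h₀ * 1 * A := by ring
        _ ≤ _ := by gcongr
    have h9 := norm_le_norm_add_norm_sub (((h : ℂ) ^ n)⁻¹ * fbiSynthesis χ h v z) (G z)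
    have h10 : Q * Real.exp ((κ + 1) / h) * A = Cn * Iχ * I₀ * Real.exp ((κ + 1) / h) * A +
        D' * h₀ * Real.exp ((κ + 1) / h) * A := by rw [hQ]; ring
    linarith
  have hae := ae_eq_of_limit_fbiSynthesis hχ hχB hv hvA (Metric.isOpen_ball (x := x₀) (ε := s)) hh
    (g := fun x => G (toComplex x))
    (hGd.continuousOn.comp continuous_toComplex.continuousOn fun x hx => toComplex_mem_ball.2 hx)
    (fun x hx => hGb _ (toComplex_mem_ball.2 hx))
    (fun t ht hth x hx => hGF t ht hth _ (toComplex_mem_ball.2 hx))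
  have hne : (((2 * Real.pi) ^ n : ℝ) : ℂ) ≠ 0 := by
    exact_mod_cast (pow_pos (by positivity : 0 < 2 * Real.pi) n).ne'
  refine ⟨fun z => (((2 * Real.pi) ^ n : ℝ) : ℂ)⁻¹ * G z, hGd.const_mul _, ?_, fun z hz => ?_⟩
  · filter_upwards [hae, hvu] with x hx hxu hxs
    have hxs' := toComplex_mem_ball.1 hxs
    have hxX : x ∈ X := hVX (subset_closure (hballV hxs' (Metric.mem_closedBall_self hρ0.le)))
    rw [hx hxs', hχ0, Complex.ofReal_one, mul_one, inv_mul_cancel_left₀ hne, ← hxu,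
      indicator_of_mem hxX]
  · rw [norm_mul, norm_inv, Complex.norm_real, Real.norm_of_nonneg (by positivity)]
    calc _ ≤ ((2 * Real.pi) ^ n)⁻¹ * ((Q + 1) * Real.exp ((κ + 1) / h) * A) := by
          gcongr
          refine (hGb z hz).trans ?_
          gcongr
          linarith
      _ = _ := by ring

end FBIToHolomorphic
end SemiclassicalCauchy

theorem mainTheorem2 (n : ℕ) (x₀ : EuclideanSpace ℝ (Fin n))
    (X : Set (EuclideanSpace ℝ (Fin n))) (hX : X ∈ 𝓝 x₀) (hXm : MeasurableSet X)
    (h₀ : ℝ) (hh₀ : 0 < h₀)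
    (u : ℝ → EuclideanSpace ℝ (Fin n) → ℂ)
    (hu : ∀ h : ℝ, 0 < h → h ≤ h₀ → MemLp (u h) ∞ (volume.restrict X))
    (N : ℝ)
    (hN : (fun h : ℝ => SemiclassicalCauchy.supNorm X (u h)) =O[𝓝[>] 0]
      (fun h : ℝ => h ^ (-N))) :
    List.TFAE
      [SemiclassicalCauchy.FBIDecay X x₀ h₀ u,
       SemiclassicalCauchy.HolomorphicExtension X x₀ h₀ u,
       SemiclassicalCauchy.CauchyEstimates X x₀ h₀ u] := by
  tfae_have 1 → 2 := fun H => H.holomorphicExtension hh₀ hXm hu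
  tfae_have 2 → 1 := fun H => H.fbiDecay hh₀ hXm hu
  tfae_have 2 → 3 := fun H => H.cauchyEstimates hh₀ hXm hu
  tfae_have 3 → 2 := fun H => H.holomorphicExtension
  tfae_finish
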